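/- \textbf{Setting.} Fix a first-order signature of function symbols with equality $\approx$ as the only predicate, an infinite set of variables, and a \emph{desired} term ordering $\prec_T$: a well-founded rewrite ordering (irreflexive, transitive, closed under substitutions and contexts) that is total on ground terms and has only finitely many ground terms below each ground term. Literals are $s\approx t$ and $s\not\approx t$ (sides unordered), $comp$ is the complement, clauses are finite multisets of literals, substitutions have finite domain. A literal $s\approx t$ is compared through the multiset $\{s,t\}$, $s\not\approx t$ through $\{s,s,t,t\}$, clauses through the multiset extension; $L\prec_T\beta$ means that this multiset is below $\{\beta\}$. $\models$ is entailment in first-order logic with equality and $gnd(N)$ the set of ground instances of $N$. For an ordering $\prec$ on ground literals (extended to ground clauses as multisets), a ground clause $C$ is \emph{redundant} w.r.t. $\prec$ and a set $N$ of ground clauses if $\{D\in N\mid D\preceq C\}\models C$; a clause is redundant w.r.t. $\prec$ and $N$ if all its ground instances are redundant w.r.t. $\prec$ and $gnd(N)$. \textbf{Trails.} A trail $\Gamma=[L_1,\dots,L_n]$ is a consistent sequence of ground literals $L_j=K\sigma$, each annotated with a level (non-decreasing along $\Gamma$) and a closure $(K\lor C)\cdot\sigma$ (a clause with a grounding substitution),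 such that $L_j$ is undefined in $[L_1,\dots,L_{j-1}]$ and irreducible by $conv([L_1,\dots,L_{j-1}])$, where $conv(\Gamma)$ is a convergent $\prec_T$-oriented rewrite system for the positive equations of $\Gamma$. A ground literal $L$ is true (false) in $\Gamma$ if $\Gamma\models L$ ($\Gamma\models comp(L)$), defined if it is true or false; a ground clause is true if $\Gamma$ entails it, false if all its literals are false, undefined otherwise. $\beta$-true, $\beta$-false, $\beta$-defined mean in addition $\prec_T\beta$; $\beta$-undefined means undefined or $\succ_T\beta$. $L_j$ is a decision literal if its level is one more than the level of its predecessor ($0$ if there is none), otherwise it is propagated. A core of a defined literal $L$ is an inclusion-minimal subsequence of $\Gamma$ in which $L$ is defined; the defining literal of $L$ is the smallest (in trail order) among the last literals of its cores. The level of $L$ is its annotation if $L\in\Gamma$, otherwise the level of its defining literal, or $0$ if its core is empty; the level of a clause is the maximum over its literals ($0$ for $\bot$). \textbf{Trail induced ordering} $\prec_{\Gamma^*}$, for a ground term $\beta$: $\beta$-defined literals of level $0$ come first, ordered by $\prec_T$; then the $\beta$-defined literals of positive level, ordered by the position in $\Gamma$ of the defining literal $L_i$, and for equal $L_i$ in the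 order $L_i$, $comp(L_i)$, then the remaining ones ordered by $\prec_T$; then all $\beta$-undefined ground literals, ordered by $\prec_T$. \textbf{Rewrite inferences.} Given variable disjoint closures $(l\approx r\lor C_1)\cdot\sigma_1$, with $r\sigma_1\prec_T l\sigma_1$, and $(K\lor C_2)\cdot\sigma_2$, with $K\sigma_2|_p=l\sigma_1$: if $p$ is a position of $K$ and $\mu=mgu(K|_p,l)$, infer $(K[r]_p\mu\lor C_1\mu\lor C_2\mu)\cdot\sigma_1\sigma_2$ with rewrite literal $K[r]_p\mu$; otherwise let $K\delta$ be the most general instance of $K$ that has position $p$, where $\delta$ introduces only fresh variables and $K\delta\sigma_2\rho=K\sigma_2$ with $\rho$ minimal, let $\mu=mgu(K\delta|_p,l)$, and infer $(K\delta[r]_p\mu\lor C_1\mu\lor C_2\delta\mu)\cdot\sigma_1\sigma_2\rho$ with rewrite literal $K\delta[r]_p\mu$. (Mgus are idempotent and introduce no fresh variables.) A reduction chain from $\Gamma$ is a finite sequence of closures with marked rewrite literals, each (a renamed copy of) an annotation in $\Gamma$ or inferred from earlier ones. A reduction chain application from $\Gamma$ to an annotated literal $A=L\sigma^{(L\lor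 C)\cdot\sigma}$ is a minimal reduction chain from $\Gamma,A$ whose last rewrite literal has as ground instance the $conv(\Gamma)$-normal form of $L\sigma$; a refutation from $\Gamma$ and $A$ is a minimal reduction chain from $\Gamma,A$ whose last rewrite literal has a ground instance $s\not\approx s$. \textbf{Calculus SCL(EQ).} States are $(\Gamma;N;U;\beta;k;D)$ with $\beta$ a ground term, $D$ being $\top$, $\bot$ or a closure. Unmentioned components stay unchanged. \begin{itemize} \item Propagate ($D=\top$): if $C_0\lor C_1\lor L\in N\cup U$ with grounding $\sigma$ irreducible by $conv(\Gamma)$, $C_0\sigma$ false in $\Gamma$, $C_1\sigma=L\sigma\lor\dots\lor L\sigma$, $\mu$ the mgu of $L$ and the literals of $C_1$, $L\sigma$ $\beta$-undefined, $(C_0\lor L)\mu\sigma\prec_T\beta$: take a reduction chain application from $\Gamma$ to $L\sigma$ annotated with $k$ and $(L\lor C_0)\mu\cdot\sigma$, with last closure $(K\lor C')\cdot\sigma'$ and rewrite literal $K$, and append $K\sigma'$ annotated with $k$ and $(K\lor C')\cdot\sigma'$ to $\Gamma$. \item Decide ($D=\top$): if $C_0\lor L\in N\cup U$ with grounding $\sigma$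 irreducible by $conv(\Gamma)$, $C_0\sigma$ $\beta$-undefined or $\beta$-true, $L\sigma$ $\beta$-undefined, $(C_0\lor L)\sigma\prec_T\beta$: take a reduction chain application from $\Gamma$ to $L\sigma$ annotated with $k+1$ and $(L\lor C_0)\cdot\sigma$, with last rewrite literal $K$ and substitution $\sigma'$, append $K\sigma'$ annotated with $k+1$ and $(K\lor comp(K))\cdot\sigma'$, and set $k:=k+1$. \item Conflict ($D=\top$): if $C\in N\cup U$ and $C\sigma$ is ground and $\beta$-false in $\Gamma$, $\sigma$ irreducible by $conv(\Gamma)$: $D:=\bot$ if $C\sigma$ has level $0$, otherwise $D:=C\cdot\sigma$. \item Skip ($D=C\cdot\sigma$, $\Gamma=\Gamma_0,K,L$): if $C\sigma$ is $\beta$-false in $\Gamma_0,K$, drop $L$ and set $k$ to the level of $K$. \item Explore-Refutation ($D=(C\lor L)\cdot\sigma$): if $L\sigma$ is strictly $\prec_{\Gamma^*}$-maximal in $(C\lor L)\sigma$ and its defining literal is the last literal of $\Gamma$, replace $D$ by a closure $C'\cdot\sigma'$ of a refutation from $\Gamma$ and $L\sigma$ (annotated with $(C\lor L)\cdot\sigma$)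 such that $C'\sigma'\prec_{\Gamma^*}(C\lor L)\sigma$ is ground and $\beta$-false in $\Gamma$. \item Factorize: replace $(C\lor L\lor L')\cdot\sigma$ with $L\sigma=L'\sigma$ by $(C\lor L)\mu\cdot\sigma$, $\mu=mgu(L,L')$. Equality-Resolution: replace $(C\lor s\not\approx s')\cdot\sigma$ with $s\sigma=s'\sigma$ by $C\mu\cdot\sigma$, $\mu=mgu(s,s')$. \item Backtrack ($\Gamma=\Gamma_0,K,\Gamma_1$, $D=(C\lor L)\cdot\sigma$): if $C\sigma$ has level $<k$, and some ground instance of $C\lor L$ is $\beta$-false in $\Gamma_0,K$ but none is in $\Gamma_0$, go to $(\Gamma_0;N;U\cup\{C\lor L\};\beta;j-i;\top)$, where $j$ is the level of $K$, $i=1$ if $K$ is a decision literal and $i=0$ otherwise. The clause $C\lor L$ is \emph{learned}. \item Grow ($D=\top$): go to $(\epsilon;N;U;\beta';0;\top)$ for a ground term $\beta'\succ_T\beta$. \end{itemize} A run is a sequence of rule applications from $(\epsilon;N;\emptyset;\beta;0;\top)$. It is \emph{regular} if (1) Conflict and Factorize have precedence over all other rules; (2) if $k=0$, Propagate has precedence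 over Decide; (3) Decide never appends $comp(L)$ if Propagate could append $L$ annotated with a clause from $N\cup U$ in the same state; (4) between an application of Conflict and the Backtrack that follows it, Skip is applied at least once, unless Conflict was applied immediately after Decide; (5) if Conflict was applied immediately after Decide, the following Backtrack is applied to $C\cdot\sigma$ only if $comp(L')\in C\sigma$ for the last literal $L'$ of the trail. \textbf{Lemma (Non-Redundant Clause Learning).} Let $N$ be a set of clauses and consider a regular run of SCL(EQ) from $N$. \begin{enumerate} \item Suppose Backtrack is applied in a state $(\Gamma';N;U;\beta;l;C\cdot\sigma)$, so that $C$ is learned, and let $\Gamma$ be the trail of any state of the conflict resolution phase that this Backtrack ends (from the state produced by Conflict up to the state before Backtrack; in particular $\Gamma=\Gamma'$ is allowed). Then $C$ is not redundant with respect to $\prec_{\Gamma^*}$ and $N\cup U$; indeed its ground instance $C\sigma$ is not redundant with respect to $\prec_{\Gamma^*}$ and $gnd(N\cup U)$. \item For the trail only non-redundant clauses need to be considered: let $(\Gamma;N;U;\beta;k;D)$ be a state of the run and let $L_j$ be a propagated literal of $\Gamma=[L_1,\dots,L_n]$ of level greater than zero with annotation $C_j\cdot\sigma_j$. Say that $E\cdot\delta$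 \emph{can justify} $L_j$ if $E=D'\lor K$ with $K\delta=L_j$, $D'\delta$ is $\beta$-false in $[L_1,\dots,L_{j-1}]$, and $\Gamma$ is still a trail when the annotation of $L_j$ is replaced by $(D'\lor K)\cdot\delta$. \begin{enumerate} \item If $G$ is a set of closures $E\cdot\delta$ with $E\in N\cup U$ such that $E\delta\prec_{\Gamma^*}C_j\sigma_j$ for all of them and $\{E\delta\mid E\cdot\delta\in G\}\models C_j\sigma_j$, then some closure in $G$ can justify $L_j$. \item If $C_j\sigma_j$ is entailed by the clauses in $gnd(N\cup U)$ that are strictly $\prec_{\Gamma^*}$-smaller than $C_j\sigma_j$, then there are $E\in N\cup U$ and $\delta$ such that $E\cdot\delta$ can justify $L_j$ and $E\delta$ is not entailed by the clauses in $gnd(N\cup U)$ that are strictly $\prec_{\Gamma^*}$-smaller than $E\delta$. \end{enumerate} \end{enumerate} -/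

import Mathlib

universe u v w

namespace SCLEQ

section

variable {Sg : FirstOrder.Language.{u, v}} {V : Type w}

/-! ### Terms, substitutions, positions -/

open Classical in
/-- The variables occurring in a term. -/
noncomputable def vars (t : Sg.Term V) : Finset V := t.varFinset

/-- A term without variables. -/
def TermGround (t : Sg.Term V) : Prop := vars t = ∅

/-- The subterm of a term at a position (arguments are numbered from `0`), if the position exists. -/
def termAt : Sg.Term V → List ℕ → Option (Sg.Term V)
  | t, [] => some t
  | .var _, _ :: _ => none
  | @FirstOrder.Language.Term.func _ _ n _ ts, i :: p => if h : i < n then termAt (ts ⟨i, h⟩) p else none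

/-- Replacement of the subterm at a position (no change if the position does not exist). -/
def termReplace : Sg.Term V → List ℕ → Sg.Term V → Sg.Term V
  | _, [], r => r
  | .var x, _ :: _, _ => .var x
  | @FirstOrder.Language.Term.func _ _ n f ts, i :: p, r =>
      if h : i < n then
        .func f (Function.update ts ⟨i, h⟩ (termReplace (ts ⟨i, h⟩) p r))
      else .func f ts

/-- Substitutions: total maps from variables to terms with finite domain. -/
structure Subst (Sg : FirstOrder.Language.{u, v}) (V : Type w) where
  map : V → Sg.Term V
  finite_dom : {x | map x ≠ .var x}.Finite

/-- The domain of a substitution. -/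
def Subst.dom (σ : Subst Sg V) : Set V := {x | σ.map x ≠ .var x}

/-- Diagrammatic composition: first `σ`, then `τ`. -/
def Subst.comp (σ τ : Subst Sg V) : Subst Sg V where
  map x := (σ.map x).subst τ.map
  finite_dom := by
    refine (σ.finite_dom.union τ.finite_dom).subset ?_
    intro x hx
    by_contra h
    simp only [Set.mem_union, Set.mem_ofPred_eq, not_or, not_not] at h
    exact hx (by simp [h.1, h.2, FirstOrder.Language.Term.subst])

/-- The substitution transported along a renaming `π` of the variables: if `σ` is grounding for an
object `X`, then this one maps the renamed copy of `X` to the same ground instance. -/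
def Subst.conj (σ : Subst Sg V) (π : Equiv.Perm V) : Subst Sg V where
  map x := (σ.map (π.symm x)).relabel π
  finite_dom := by
    refine (σ.finite_dom.image π).subset ?_
    intro x hx
    refine ⟨π.symm x, ?_, by simp⟩
    intro h
    exact hx (by simp [h, FirstOrder.Language.Term.relabel])

/-- `σ` unifies all pairs in `E`. -/
def Unifies (σ : Subst Sg V) (E : Set (Sg.Term V × Sg.Term V)) : Prop :=
  ∀ e ∈ E, e.1.subst σ.map = e.2.subst σ.map

/-- `μ` is an idempotent most general unifier of `E` that does not introduce fresh variables. -/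
structure IsMGU (μ : Subst Sg V) (E : Set (Sg.Term V × Sg.Term V)) : Prop where
  unifies : Unifies μ E
  mostGeneral : ∀ τ : Subst Sg V, Unifies τ E → ∃ ρ : Subst Sg V, τ = μ.comp ρ
  idempotent : μ.comp μ = μ
  noFresh : ∀ x ∈ μ.dom, ∀ y, (y = x ∨ y ∈ vars (μ.map x)) →
    ∃ e ∈ E, y ∈ vars e.1 ∨ y ∈ vars e.2

/-! ### Literals and clauses -/

/-- Equational literals. `pos = true` is an equation, `pos = false` an inequation; `s ≈ t` and
`t ≈ s` are the same literal. -/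
@[ext]
structure Literal (Sg : FirstOrder.Language.{u, v}) (V : Type w) where
  pos : Bool
  eqn : Sym2 (Sg.Term V)

namespace Literal

/-- The complement. -/
def comp (L : Literal Sg V) : Literal Sg V := ⟨!L.pos, L.eqn⟩

def subst (L : Literal Sg V) (σ : Subst Sg V) : Literal Sg V :=
  ⟨L.pos, L.eqn.map (fun t => t.subst σ.map)⟩

def rename (L : Literal Sg V) (π : Equiv.Perm V) : Literal Sg V :=
  ⟨L.pos, L.eqn.map (fun t => t.relabel π)⟩

def Ground (L : Literal Sg V) : Prop := ∀ t ∈ L.eqn, TermGround t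

/-- The multiset used for comparing literals: `{s, t}` for `s ≈ t`, `{s, s, t, t}` for `s ≉ t`. -/
def terms (L : Literal Sg V) : Multiset (Sg.Term V) :=
  if L.pos then L.eqn.toMultiset else L.eqn.toMultiset + L.eqn.toMultiset

/-- Truth of a literal in a structure under a valuation. -/
def Holds (L : Literal Sg V) {M : Type*} [Sg.Structure M] (ν : V → M) : Prop :=
  (L.eqn.map (fun t => t.realize ν)).IsDiag ↔ L.pos = true

end Literal

/-- Clauses are multisets of literals. -/
abbrev Clause (Sg : FirstOrder.Language.{u, v}) (V : Type w) := Multiset (Literal Sg V)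

namespace Clause

def subst (C : Clause Sg V) (σ : Subst Sg V) : Clause Sg V := C.map (fun L => L.subst σ)

def rename (C : Clause Sg V) (π : Equiv.Perm V) : Clause Sg V := C.map (fun L => L.rename π)

def Ground (C : Clause Sg V) : Prop := ∀ L ∈ C, L.Ground

def vars (C : Clause Sg V) : Set V := {x | ∃ L ∈ C, ∃ t ∈ L.eqn, x ∈ SCLEQ.vars t}

end Clause

/-- All ground instances of clauses in `N`. -/
def gnd (N : Set (Clause Sg V)) : Set (Clause Sg V) :=
  {D | ∃ C ∈ N, ∃ σ : Subst Sg V, D = C.subst σ ∧ D.Ground}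

/-- First-order entailment with equality; clauses are read as universally closed disjunctions. -/
def Entails (N : Set (Clause Sg V)) (C : Clause Sg V) : Prop :=
  ∀ (M : Type (max u w)) [Nonempty M] [Sg.Structure M],
    (∀ D ∈ N, ∀ ν : V → M, ∃ L ∈ D, L.Holds ν) → ∀ ν : V → M, ∃ L ∈ C, L.Holds ν

/-! ### Orderings -/

/-- The multiset extension of a strict ordering. -/
def MulExt {α : Type*} (r : α → α → Prop) (M N : Multiset α) : Prop :=
  ∃ X Y Z : Multiset α, Z ≠ 0 ∧ M = X + Y ∧ N = X + Z ∧ ∀ y ∈ Y, ∃ z ∈ Z, r y z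

/-- Desired term orderings: well-founded rewrite orderings, total on ground terms, such that there
are only finitely many ground terms below each ground term. -/
structure DesiredOrdering (lt : Sg.Term V → Sg.Term V → Prop) : Prop where
  irrefl : ∀ s, ¬ lt s s
  trans : ∀ s t r, lt s t → lt t r → lt s r
  wf : WellFounded lt
  subst : ∀ s t, lt s t → ∀ σ : Subst Sg V, lt (s.subst σ.map) (t.subst σ.map)
  context : ∀ s t, lt s t → ∀ (c : Sg.Term V) (p : List ℕ), (termAt c p).isSome →
    lt (termReplace c p s) (termReplace c p t)
  total : ∀ s t, TermGround s → TermGround t → lt s t ∨ s = t ∨ lt t s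
  finite : ∀ t, TermGround t → {s | TermGround s ∧ lt s t}.Finite

variable (lt : Sg.Term V → Sg.Term V → Prop)

/-- The term ordering on literals. -/
def LitLT (L K : Literal Sg V) : Prop := MulExt lt L.terms K.terms

/-- `L ≺_T β`. -/
def LitBelow (β : Sg.Term V) (L : Literal Sg V) : Prop := MulExt lt L.terms {β}

/-- `β ≺_T L`. -/
def LitAbove (β : Sg.Term V) (L : Literal Sg V) : Prop := MulExt lt {β} L.terms

/-- `C ≺_T β`. -/
def ClauseBelow (β : Sg.Term V) (C : Clause Sg V) : Prop :=
  MulExt (MulExt lt) (C.map Literal.terms) {{β}}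

/-- `β ≺_T C`. -/
def ClauseAbove (β : Sg.Term V) (C : Clause Sg V) : Prop :=
  MulExt (MulExt lt) {{β}} (C.map Literal.terms)

/-- A ground clause `C` is redundant w.r.t. a set `N` of ground clauses and an ordering `r` on ground
literals if the clauses of `N` that are smaller than or equal to `C` entail `C`. -/
def GroundRedundant (r : Literal Sg V → Literal Sg V → Prop) (N : Set (Clause Sg V))
    (C : Clause Sg V) : Prop :=
  Entails {D | D ∈ N ∧ (D = C ∨ MulExt r D C)} C

/-- A clause is redundant w.r.t. `N` if all its ground instances are redundant w.r.t. the ground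
instances of `N`. -/
def Redundant (r : Literal Sg V → Literal Sg V → Prop) (N : Set (Clause Sg V))
    (C : Clause Sg V) : Prop :=
  ∀ C' ∈ gnd {C}, GroundRedundant r (gnd N) C'

/-- The ground clause `C` is entailed by strictly smaller clauses of `N`. -/
def EntailedBySmaller (r : Literal Sg V → Literal Sg V → Prop) (N : Set (Clause Sg V))
    (C : Clause Sg V) : Prop :=
  Entails {D | D ∈ N ∧ MulExt r D C} C

/-! ### Rewriting -/

/-- One rewrite step with a term rewrite system `R`. -/
def Rewrites (R : Set (Sg.Term V × Sg.Term V)) (s t : Sg.Term V) : Prop :=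
  ∃ lr ∈ R, ∃ (p : List ℕ) (σ : Subst Sg V),
    termAt s p = some (lr.1.subst σ.map) ∧ t = termReplace s p (lr.2.subst σ.map)

def TermIrreducible (R : Set (Sg.Term V × Sg.Term V)) (t : Sg.Term V) : Prop :=
  ¬ ∃ t', Rewrites R t t'

def LitIrreducible (R : Set (Sg.Term V × Sg.Term V)) (L : Literal Sg V) : Prop :=
  ∀ t ∈ L.eqn, TermIrreducible R t

def SubstIrreducible (R : Set (Sg.Term V × Sg.Term V)) (σ : Subst Sg V) : Prop :=
  ∀ x ∈ σ.dom, TermIrreducible R (σ.map x)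

/-- `s` is a normal form of `t`. -/
def IsNormalForm (R : Set (Sg.Term V × Sg.Term V)) (t s : Sg.Term V) : Prop :=
  Relation.ReflTransGen (Rewrites R) t s ∧ TermIrreducible R s

/-- A convergent rewrite system for the positive equations in `Γ`: all ground equations that they
entail, oriented by the term ordering. Any other convergent, `≺_T`-oriented system for the same
equational theory has the same normal forms, because the normal form of a ground term is the least
ground term that is equal to it. -/
def conv (Γ : List (Literal Sg V)) : Set (Sg.Term V × Sg.Term V) :=
  {lr | TermGround lr.1 ∧ TermGround lr.2 ∧ lt lr.2 lr.1 ∧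
    Entails {D | ∃ L ∈ Γ, L.pos = true ∧ D = {L}} {⟨true, s(lr.1, lr.2)⟩}}

/-! ### Trails -/

/-- An annotated literal `Lσ^{level : (L ∨ C)·σ}`, with `lit = L` and `rest = C`. -/
structure AnnLit (Sg : FirstOrder.Language.{u, v}) (V : Type w) where
  level : ℕ
  lit : Literal Sg V
  rest : Clause Sg V
  sub : Subst Sg V

namespace AnnLit

/-- The annotated ground literal. -/
def ground (A : AnnLit Sg V) : Literal Sg V := A.lit.subst A.sub

/-- The annotating clause. -/
def clause (A : AnnLit Sg V) : Clause Sg V := A.lit ::ₘ A.rest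

/-- The ground instance of the annotating closure. -/
def groundClause (A : AnnLit Sg V) : Clause Sg V := A.clause.subst A.sub

end AnnLit

/-- The sequence of ground literals of an annotated sequence. -/
def lits (Γ : List (AnnLit Sg V)) : List (Literal Sg V) := Γ.map AnnLit.ground

/-- The literals of a sequence as unit clauses. -/
def units (Γ : List (Literal Sg V)) : Set (Clause Sg V) := {D | ∃ L ∈ Γ, D = {L}}

def LitTrue (Γ : List (Literal Sg V)) (L : Literal Sg V) : Prop := Entails (units Γ) {L}

def LitFalse (Γ : List (Literal Sg V)) (L : Literal Sg V) : Prop := Entails (units Γ) {L.comp}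

def LitDefined (Γ : List (Literal Sg V)) (L : Literal Sg V) : Prop := LitTrue Γ L ∨ LitFalse Γ L

def Consistent (Γ : List (Literal Sg V)) : Prop := ¬ Entails (units Γ) 0

/-- A clause is true in `Γ` if `Γ` entails it. -/
def ClauseTrue (Γ : List (Literal Sg V)) (C : Clause Sg V) : Prop := Entails (units Γ) C

/-- A clause is false in `Γ` if `Γ` entails its negation, i.e. if all its literals are false. -/
def ClauseFalse (Γ : List (Literal Sg V)) (C : Clause Sg V) : Prop := ∀ L ∈ C, LitFalse Γ L

def ClauseUndefined (Γ : List (Literal Sg V)) (C : Clause Sg V) : Prop :=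
  ¬ ClauseTrue Γ C ∧ ¬ ClauseFalse Γ C

/-- `β`-defined literals: defined and smaller than `β`. -/
def BetaDefined (β : Sg.Term V) (Γ : List (Literal Sg V)) (L : Literal Sg V) : Prop :=
  LitBelow lt β L ∧ LitDefined Γ L

def BetaUndefined (β : Sg.Term V) (Γ : List (Literal Sg V)) (L : Literal Sg V) : Prop :=
  LitAbove lt β L ∨ ¬ LitDefined Γ L

def ClauseBetaTrue (β : Sg.Term V) (Γ : List (Literal Sg V)) (C : Clause Sg V) : Prop :=
  ClauseBelow lt β C ∧ ClauseTrue Γ C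

def ClauseBetaFalse (β : Sg.Term V) (Γ : List (Literal Sg V)) (C : Clause Sg V) : Prop :=
  ClauseBelow lt β C ∧ ClauseFalse Γ C

def ClauseBetaUndefined (β : Sg.Term V) (Γ : List (Literal Sg V)) (C : Clause Sg V) : Prop :=
  ClauseAbove lt β C ∨ ClauseUndefined Γ C

/-- Trails. -/
structure IsTrail (Γ : List (AnnLit Sg V)) : Prop where
  closures : ∀ A ∈ Γ, A.groundClause.Ground
  consistent : Consistent (lits Γ)
  levels : Γ.Pairwise (fun A B => A.level ≤ B.level)
  undefined : ∀ (i : ℕ) (A : AnnLit Sg V), Γ[i]? = some A → ¬ LitDefined (lits (Γ.take i)) A.ground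
  irreducible : ∀ (i : ℕ) (A : AnnLit Sg V), Γ[i]? = some A →
    LitIrreducible (conv lt (lits (Γ.take i))) A.ground

/-- The level of the last literal of `Γ`, and `0` if `Γ` is empty. -/
def lastLevel (Γ : List (AnnLit Sg V)) : ℕ := (Γ.getLast?.map AnnLit.level).getD 0

/-- `K`, placed directly after `Γ`, is a decision literal: it opens a new level. -/
def IsDecision (Γ : List (AnnLit Sg V)) (K : AnnLit Sg V) : Prop := K.level = lastLevel Γ + 1

/-- The subsequence of `Γ` given by a set of indices. -/
def sublits (Γ : List (AnnLit Sg V)) (I : Finset ℕ) : Set (Clause Sg V) :=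
  {D | ∃ i ∈ I, ∃ A, Γ[i]? = some A ∧ D = {A.ground}}

/-- `L` is defined in the subsequence of `Γ` given by `I`. -/
def DefinedBy (Γ : List (AnnLit Sg V)) (I : Finset ℕ) (L : Literal Sg V) : Prop :=
  Entails (sublits Γ I) {L} ∨ Entails (sublits Γ I) {L.comp}

/-- Cores: minimal subsequences of `Γ` in which `L` is defined. -/
def IsCore (Γ : List (AnnLit Sg V)) (L : Literal Sg V) (I : Finset ℕ) : Prop :=
  I ⊆ Finset.range Γ.length ∧ DefinedBy Γ I L ∧ ∀ J, J ⊂ I → ¬ DefinedBy Γ J L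

/-- The literal of `Γ` with index `i` is the defining literal of `L`: it is the largest element of
some core, and no core has a smaller largest element. -/
def IsDefining (Γ : List (AnnLit Sg V)) (L : Literal Sg V) (i : ℕ) : Prop :=
  (∃ I, IsCore Γ L I ∧ IsGreatest (I : Set ℕ) i) ∧
    ∀ J, IsCore Γ L J → ∀ j, IsGreatest (J : Set ℕ) j → i ≤ j

open Classical in
/-- The level of a ground literal that is defined in `Γ`. -/
noncomputable def litLevel (Γ : List (AnnLit Sg V)) (L : Literal Sg V) : ℕ :=
  match Γ.find? (fun A => decide (A.ground = L)) with
  | some A => A.level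
  | none =>
    if h : ∃ i A, Γ[i]? = some A ∧ IsDefining Γ L i then h.choose_spec.choose.level else 0

/-- The level of a clause: the maximal level of its literals, and `0` for the empty clause. -/
noncomputable def clauseLevel (Γ : List (AnnLit Sg V)) (C : Clause Sg V) : ℕ :=
  (C.map (litLevel Γ)).sup

/-- `L` is the `i`-th literal of the trail. -/
def IsTrailLit (Γ : List (AnnLit Sg V)) (i : ℕ) (L : Literal Sg V) : Prop :=
  ∃ A, Γ[i]? = some A ∧ A.ground = L

/-- `L` is one of the `β`-defined literals outside `Γ ∪ comp(Γ)` with defining literal `Γ_i`. -/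
def IsOther (β : Sg.Term V) (Γ : List (AnnLit Sg V)) (i : ℕ) (L : Literal Sg V) : Prop :=
  L.Ground ∧ BetaDefined lt β (lits Γ) L ∧ L ∉ lits Γ ∧ L.comp ∉ lits Γ ∧ IsDefining Γ L i

/-- Ground `β`-defined literals of level greater than zero. -/
def PosLevel (β : Sg.Term V) (Γ : List (AnnLit Sg V)) (L : Literal Sg V) : Prop :=
  L.Ground ∧ BetaDefined lt β (lits Γ) L ∧ 0 < litLevel Γ L

/-- Ground `β`-defined literals of level zero. -/
def ZeroLevel (β : Sg.Term V) (Γ : List (AnnLit Sg V)) (L : Literal Sg V) : Prop :=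
  L.Ground ∧ BetaDefined lt β (lits Γ) L ∧ litLevel Γ L = 0

/-- The trail induced ordering `≺_{Γ*}` on ground literals. -/
inductive TrailLT (β : Sg.Term V) (Γ : List (AnnLit Sg V)) : Literal Sg V → Literal Sg V → Prop
  | other_other {L K i j} : PosLevel lt β Γ L → PosLevel lt β Γ K →
      IsOther lt β Γ i L → IsOther lt β Γ j K → (i < j ∨ (i = j ∧ LitLT lt L K)) →
      TrailLT β Γ L K
  | lit_lit {L K i j} : PosLevel lt β Γ L → PosLevel lt β Γ K →
      IsTrailLit Γ i L → IsTrailLit Γ j K → i < j → TrailLT β Γ L K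
  | comp_lit {L K i j} : PosLevel lt β Γ L → PosLevel lt β Γ K →
      IsTrailLit Γ i L.comp → IsTrailLit Γ j K → i < j → TrailLT β Γ L K
  | lit_comp {L K i j} : PosLevel lt β Γ L → PosLevel lt β Γ K →
      IsTrailLit Γ i L → IsTrailLit Γ j K.comp → i ≤ j → TrailLT β Γ L K
  | comp_comp {L K i j} : PosLevel lt β Γ L → PosLevel lt β Γ K →
      IsTrailLit Γ i L.comp → IsTrailLit Γ j K.comp → i < j → TrailLT β Γ L K
  | trail_other {L K i j} : PosLevel lt β Γ L → PosLevel lt β Γ K →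
      (IsTrailLit Γ i L ∨ IsTrailLit Γ i L.comp) → IsOther lt β Γ j K → i ≤ j → TrailLT β Γ L K
  | other_trail {L K i j} : PosLevel lt β Γ L → PosLevel lt β Γ K →
      IsOther lt β Γ i L → (IsTrailLit Γ j K ∨ IsTrailLit Γ j K.comp) → i < j → TrailLT β Γ L K
  | zero_zero {L K} : ZeroLevel lt β Γ L → ZeroLevel lt β Γ K → LitLT lt L K → TrailLT β Γ L K
  | zero_pos {L K} : ZeroLevel lt β Γ L → PosLevel lt β Γ K → TrailLT β Γ L K
  | undef_undef {L K} : L.Ground → K.Ground → ¬ BetaDefined lt β (lits Γ) L →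
      ¬ BetaDefined lt β (lits Γ) K → LitLT lt L K → TrailLT β Γ L K
  | def_undef {L K} : L.Ground → K.Ground → BetaDefined lt β (lits Γ) L →
      ¬ BetaDefined lt β (lits Γ) K → TrailLT β Γ L K

/-! ### Rewrite inferences -/

/-- A literal with a chosen order of its two sides. -/
structure EqLit (Sg : FirstOrder.Language.{u, v}) (V : Type w) where
  pos : Bool
  lhs : Sg.Term V
  rhs : Sg.Term V

namespace EqLit

def toLit (e : EqLit Sg V) : Literal Sg V := ⟨e.pos, s(e.lhs, e.rhs)⟩

def subst (e : EqLit Sg V) (σ : Subst Sg V) : EqLit Sg V :=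
  ⟨e.pos, e.lhs.subst σ.map, e.rhs.subst σ.map⟩

/-- The subterm at a position; `0 :: p` is below the left side and `1 :: p` below the right one. -/
def at? (e : EqLit Sg V) : List ℕ → Option (Sg.Term V)
  | 0 :: p => termAt e.lhs p
  | 1 :: p => termAt e.rhs p
  | _ => none

/-- Replacement of the subterm at a position. -/
def replace (e : EqLit Sg V) : List ℕ → Sg.Term V → EqLit Sg V
  | 0 :: p, r => ⟨e.pos, termReplace e.lhs p r, e.rhs⟩
  | 1 :: p, r => ⟨e.pos, e.lhs, termReplace e.rhs p r⟩
  | _, _ => e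

end EqLit

/-- Rewrite steps `(L·σ, (L ∨ C)·σ, R, S, p)`; `base` is the case in which the last three
components are empty. -/
inductive RewriteStep (Sg : FirstOrder.Language.{u, v}) (V : Type w) where
  | base (L : EqLit Sg V) (C : Clause Sg V) (σ : Subst Sg V)
  | infer (L : EqLit Sg V) (C : Clause Sg V) (σ : Subst Sg V) (R S : RewriteStep Sg V)
      (p : List ℕ)

namespace RewriteStep

/-- The rewrite literal. -/
def lit : RewriteStep Sg V → EqLit Sg V
  | base L _ _ => L
  | infer L _ _ _ _ _ => L

/-- The clause without the rewrite literal. -/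
def rest : RewriteStep Sg V → Clause Sg V
  | base _ C _ => C
  | infer _ C _ _ _ _ => C

def sub : RewriteStep Sg V → Subst Sg V
  | base _ _ σ => σ
  | infer _ _ σ _ _ _ => σ

def clause (I : RewriteStep Sg V) : Clause Sg V := I.lit.toLit ::ₘ I.rest

/-- All variables that a rewrite step involves. -/
def allVars (I : RewriteStep Sg V) : Set V := I.clause.vars ∪ I.sub.dom

end RewriteStep

/-- `δ` is a most general substitution that makes `p` a position of `e`, introduces only fresh
variables, and has `eσ` as an instance via `ρ`, where `ρ` is minimal. -/
structure IsExpansion (e : EqLit Sg V) (p : List ℕ) (σ : Subst Sg V) (used : Set V)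
    (δ ρ : Subst Sg V) : Prop where
  position : ((e.subst δ).at? p).isSome
  dom : ∀ x ∈ δ.dom, x ∈ vars e.lhs ∨ x ∈ vars e.rhs
  fresh : ∀ x ∈ δ.dom, ∀ y ∈ vars (δ.map x), y ∉ used
  factors : ((e.subst δ).subst σ).subst ρ = e.subst σ
  minimal : ∀ ρ' : Subst Sg V, ((e.subst δ).subst σ).subst ρ' = e.subst σ → ρ.dom ⊆ ρ'.dom
  mostGeneral : ∀ δ' ρ' : Subst Sg V, ((e.subst δ').at? p).isSome →
    (e.subst δ').subst ρ' = e.subst σ → ∃ θ : Subst Sg V, e.subst δ' = (e.subst δ).subst θ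

/-- `(L·σ, (L ∨ C)·σ, I₁, I₂, p)` is the result of a rewrite inference: an instance of the left side
of the equation of `I₁` is replaced at position `p` of the literal of `I₂`, where `p` may lie below
a variable position. -/
inductive RewriteInference (I₁ I₂ : RewriteStep Sg V) (p : List ℕ) :
    EqLit Sg V → Clause Sg V → Subst Sg V → Prop
  | direct {l r t : Sg.Term V} {μ : Subst Sg V} :
      Disjoint I₁.allVars I₂.allVars →
      (I₁.lit = ⟨true, l, r⟩ ∨ I₁.lit = ⟨true, r, l⟩) →
      lt (r.subst I₁.sub.map) (l.subst I₁.sub.map) →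
      (I₂.lit.subst I₂.sub).at? p = some (l.subst I₁.sub.map) →
      I₂.lit.at? p = some t →
      IsMGU μ {(t, l)} →
      RewriteInference I₁ I₂ p ((I₂.lit.replace p r).subst μ)
        (I₁.rest.subst μ + I₂.rest.subst μ) (I₁.sub.comp I₂.sub)
  | belowVar {l r t : Sg.Term V} {μ δ ρ : Subst Sg V} :
      Disjoint I₁.allVars I₂.allVars →
      (I₁.lit = ⟨true, l, r⟩ ∨ I₁.lit = ⟨true, r, l⟩) →
      lt (r.subst I₁.sub.map) (l.subst I₁.sub.map) →
      (I₂.lit.subst I₂.sub).at? p = some (l.subst I₁.sub.map) →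
      I₂.lit.at? p = none →
      IsExpansion I₂.lit p I₂.sub (I₁.allVars ∪ I₂.allVars) δ ρ →
      (I₂.lit.subst δ).at? p = some t →
      IsMGU μ {(t, l)} →
      RewriteInference I₁ I₂ p (((I₂.lit.subst δ).replace p r).subst μ)
        (I₁.rest.subst μ + (I₂.rest.subst δ).subst μ) ((I₁.sub.comp I₂.sub).comp ρ)

/-- Reduction chains from `Γ`. Clauses are considered up to renaming of variables, so a closure from
`Γ` may be taken with renamed variables. -/
def IsReductionChain (Γ : List (AnnLit Sg V)) (P : List (RewriteStep Sg V)) : Prop :=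
  ∀ (i : ℕ) (I : RewriteStep Sg V), P[i]? = some I →
    (∃ A ∈ Γ, ∃ (π : Equiv.Perm V) (e : EqLit Sg V), e.toLit = A.lit.rename π ∧
      I = .base e (A.rest.rename π) (A.sub.conj π)) ∨
    (∃ R ∈ P.take i, ∃ S ∈ P.take i, ∃ e C σ p,
      I = .infer e C σ R S p ∧ RewriteInference lt R S p e C σ)

/-- A reduction chain from `Γ, A` whose last literal is the normal form of the ground literal of `A`
w.r.t. `conv Γ`. -/
def Reduces (Γ : List (AnnLit Sg V)) (A : AnnLit Sg V) (P : List (RewriteStep Sg V)) : Prop :=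
  IsReductionChain lt (Γ ++ [A]) P ∧
  ∃ I, P.getLast? = some I ∧ ∃ s t : Sg.Term V, A.ground = ⟨I.lit.pos, s(s, t)⟩ ∧
    IsNormalForm (conv lt (lits Γ)) s (I.lit.subst I.sub).lhs ∧
    IsNormalForm (conv lt (lits Γ)) t (I.lit.subst I.sub).rhs

/-- Reduction chain applications from `Γ` to `A`: minimal chains that reduce `A`. -/
def IsReductionChainApplication (Γ : List (AnnLit Sg V)) (A : AnnLit Sg V)
    (P : List (RewriteStep Sg V)) : Prop :=
  Reduces lt Γ A P ∧ ∀ i < P.length, ¬ Reduces lt Γ A (P.eraseIdx i)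

/-- A reduction chain from `Γ, A` that ends in a literal `s ≉ s`. -/
def Refutes (Γ : List (AnnLit Sg V)) (A : AnnLit Sg V) (P : List (RewriteStep Sg V)) : Prop :=
  IsReductionChain lt (Γ ++ [A]) P ∧
  ∃ I, P.getLast? = some I ∧ I.lit.pos = false ∧
    (I.lit.subst I.sub).lhs = (I.lit.subst I.sub).rhs

/-- Refutations from `Γ` and `A`: no step except the last can be removed. -/
def IsRefutation (Γ : List (AnnLit Sg V)) (A : AnnLit Sg V) (P : List (RewriteStep Sg V)) :
    Prop :=
  Refutes lt Γ A P ∧ ∀ i, i + 1 < P.length → ¬ Refutes lt Γ A (P.eraseIdx i)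

/-! ### The calculus -/

/-- The last component of a state: `⊤`, `⊥`, or a closure. -/
inductive Status (Sg : FirstOrder.Language.{u, v}) (V : Type w) where
  | top
  | bot
  | closure (C : Clause Sg V) (σ : Subst Sg V)

/-- States `(Γ; N; U; β; k; D)`. -/
structure State (Sg : FirstOrder.Language.{u, v}) (V : Type w) where
  trail : List (AnnLit Sg V)
  N : Set (Clause Sg V)
  U : Set (Clause Sg V)
  β : Sg.Term V
  k : ℕ
  status : Status Sg V

/-- The names of the rules. -/
inductive Rule where
  | propagate | decide | conflict | skip | exploreRefutation | factorize | equalityResolution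
  | backtrack | grow

/-- The rules of the calculus. -/
inductive Step : Rule → State Sg V → State Sg V → Prop
  | propagate {Γ N U β k} {C₀ : Clause Sg V} {b : Bool} {s t : Sg.Term V}
      {E : List (Sg.Term V × Sg.Term V)} {σ μ : Subst Sg V} {P : List (RewriteStep Sg V)}
      {I : RewriteStep Sg V} :
      -- the clause `C₀ ∨ C₁ ∨ L` with `L = s # t`, where `C₁` consists of the literals in `E`
      C₀ + Multiset.ofList (E.map fun e => (⟨b, s(e.1, e.2)⟩ : Literal Sg V)) +
        {⟨b, s(s, t)⟩} ∈ N ∪ U →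
      ((C₀ + {⟨b, s(s, t)⟩} : Clause Sg V).subst σ).Ground →
      ClauseFalse (lits Γ) (C₀.subst σ) →
      (∀ e ∈ E, e.1.subst σ.map = s.subst σ.map ∧ e.2.subst σ.map = t.subst σ.map) →
      IsMGU μ {q | ∃ e ∈ E, q = (e.1, s) ∨ q = (e.2, t)} →
      BetaUndefined lt β (lits Γ) (Literal.subst ⟨b, s(s, t)⟩ σ) →
      ClauseBelow lt β (((C₀ + {⟨b, s(s, t)⟩} : Clause Sg V).subst μ).subst σ) →
      SubstIrreducible (conv lt (lits Γ)) σ →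
      IsReductionChainApplication lt Γ
        ⟨k, Literal.subst ⟨b, s(s, t)⟩ μ, C₀.subst μ, σ⟩ P →
      P.getLast? = some I →
      Step .propagate ⟨Γ, N, U, β, k, .top⟩
        ⟨Γ ++ [⟨k, I.lit.toLit, I.rest, I.sub⟩], N, U, β, k, .top⟩
  | decide {Γ N U β k} {C₀ : Clause Sg V} {L : Literal Sg V} {σ : Subst Sg V}
      {P : List (RewriteStep Sg V)} {I : RewriteStep Sg V} :
      C₀ + {L} ∈ N ∪ U →
      ((C₀ + {L}).subst σ).Ground →
      (ClauseBetaUndefined lt β (lits Γ) (C₀.subst σ) ∨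
        ClauseBetaTrue lt β (lits Γ) (C₀.subst σ)) →
      BetaUndefined lt β (lits Γ) (L.subst σ) →
      ClauseBelow lt β ((C₀ + {L}).subst σ) →
      SubstIrreducible (conv lt (lits Γ)) σ →
      IsReductionChainApplication lt Γ ⟨k + 1, L, C₀, σ⟩ P →
      P.getLast? = some I →
      Step .decide ⟨Γ, N, U, β, k, .top⟩
        ⟨Γ ++ [⟨k + 1, I.lit.toLit, {I.lit.toLit.comp}, I.sub⟩], N, U, β, k + 1, .top⟩
  | conflict_bot {Γ N U β k} {C : Clause Sg V} {σ : Subst Sg V} :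
      C ∈ N ∪ U → (C.subst σ).Ground →
      ClauseBetaFalse lt β (lits Γ) (C.subst σ) →
      SubstIrreducible (conv lt (lits Γ)) σ →
      clauseLevel Γ (C.subst σ) = 0 →
      Step .conflict ⟨Γ, N, U, β, k, .top⟩ ⟨Γ, N, U, β, k, .bot⟩
  | conflict {Γ N U β k} {C : Clause Sg V} {σ : Subst Sg V} :
      C ∈ N ∪ U → (C.subst σ).Ground →
      ClauseBetaFalse lt β (lits Γ) (C.subst σ) →
      SubstIrreducible (conv lt (lits Γ)) σ →
      clauseLevel Γ (C.subst σ) ≠ 0 →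
      Step .conflict ⟨Γ, N, U, β, k, .top⟩ ⟨Γ, N, U, β, k, .closure C σ⟩
  | skip {Γ : List (AnnLit Sg V)} {K A : AnnLit Sg V} {N U β k} {C : Clause Sg V}
      {σ : Subst Sg V} :
      ClauseBetaFalse lt β (lits (Γ ++ [K])) (C.subst σ) →
      Step .skip ⟨Γ ++ [K, A], N, U, β, k, .closure C σ⟩
        ⟨Γ ++ [K], N, U, β, K.level, .closure C σ⟩
  | exploreRefutation {Γ N U β k} {C : Clause Sg V} {L : Literal Sg V} {σ : Subst Sg V}
      {P : List (RewriteStep Sg V)} {I : RewriteStep Sg V} :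
      (∀ K ∈ C.subst σ, TrailLT lt β Γ K (L.subst σ)) →
      -- the last literal of the trail is the defining literal of `Lσ`
      (∃ i, i + 1 = Γ.length ∧ IsDefining Γ (L.subst σ) i) →
      IsRefutation lt Γ ⟨k, L, C, σ⟩ P →
      I ∈ P →
      (I.clause.subst I.sub).Ground →
      MulExt (TrailLT lt β Γ) (I.clause.subst I.sub) ((C + {L}).subst σ) →
      ClauseBetaFalse lt β (lits Γ) (I.clause.subst I.sub) →
      Step .exploreRefutation ⟨Γ, N, U, β, k, .closure (C + {L}) σ⟩
        ⟨Γ, N, U, β, k, .closure I.clause I.sub⟩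
  | factorize {Γ N U β k} {C : Clause Sg V} {b : Bool} {s t s' t' : Sg.Term V}
      {σ μ : Subst Sg V} :
      s.subst σ.map = s'.subst σ.map → t.subst σ.map = t'.subst σ.map →
      IsMGU μ {(s, s'), (t, t')} →
      Step .factorize
        ⟨Γ, N, U, β, k, .closure (C + {⟨b, s(s, t)⟩} + {⟨b, s(s', t')⟩}) σ⟩
        ⟨Γ, N, U, β, k, .closure ((C + {⟨b, s(s, t)⟩} : Clause Sg V).subst μ) σ⟩
  | equalityResolution {Γ N U β k} {C : Clause Sg V} {s t : Sg.Term V} {σ μ : Subst Sg V} :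
      s.subst σ.map = t.subst σ.map →
      IsMGU μ {(s, t)} →
      Step .equalityResolution
        ⟨Γ, N, U, β, k, .closure (C + {⟨false, s(s, t)⟩}) σ⟩
        ⟨Γ, N, U, β, k, .closure (C.subst μ) σ⟩
  | backtrack_decision {Γ Γ' : List (AnnLit Sg V)} {K : AnnLit Sg V} {N U β k}
      {C : Clause Sg V} {L : Literal Sg V} {σ : Subst Sg V} :
      clauseLevel (Γ ++ K :: Γ') (C.subst σ) < k →
      (∃ τ : Subst Sg V, ((C + {L}).subst τ).Ground ∧
        ClauseBetaFalse lt β (lits (Γ ++ [K])) ((C + {L}).subst τ)) →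
      (¬ ∃ τ : Subst Sg V, ((C + {L}).subst τ).Ground ∧
        ClauseBetaFalse lt β (lits Γ) ((C + {L}).subst τ)) →
      IsDecision Γ K →
      Step .backtrack ⟨Γ ++ K :: Γ', N, U, β, k, .closure (C + {L}) σ⟩
        ⟨Γ, N, U ∪ {C + {L}}, β, K.level - 1, .top⟩
  | backtrack_propagated {Γ Γ' : List (AnnLit Sg V)} {K : AnnLit Sg V} {N U β k}
      {C : Clause Sg V} {L : Literal Sg V} {σ : Subst Sg V} :
      clauseLevel (Γ ++ K :: Γ') (C.subst σ) < k →
      (∃ τ : Subst Sg V, ((C + {L}).subst τ).Ground ∧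
        ClauseBetaFalse lt β (lits (Γ ++ [K])) ((C + {L}).subst τ)) →
      (¬ ∃ τ : Subst Sg V, ((C + {L}).subst τ).Ground ∧
        ClauseBetaFalse lt β (lits Γ) ((C + {L}).subst τ)) →
      ¬ IsDecision Γ K →
      Step .backtrack ⟨Γ ++ K :: Γ', N, U, β, k, .closure (C + {L}) σ⟩
        ⟨Γ, N, U ∪ {C + {L}}, β, K.level, .top⟩
  | grow {Γ N U β k β'} :
      TermGround β' → lt β β' →
      Step .grow ⟨Γ, N, U, β, k, .top⟩ ⟨[], N, U, β', 0, .top⟩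

/-- A rule is applicable to a state. -/
def Applicable (R : Rule) (S : State Sg V) : Prop := ∃ S', Step lt R S S'

/-- A run of `n` rule applications for the initial clause set `N`: rule `r i` leads from `S i` to
`S (i + 1)`. -/
structure IsRun (N : Set (Clause Sg V)) (n : ℕ) (S : ℕ → State Sg V) (r : ℕ → Rule) : Prop where
  init : ∃ β, TermGround β ∧ S 0 = ⟨[], N, ∅, β, 0, .top⟩
  step : ∀ i < n, Step lt (r i) (S i) (S (i + 1))

/-- `c` is the last application of Conflict before the rule application `b`. -/
def LastConflict (r : ℕ → Rule) (c b : ℕ) : Prop :=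
  c < b ∧ r c = .conflict ∧ ∀ j, c < j → j < b → r j ≠ .conflict

/-- Conflict is applied at `c` immediately after an application of Decide. -/
def AfterDecide (r : ℕ → Rule) (c : ℕ) : Prop := ∃ d, d + 1 = c ∧ r d = .decide

/-- Regular runs. -/
structure IsRegularRun (N : Set (Clause Sg V)) (n : ℕ) (S : ℕ → State Sg V) (r : ℕ → Rule) :
    Prop extends IsRun lt N n S r where
  /-- Conflict and Factorize have precedence over all other rules. -/
  conflict_first : ∀ i < n, Applicable lt .conflict (S i) → r i = .conflict
  factorize_first : ∀ i < n, Applicable lt .factorize (S i) → r i = .factorize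
  /-- At level zero, Propagate has precedence over Decide. -/
  propagate_first : ∀ i < n, (S i).k = 0 → Applicable lt .propagate (S i) → r i ≠ .decide
  /-- Decide does not add the complement of a literal that could be propagated with an annotation
  from `N ∪ U`. -/
  no_bad_decision : ∀ i < n, r i = .decide →
    ∀ A, (S (i + 1)).trail = (S i).trail ++ [A] →
    ¬ ∃ S' B, Step lt .propagate (S i) S' ∧ S'.trail = (S i).trail ++ [B] ∧
      B.clause ∈ (S i).N ∪ (S i).U ∧ A.ground = B.ground.comp
  /-- Skip is applied at least once during conflict resolution, except if Conflict is applied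
  immediately after Decide. -/
  skip_once : ∀ b < n, r b = .backtrack → ∀ c, LastConflict r c b →
    AfterDecide r c ∨ ∃ j, c < j ∧ j < b ∧ r j = .skip
  /-- If Conflict is applied immediately after Decide, then Backtrack is only applied if the
  conflict clause contains the complement of the last trail literal. -/
  backtrack_after_decide : ∀ b < n, r b = .backtrack → ∀ c, LastConflict r c b →
    AfterDecide r c → ∀ C σ, (S b).status = .closure C σ →
    ∃ A, (S b).trail.getLast? = some A ∧ A.ground.comp ∈ C.subst σ

/-- The state is in conflict resolution: its last component is a closure. -/
def State.InConflict (S : State Sg V) : Prop := ∃ C σ, S.status = .closure C σ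

/-- The closure `E·δ`, with `E = K ∨ D`, can replace the justification of the `j`-th literal `A` of
`Γ`: the literal stays the same, `Dδ` is false in the part of `Γ` to the left of it, and the sequence
with the new annotation is a trail. -/
def CanJustify (β : Sg.Term V) (Γ : List (AnnLit Sg V)) (j : ℕ) (A : AnnLit Sg V)
    (E : Clause Sg V) (δ : Subst Sg V) : Prop :=
  ∃ (K : Literal Sg V) (D : Clause Sg V), E = K ::ₘ D ∧ K.subst δ = A.ground ∧
    ClauseBetaFalse lt β (lits (Γ.take j)) (D.subst δ) ∧
    IsTrail lt (Γ.set j ⟨A.level, K, D, δ⟩)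

end

end SCLEQ

namespace SCLEQ

/-! ### Syntax: variables, positions, irreducibility, and monotonicity of the term ordering. -/

section Terms

open FirstOrder.Language (Term)

variable {Sg : FirstOrder.Language.{u, v}} {V : Type w}

/-! ### Variables and substitutions -/

/-! Everything rests on one invariant of regular runs: no ground instance of a clause in `N ∪ U` is
`β`-false in a proper prefix of the trail. Since Conflict has precedence, a trail is extended only
when it contains no conflict itself, and Backtrack returns to a prefix in which the learned clause
has no false instance. Conflict insists on an irreducible grounding substitution, but any
substitution can be normalized without changing truth values or leaving the region below `β`
(`exists_normalized`), so its inapplicability excludes all false instances.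

The second ingredient is that the trail induced ordering respects prefixes. A literal is defined in
the prefix of length `m` exactly when its defining index is below `m`, and a smaller literal never
has a larger defining index. So, as soon as a prefix contains all literals of level zero, every
literal smaller than one defined there is defined there too. At a trail position the first literal
is the trail literal `A` itself and the second is its complement: whatever is smaller than `A` is
defined strictly before it, and whatever is smaller than `comp A` is defined before it or equals
`A`.

These combine through a model argument. Suppose that clauses of `gnd (N ∪ U)` not larger than `C`
entail `C`, and let a model of a prefix falsify `C`. Then one of these clauses, `D`, fails in that
model. Literals of `D` that are defined in the prefix and fail in one of its models are false in the
prefix. If `C` is false in a prefix without conflicts, `D` is therefore a forbidden conflict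
(`not_groundRedundant_of_noConflict`). This settles a learned clause when Skip was applied, because
the clause is then false in a proper prefix of the trail at the time of Conflict.

Without Skip, Conflict followed a Decide of some `A`, and the learned instance is `comp A ∨ R` with
`R` false before `A`. A model of the whole trail now yields an instance `comp A ∨ D'` with `D'`
false before `A` (`GroundRedundant.exists_comp`). Then Propagate could have appended `comp A` with a
clause of `N ∪ U` (`exists_propagate`), so that the decision violated regularity.

For a propagated `A` with annotation `A ∨ R`, the model is one of the prefix before `A` in which `A`
fails; it exists because `A` is undefined there. The failing clause must have the form `A ∨ D'` with
`D'` false before `A` (`Entails.exists_propagating`), hence it can justify `A`. Its remainder again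
satisfies the hypothesis on `R`, so the argument can be repeated. As the ordering is well-founded, a
minimal justifying clause is not entailed by smaller ones.

That `R` is false before `A` is an invariant too. It needs the soundness of reduction chains: a
rewrite inference only collects, on the ground level, the side literals of its premises
(`RewriteInference.sound`). -/

theorem mem_vars_var {x y : V} : x ∈ vars (Term.var y : Sg.Term V) ↔ x = y := by
  simp [vars, Term.varFinset]

theorem mem_vars_func {n : ℕ} {f : Sg.Functions n} {ts : Fin n → Sg.Term V} {x : V} :
    x ∈ vars (Term.func f ts) ↔ ∃ i, x ∈ vars (ts i) := by
  simp [vars, Term.varFinset]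

theorem termGround_iff {t : Sg.Term V} : TermGround t ↔ ∀ x, x ∉ vars t :=
  Finset.eq_empty_iff_forall_notMem

theorem subst_congr {t : Sg.Term V} {f g : V → Sg.Term V} (h : ∀ x ∈ vars t, f x = g x) :
    t.subst f = t.subst g := by
  induction t with
  | var y => exact h y (mem_vars_var.2 rfl)
  | func F ts ih =>
    simp only [Term.subst]
    congr 1
    funext i
    exact ih i fun x hx => h x (mem_vars_func.2 ⟨i, hx⟩)

theorem subst_var (t : Sg.Term V) : t.subst Term.var = t := by
  induction t with
  | var y => rfl
  | func F ts ih => simp only [Term.subst, ih]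

theorem subst_subst (t : Sg.Term V) (f g : V → Sg.Term V) :
    (t.subst f).subst g = t.subst fun x => (f x).subst g := by
  induction t with
  | var y => rfl
  | func F ts ih => simp only [Term.subst, ih]

theorem mem_vars_subst {t : Sg.Term V} {f : V → Sg.Term V} {x : V} :
    x ∈ vars (t.subst f) ↔ ∃ y ∈ vars t, x ∈ vars (f y) := by
  induction t with
  | var y => simp [Term.subst, mem_vars_var]
  | func F ts ih =>
    simp only [Term.subst, mem_vars_func, ih]
    constructor
    · rintro ⟨i, y, hy, hx⟩; exact ⟨y, ⟨i, hy⟩, hx⟩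
    · rintro ⟨y, ⟨i, hy⟩, hx⟩; exact ⟨i, y, hy, hx⟩

theorem TermGround.subst_eq {t : Sg.Term V} (h : TermGround t) (f : V → Sg.Term V) :
    t.subst f = t := by
  conv_rhs => rw [← subst_var t]
  exact subst_congr fun x hx => absurd hx (termGround_iff.1 h x)

theorem termGround_subst {t : Sg.Term V} {f : V → Sg.Term V} :
    TermGround (t.subst f) ↔ ∀ y ∈ vars t, TermGround (f y) := by
  simp only [termGround_iff, mem_vars_subst]
  constructor
  · intro h y hy x hx; exact h x ⟨y, hy, hx⟩
  · rintro h x ⟨y, hy, hx⟩; exact h y hy x hx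

theorem relabel_eq_subst (t : Sg.Term V) (π : V → V) :
    t.relabel π = t.subst fun x => Term.var (π x) := by
  induction t with
  | var y => rfl
  | func F ts ih => simp only [Term.subst, Term.relabel, ih]

theorem TermGround.relabel_eq {t : Sg.Term V} (h : TermGround t) (π : V → V) :
    t.relabel π = t := by
  rw [relabel_eq_subst, h.subst_eq]

/-- Terms are freely generated, so equality of the instances can be read off at every variable
occurrence. This turns the factorization of a literal instance into equations between substitutions.
-/
theorem subst_eq_on_vars {t : Sg.Term V} {f g : V → Sg.Term V} (h : t.subst f = t.subst g) :
    ∀ x ∈ vars t, f x = g x := by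
  induction t with
  | var y => intro x hx; rw [mem_vars_var.1 hx]; exact h
  | func F ts ih =>
    intro x hx
    obtain ⟨i, hi⟩ := mem_vars_func.1 hx
    simp only [Term.subst, Term.func.injEq, heq_eq_eq, true_and] at h
    exact ih i (congrFun h i) x hi

theorem Subst.comp_map (σ τ : Subst Sg V) (t : Sg.Term V) :
    t.subst (σ.comp τ).map = (t.subst σ.map).subst τ.map := by
  rw [subst_subst]; rfl

theorem Subst.ext_map {σ τ : Subst Sg V} (h : σ.map = τ.map) : σ = τ := by
  cases σ; cases τ; cases h; rfl

theorem Subst.comp_assoc (σ τ ρ : Subst Sg V) : (σ.comp τ).comp ρ = σ.comp (τ.comp ρ) :=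
  Subst.ext_map (funext fun x => (τ.comp_map ρ (σ.map x)).symm)

theorem Subst.map_eq_var {σ : Subst Sg V} {x : V} (h : x ∉ σ.dom) : σ.map x = .var x := by
  by_contra h'; exact h h'

/-- A unifier absorbs the idempotent most general unifier. -/
theorem IsMGU.comp_eq {μ τ : Subst Sg V} {E : Set (Sg.Term V × Sg.Term V)} (hμ : IsMGU μ E)
    (hτ : Unifies τ E) : μ.comp τ = τ := by
  obtain ⟨ρ, rfl⟩ := hμ.mostGeneral τ hτ
  rw [← Subst.comp_assoc, hμ.idempotent]

/-- The identity substitution. -/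
def Subst.id : Subst Sg V := ⟨Term.var, by simp⟩

theorem Subst.id_comp (σ : Subst Sg V) : Subst.id.comp σ = σ := Subst.ext_map rfl

theorem isMGU_id_empty : IsMGU (Subst.id : Subst Sg V) ∅ where
  unifies := by simp [Unifies]
  mostGeneral τ _ := ⟨τ, (Subst.id_comp τ).symm⟩
  idempotent := Subst.id_comp _
  noFresh x hx := absurd rfl hx

/-! ### Positions -/

theorem termAt_func {n : ℕ} {f : Sg.Functions n} {ts : Fin n → Sg.Term V} {i : ℕ} {p : List ℕ}
    {u : Sg.Term V} : termAt (Term.func f ts) (i :: p) = some u ↔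
      ∃ h : i < n, termAt (ts ⟨i, h⟩) p = some u := by
  rw [termAt]; split <;> simp_all

theorem termReplace_func {n : ℕ} {f : Sg.Functions n} {ts : Fin n → Sg.Term V} {i : ℕ}
    {p : List ℕ} {r : Sg.Term V} (h : i < n) : termReplace (Term.func f ts) (i :: p) r =
      Term.func f (Function.update ts ⟨i, h⟩ (termReplace (ts ⟨i, h⟩) p r)) := by
  rw [termReplace, dif_pos h]

theorem termAt_append {t u : Sg.Term V} {p q : List ℕ} (h : termAt t p = some u) :
    termAt t (p ++ q) = termAt u q := by
  induction p generalizing t with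
  | nil => simp only [termAt, Option.some.injEq] at h; simp [h]
  | cons i p ih =>
    cases t with
    | var x => simp [termAt] at h
    | func f ts =>
      obtain ⟨hi, h⟩ := termAt_func.1 h
      rw [List.cons_append, termAt, dif_pos hi, ih h]

/-- Writing a term as its own replacement lets closure under contexts compare a rewritten term with
the original one. -/
theorem termReplace_self {t u : Sg.Term V} {p : List ℕ} (h : termAt t p = some u) :
    termReplace t p u = t := by
  induction p generalizing t with
  | nil => simpa [termAt, termReplace] using h.symm
  | cons i p ih =>
    cases t with
    | var x => simp [termAt] at h
    | func f ts =>
      obtain ⟨hi, h⟩ := termAt_func.1 h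
      rw [termReplace_func hi, ih h, Function.update_eq_self]

theorem vars_termReplace {t r : Sg.Term V} {p : List ℕ} {x : V}
    (hx : x ∈ vars (termReplace t p r)) : x ∈ vars t ∨ x ∈ vars r := by
  induction p generalizing t with
  | nil => exact Or.inr (by simpa [termReplace] using hx)
  | cons i p ih =>
    cases t with
    | var y => exact Or.inl (by simpa [termReplace] using hx)
    | @func m f ts =>
      by_cases hi : i < m
      · rw [termReplace_func hi] at hx
        obtain ⟨j, hj⟩ := mem_vars_func.1 hx
        by_cases hij : j = ⟨i, hi⟩
        · subst hij
          rw [Function.update_self] at hj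
          exact (ih hj).imp (fun h => mem_vars_func.2 ⟨_, h⟩) fun h => h
        · rw [Function.update_of_ne hij] at hj
          exact Or.inl (mem_vars_func.2 ⟨_, hj⟩)
      · rw [termReplace, dif_neg hi] at hx
        exact Or.inl hx

theorem termGround_termReplace {t r : Sg.Term V} {p : List ℕ} (ht : TermGround t)
    (hr : TermGround r) : TermGround (termReplace t p r) :=
  termGround_iff.2 fun x hx => (vars_termReplace hx).elim (termGround_iff.1 ht x)
    (termGround_iff.1 hr x)

theorem termAt_subst {t u : Sg.Term V} {p : List ℕ} (h : termAt t p = some u)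
    (f : V → Sg.Term V) : termAt (t.subst f) p = some (u.subst f) := by
  induction p generalizing t with
  | nil => simp only [termAt, Option.some.injEq] at h ⊢; rw [h]
  | cons i p ih =>
    cases t with
    | var x => simp [termAt] at h
    | func F ts =>
      obtain ⟨hi, h⟩ := termAt_func.1 h
      exact termAt_func.2 ⟨hi, ih h⟩

theorem termReplace_subst {t u : Sg.Term V} {p : List ℕ} (h : termAt t p = some u)
    (r : Sg.Term V) (f : V → Sg.Term V) :
    (termReplace t p r).subst f = termReplace (t.subst f) p (r.subst f) := by
  induction p generalizing t with
  | nil => simp [termReplace]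
  | cons i p ih =>
    cases t with
    | var x => simp [termAt] at h
    | func F ts =>
      obtain ⟨hi, h⟩ := termAt_func.1 h
      rw [termReplace_func hi]
      simp only [Term.subst]
      rw [termReplace_func hi]
      congr 1
      funext j
      by_cases hij : j = ⟨i, hi⟩
      · subst hij; simp only [Function.update_self]; exact ih h
      · simp only [Function.update_of_ne hij]

theorem exists_termAt_var {t : Sg.Term V} {x : V} (h : x ∈ vars t) :
    ∃ p, termAt t p = some (.var x) := by
  induction t with
  | var y => exact ⟨[], by rw [mem_vars_var.1 h]; rfl⟩
  | func f ts ih =>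
    obtain ⟨i, hi⟩ := mem_vars_func.1 h
    obtain ⟨p, hp⟩ := ih i hi
    exact ⟨i :: p, termAt_func.2 ⟨i.2, hp⟩⟩

theorem realize_termReplace {M : Type*} [Sg.Structure M] {ν : V → M} {t u r : Sg.Term V}
    {p : List ℕ} (h : termAt t p = some u) (hr : r.realize ν = u.realize ν) :
    (termReplace t p r).realize ν = t.realize ν := by
  induction p generalizing t with
  | nil => simp only [termAt, Option.some.injEq] at h; rw [termReplace, hr, h]
  | cons i p ih =>
    cases t with
    | var x => simp [termAt] at h
    | func f ts =>
      obtain ⟨hi, h⟩ := termAt_func.1 h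
      rw [termReplace_func hi, Term.realize, Term.realize]
      congr 1
      funext j
      by_cases hij : j = ⟨i, hi⟩
      · subst hij; simp only [Function.update_self]; exact ih h
      · simp only [Function.update_of_ne hij]

theorem TermGround.realize_eq {M : Type*} [Sg.Structure M] {t : Sg.Term V} (h : TermGround t)
    (ν ν' : V → M) : t.realize ν = t.realize ν' := by
  induction t with
  | var x => exact absurd (mem_vars_var.2 rfl) (termGround_iff.1 h x)
  | func f ts ih =>
    simp only [Term.realize]
    congr 1
    funext i
    exact ih i (termGround_iff.2 fun x hx => termGround_iff.1 h x (mem_vars_func.2 ⟨i, hx⟩))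

/-! ### Irreducible terms -/

theorem TermIrreducible.subterm {R : Set (Sg.Term V × Sg.Term V)} {t u : Sg.Term V} {p : List ℕ}
    (ht : TermIrreducible R t) (h : termAt t p = some u) : TermIrreducible R u := by
  rintro ⟨_, lr, hlr, q, σ, hq, rfl⟩
  exact ht ⟨_, lr, hlr, p ++ q, σ, by rw [termAt_append h, hq], rfl⟩

theorem TermIrreducible.of_subst {R : Set (Sg.Term V × Sg.Term V)} {t : Sg.Term V}
    {f : V → Sg.Term V} (ht : TermIrreducible R (t.subst f)) {x : V} (hx : x ∈ vars t) :
    TermIrreducible R (f x) := by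
  obtain ⟨p, hp⟩ := exists_termAt_var hx
  exact ht.subterm (termAt_subst hp f)

/-! ### Monotonicity of the term ordering -/

variable {lt : Sg.Term V → Sg.Term V → Prop}

theorem DesiredOrdering.update (hlt : DesiredOrdering lt) {n : ℕ} (f : Sg.Functions n)
    (ts : Fin n → Sg.Term V) (i : Fin n) {a b : Sg.Term V} (h : lt a b) :
    lt (.func f (Function.update ts i a)) (.func f (Function.update ts i b)) := by
  have := hlt.context a b h (.func f ts) [i.1] (by simp [termAt])
  simpa [termReplace_func i.2, termReplace] using this

/-- The arguments are exchanged one at a time; each exchange changes nothing or decreases the term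
by closure under contexts. -/
theorem DesiredOrdering.func_le (hlt : DesiredOrdering lt) {n : ℕ} (f : Sg.Functions n)
    {as bs : Fin n → Sg.Term V} (h : ∀ i, as i = bs i ∨ lt (as i) (bs i)) :
    (Term.func f as) = .func f bs ∨ lt (.func f as) (.func f bs) := by
  classical
  -- The set `s` records the arguments that are already taken from `as`; the claim is the case where
  -- `s` contains all of them.
  have key : ∀ s : Finset (Fin n), Term.func f (fun i => if i ∈ s then as i else bs i) = .func f bs ∨
      lt (.func f (fun i => if i ∈ s then as i else bs i)) (.func f bs) := by
    intro s
    induction s using Finset.induction_on with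
    | empty => exact Or.inl (by simp)
    | insert i s hi ih =>
      have e1 : (fun j => if j ∈ insert i s then as j else bs j) =
          Function.update (fun j => if j ∈ s then as j else bs j) i (as i) := by
        funext j
        by_cases hj : j = i
        · subst hj; simp
        · simp [hj]
      have e2 : (fun j => if j ∈ s then as j else bs j) =
          Function.update (fun j => if j ∈ s then as j else bs j) i (bs i) := by
        funext j
        by_cases hj : j = i
        · subst hj; simp [hi]
        · simp [hj]
      rw [e1]
      rcases h i with h | h
      · rwa [h, ← e2]
      · have h2 := hlt.update f (fun j => if j ∈ s then as j else bs j) i h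
        rw [← e2] at h2
        rcases ih with ih | ih
        · exact Or.inr (ih ▸ h2)
        · exact Or.inr (hlt.trans _ _ _ h2 ih)
  simpa using key Finset.univ

/-- This shows that normalizing a substitution does not enlarge the instances. -/
theorem DesiredOrdering.subst_le (hlt : DesiredOrdering lt) {f g : V → Sg.Term V} (t : Sg.Term V)
    (h : ∀ x ∈ vars t, f x = g x ∨ lt (f x) (g x)) :
    t.subst f = t.subst g ∨ lt (t.subst f) (t.subst g) := by
  induction t with
  | var x => exact h x (mem_vars_var.2 rfl)
  | func F ts ih =>
    exact hlt.func_le F fun i => ih i fun x hx => h x (mem_vars_func.2 ⟨i, hx⟩)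

end Terms

/-! ### Truth in a sequence of literals, comparison with `β`, and normalization of substitutions. -/

section Semantics

open FirstOrder.Language (Term)

variable {Sg : FirstOrder.Language.{u, v}} {V : Type w}

/-! ### Literals and their semantics -/

theorem Literal.comp_comp (L : Literal Sg V) : L.comp.comp = L := by
  cases L; simp [Literal.comp]

theorem Literal.comp_subst (L : Literal Sg V) (σ : Subst Sg V) :
    L.comp.subst σ = (L.subst σ).comp := rfl

theorem Literal.subst_mk (b : Bool) (s t : Sg.Term V) (σ : Subst Sg V) :
    Literal.subst ⟨b, s(s, t)⟩ σ = ⟨b, s(s.subst σ.map, t.subst σ.map)⟩ := rfl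

theorem Literal.ground_mk {b : Bool} {s t : Sg.Term V} :
    Literal.Ground ⟨b, s(s, t)⟩ ↔ TermGround s ∧ TermGround t := by
  simp [Literal.Ground]

theorem Literal.exists_mk (L : Literal Sg V) : ∃ b s t, L = ⟨b, s(s, t)⟩ := by
  obtain ⟨b, e⟩ := L
  induction e using Sym2.ind with
  | _ s t => exact ⟨b, s, t, rfl⟩

theorem Literal.comp_ground {L : Literal Sg V} : L.comp.Ground ↔ L.Ground := Iff.rfl

theorem Literal.subst_comp (L : Literal Sg V) (σ τ : Subst Sg V) :
    L.subst (σ.comp τ) = (L.subst σ).subst τ := by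
  obtain ⟨b, s, t, rfl⟩ := L.exists_mk
  simp only [Literal.subst_mk, Subst.comp_map]

theorem Literal.subst_congr {L : Literal Sg V} {σ τ : Subst Sg V}
    (h : ∀ t ∈ L.eqn, ∀ x ∈ vars t, σ.map x = τ.map x) : L.subst σ = L.subst τ := by
  obtain ⟨b, s, t, rfl⟩ := L.exists_mk
  simp only [Literal.subst_mk]
  rw [SCLEQ.subst_congr (h s (by simp)), SCLEQ.subst_congr (h t (by simp))]

theorem Literal.holds_mk {b : Bool} {s t : Sg.Term V} {M : Type*} [Sg.Structure M] {ν : V → M} :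
    Literal.Holds ⟨b, s(s, t)⟩ ν ↔ (s.realize ν = t.realize ν ↔ b = true) := by
  simp [Literal.Holds]

theorem Literal.holds_comp {L : Literal Sg V} {M : Type*} [Sg.Structure M] {ν : V → M} :
    L.comp.Holds ν ↔ ¬ L.Holds ν := by
  obtain ⟨b, e⟩ := L
  cases b <;> simp [Literal.Holds, Literal.comp]

theorem Literal.Ground.holds_iff {L : Literal Sg V} (hL : L.Ground) {M : Type*} [Sg.Structure M]
    (ν ν' : V → M) : L.Holds ν ↔ L.Holds ν' := by
  obtain ⟨b, s, t, rfl⟩ := L.exists_mk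
  obtain ⟨hs, ht⟩ := Literal.ground_mk.1 hL
  rw [Literal.holds_mk, Literal.holds_mk, hs.realize_eq ν ν', ht.realize_eq ν ν']

theorem Clause.subst_comp (C : Clause Sg V) (σ τ : Subst Sg V) :
    Clause.subst C (σ.comp τ) = Clause.subst (Clause.subst C σ) τ := by
  simp only [Clause.subst, Multiset.map_map]
  exact Multiset.map_congr rfl fun L _ => L.subst_comp σ τ

theorem Clause.subst_add (C D : Clause Sg V) (σ : Subst Sg V) :
    Clause.subst (C + D) σ = Clause.subst C σ + Clause.subst D σ := Multiset.map_add _ _ _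

theorem Clause.subst_cons (L : Literal Sg V) (D : Clause Sg V) (σ : Subst Sg V) :
    Clause.subst (L ::ₘ D) σ = L.subst σ ::ₘ Clause.subst D σ := Multiset.map_cons _ _ _

theorem Clause.subst_singleton (L : Literal Sg V) (σ : Subst Sg V) :
    Clause.subst {L} σ = {L.subst σ} := Multiset.map_singleton _ _

theorem Clause.subst_congr {C : Clause Sg V} {σ τ : Subst Sg V}
    (h : ∀ x ∈ Clause.vars C, σ.map x = τ.map x) : Clause.subst C σ = Clause.subst C τ :=
  Multiset.map_congr rfl fun L hL => Literal.subst_congr fun t ht x hx => h x ⟨L, hL, t, ht, hx⟩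

/-- All literals of the sequence hold in the structure. -/
def Models (M : Type*) [Sg.Structure M] (Γ : List (Literal Sg V)) : Prop :=
  ∀ L ∈ Γ, ∀ ν : V → M, L.Holds ν

theorem entails_units_iff {Γ : List (Literal Sg V)} {C : Clause Sg V} :
    Entails (units Γ) C ↔ ∀ (M : Type (max u w)) [Nonempty M] [Sg.Structure M], Models M Γ →
      ∀ ν : V → M, ∃ L ∈ C, L.Holds ν := by
  constructor
  · intro h M _ _ hM
    refine h M ?_
    rintro D ⟨L, hL, rfl⟩ ν
    exact ⟨L, Multiset.mem_singleton_self L, hM L hL ν⟩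
  · intro h M _ _ hM
    refine h M fun L hL ν => ?_
    obtain ⟨K, hK, hν⟩ := hM {L} ⟨L, hL, rfl⟩ ν
    rwa [Multiset.mem_singleton.1 hK] at hν

theorem litTrue_iff {Γ : List (Literal Sg V)} {L : Literal Sg V} :
    LitTrue Γ L ↔ ∀ (M : Type (max u w)) [Nonempty M] [Sg.Structure M], Models M Γ →
      ∀ ν : V → M, L.Holds ν := by
  simp only [LitTrue, entails_units_iff, Multiset.mem_singleton, exists_eq_left]

theorem litFalse_iff {Γ : List (Literal Sg V)} {L : Literal Sg V} :
    LitFalse Γ L ↔ ∀ (M : Type (max u w)) [Nonempty M] [Sg.Structure M], Models M Γ →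
      ∀ ν : V → M, ¬ L.Holds ν := by
  simp only [LitFalse, entails_units_iff, Multiset.mem_singleton, exists_eq_left,
    Literal.holds_comp]

theorem Consistent.exists_model {Γ : List (Literal Sg V)} (h : Consistent Γ) :
    ∃ (M : Type (max u w)) (_ : Nonempty M) (_ : Sg.Structure M), Models M Γ := by
  by_contra h'
  push Not at h'
  refine h (entails_units_iff.2 fun M _ _ hM => absurd hM (h' M inferInstance inferInstance))

theorem Models.mono {M : Type*} [Sg.Structure M] {Γ Δ : List (Literal Sg V)} (h : Δ ⊆ Γ)
    (hM : Models M Γ) : Models M Δ := fun L hL => hM L (h hL)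

theorem Consistent.of_model {Γ : List (Literal Sg V)} (M : Type (max u w)) [Nonempty M]
    [Sg.Structure M] (hM : Models M Γ) : Consistent Γ := by
  intro h
  obtain ⟨x⟩ := ‹Nonempty M›
  obtain ⟨L, hL, -⟩ := entails_units_iff.1 h M hM fun _ => x
  exact absurd hL (Multiset.notMem_zero L)

theorem Consistent.mono {Γ Δ : List (Literal Sg V)} (h : Δ ⊆ Γ) (hΓ : Consistent Γ) :
    Consistent Δ := by
  obtain ⟨M, _, _, hM⟩ := hΓ.exists_model
  exact .of_model M (hM.mono h)

theorem LitTrue.mono {Γ Δ : List (Literal Sg V)} {L : Literal Sg V} (h : Δ ⊆ Γ)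
    (hL : LitTrue Δ L) : LitTrue Γ L :=
  litTrue_iff.2 fun M _ _ hM => litTrue_iff.1 hL M (hM.mono h)

theorem LitFalse.mono {Γ Δ : List (Literal Sg V)} {L : Literal Sg V} (h : Δ ⊆ Γ)
    (hL : LitFalse Δ L) : LitFalse Γ L :=
  LitTrue.mono h hL

theorem LitDefined.mono {Γ Δ : List (Literal Sg V)} {L : Literal Sg V} (h : Δ ⊆ Γ)
    (hL : LitDefined Δ L) : LitDefined Γ L := hL.imp (LitTrue.mono h) (LitFalse.mono h)

theorem LitTrue.of_mem {Γ : List (Literal Sg V)} {L : Literal Sg V} (h : L ∈ Γ) : LitTrue Γ L :=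
  litTrue_iff.2 fun _ _ _ hM => hM L h

theorem LitFalse.of_comp_mem {Γ : List (Literal Sg V)} {L : Literal Sg V} (h : L.comp ∈ Γ) :
    LitFalse Γ L := LitTrue.of_mem h

theorem litDefined_comp {Γ : List (Literal Sg V)} {L : Literal Sg V} :
    LitDefined Γ L.comp ↔ LitDefined Γ L := by
  unfold LitDefined LitFalse LitTrue
  rw [L.comp_comp, or_comm]

theorem Consistent.not_true_of_false {Γ : List (Literal Sg V)} {L : Literal Sg V}
    (h : Consistent Γ) (hF : LitFalse Γ L) : ¬ LitTrue Γ L := by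
  obtain ⟨M, hne, _, hM⟩ := h.exists_model
  obtain ⟨x⟩ := id hne
  exact fun hT => litFalse_iff.1 hF M hM (fun _ => x) (litTrue_iff.1 hT M hM _)

theorem Consistent.comp_notMem {Γ : List (Literal Sg V)} {L : Literal Sg V}
    (h : Consistent Γ) (hL : L ∈ Γ) : L.comp ∉ Γ :=
  fun hm => h.not_true_of_false (.of_comp_mem hm) (.of_mem hL)

/-- A consistent sequence stays consistent when an undefined ground literal is appended. -/
theorem Consistent.append {Γ : List (Literal Sg V)} {L : Literal Sg V} (hL : L.Ground)
    (h : ¬ LitDefined Γ L) : Consistent (Γ ++ [L]) := by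
  by_contra hc
  -- If the extended sequence has no model, then every model of `Γ` falsifies `L`. Groundness makes
  -- truth under one valuation the same as truth under all.
  refine h (Or.inr (litFalse_iff.2 fun M _ _ hM ν hν => hc (.of_model M ?_)))
  intro K hK ν'
  rcases List.mem_append.1 hK with hK | hK
  · exact hM K hK ν'
  · rw [List.mem_singleton.1 hK]; exact (hL.holds_iff ν ν').1 hν

/-- A ground clause that fails in some model of `Γ` has no true literal, so that each of its
literals that is defined in `Γ` is false. -/
theorem LitDefined.false_of_not_holds {Γ : List (Literal Sg V)} {L : Literal Sg V}
    (h : LitDefined Γ L) {M : Type (max u w)} [Nonempty M] [Sg.Structure M] (hM : Models M Γ)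
    {ν : V → M} (hν : ¬ L.Holds ν) : LitFalse Γ L :=
  h.resolve_left fun hT => hν (litTrue_iff.1 hT M hM ν)

/-! ### Comparison with a term -/

/-- The replaced part is a nonempty submultiset of a singleton, so nothing is left over as the
common part. -/
theorem mulExt_singleton {α : Type*} {r : α → α → Prop} {M : Multiset α} {b : α} :
    MulExt r M {b} ↔ ∀ a ∈ M, r a b := by
  constructor
  · rintro ⟨X, Y, Z, hZ, rfl, hN, h⟩ a ha
    have hX : X = 0 ∧ Z = {b} := by
      have hc := congrArg Multiset.card hN
      have hz : 0 < Multiset.card Z := Multiset.card_pos.2 hZ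
      simp only [Multiset.card_singleton, Multiset.card_add] at hc
      have : X = 0 := Multiset.card_eq_zero.1 (by omega)
      subst this
      exact ⟨rfl, by simpa using hN.symm⟩
    obtain ⟨rfl, rfl⟩ := hX
    obtain ⟨z, hz, hr⟩ := h a (by simpa using ha)
    rwa [Multiset.mem_singleton.1 hz] at hr
  · intro h
    exact ⟨0, M, {b}, by simp, by simp, by simp, fun a ha => ⟨b, by simp, h a ha⟩⟩

theorem Literal.mem_terms {L : Literal Sg V} {t : Sg.Term V} : t ∈ L.terms ↔ t ∈ L.eqn := by
  obtain ⟨b, s, t', rfl⟩ := L.exists_mk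
  cases b <;> (simp [Literal.terms, Sym2.toMultiset]; try tauto)

variable {lt : Sg.Term V → Sg.Term V → Prop}

theorem litBelow_iff {β : Sg.Term V} {L : Literal Sg V} :
    LitBelow lt β L ↔ ∀ t ∈ L.eqn, lt t β := by
  simp only [LitBelow, mulExt_singleton, Literal.mem_terms]

theorem litBelow_mk {β : Sg.Term V} {b : Bool} {s t : Sg.Term V} :
    LitBelow lt β ⟨b, s(s, t)⟩ ↔ lt s β ∧ lt t β := by
  simp [litBelow_iff]

theorem litBelow_comp {β : Sg.Term V} {L : Literal Sg V} :
    LitBelow lt β L.comp ↔ LitBelow lt β L := by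
  simp only [litBelow_iff, Literal.comp]

theorem clauseBelow_iff {β : Sg.Term V} {C : Clause Sg V} :
    ClauseBelow lt β C ↔ ∀ L ∈ C, LitBelow lt β L := by
  simp only [ClauseBelow, mulExt_singleton, Multiset.mem_map, forall_exists_index, and_imp,
    forall_apply_eq_imp_iff₂, LitBelow]

/-- Both comparisons together would give a term below itself. Consequently a `β`-undefined literal
below `β` is undefined outright. -/
theorem not_litAbove_of_litBelow (hlt : DesiredOrdering lt) {β : Sg.Term V} {L : Literal Sg V}
    (h : LitBelow lt β L) : ¬ LitAbove lt β L := by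
  rw [LitBelow, mulExt_singleton] at h
  rintro ⟨X, Y, Z, -, hX, hZ, hY⟩
  have hβ : β ∈ X + Y := hX ▸ Multiset.mem_singleton_self β
  rcases Multiset.mem_add.1 hβ with hβ | hβ
  · exact hlt.irrefl β (h β (by rw [hZ]; exact Multiset.mem_add.2 (Or.inl hβ)))
  · obtain ⟨z, hz, hr⟩ := hY β hβ
    exact hlt.irrefl β (hlt.trans _ _ _ hr (h z (by rw [hZ]; exact Multiset.mem_add.2 (Or.inr hz))))

theorem BetaUndefined.not_defined (hlt : DesiredOrdering lt) {β : Sg.Term V}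
    {Γ : List (Literal Sg V)} {L : Literal Sg V} (h : BetaUndefined lt β Γ L)
    (hL : LitBelow lt β L) : ¬ LitDefined Γ L := h.resolve_left (not_litAbove_of_litBelow hlt hL)

/-! ### Normal forms -/

/-- The equation `s ≈ t` holds in all models of `Γ`. -/
def EqIn (Γ : List (Literal Sg V)) (s t : Sg.Term V) : Prop :=
  ∀ (M : Type (max u w)) [Nonempty M] [Sg.Structure M], Models M Γ →
    ∀ ν : V → M, s.realize ν = t.realize ν

theorem EqIn.subst {Γ : List (Literal Sg V)} {f g : V → Sg.Term V} (t : Sg.Term V)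
    (h : ∀ x ∈ vars t, EqIn Γ (f x) (g x)) : EqIn Γ (t.subst f) (t.subst g) := by
  intro M _ _ hM ν
  induction t with
  | var x => exact h x (mem_vars_var.2 rfl) M hM ν
  | func F ts ih =>
    simp only [Term.subst, Term.realize]
    congr 1
    funext i
    exact ih i fun x hx => h x (mem_vars_func.2 ⟨i, hx⟩)

/-- Replacing the sides of a literal by equal terms. -/
theorem litTrue_congr {Γ : List (Literal Sg V)} {b : Bool} {s t s' t' : Sg.Term V}
    (hs : EqIn Γ s s') (ht : EqIn Γ t t') :
    LitTrue Γ ⟨b, s(s, t)⟩ ↔ LitTrue Γ ⟨b, s(s', t')⟩ := by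
  simp only [litTrue_iff, Literal.holds_mk]
  constructor <;> intro h M _ _ hM ν
  · rw [← hs M hM ν, ← ht M hM ν]; exact h M hM ν
  · rw [hs M hM ν, ht M hM ν]; exact h M hM ν

theorem litFalse_congr {Γ : List (Literal Sg V)} {b : Bool} {s t s' t' : Sg.Term V}
    (hs : EqIn Γ s s') (ht : EqIn Γ t t') :
    LitFalse Γ ⟨b, s(s, t)⟩ ↔ LitFalse Γ ⟨b, s(s', t')⟩ := litTrue_congr hs ht

theorem litDefined_congr {Γ : List (Literal Sg V)} {b : Bool} {s t s' t' : Sg.Term V}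
    (hs : EqIn Γ s s') (ht : EqIn Γ t t') :
    LitDefined Γ ⟨b, s(s, t)⟩ ↔ LitDefined Γ ⟨b, s(s', t')⟩ :=
  or_congr (litTrue_congr hs ht) (litFalse_congr hs ht)

/-- Rewriting with `conv Γ` decreases ground terms and preserves their values in models of `Γ`. -/
theorem Rewrites.conv (hlt : DesiredOrdering lt) {Γ : List (Literal Sg V)} {s t : Sg.Term V}
    (h : Rewrites (conv lt Γ) s t) :
    EqIn Γ s t ∧ lt t s ∧ (TermGround s → TermGround t) := by
  obtain ⟨⟨l, r⟩, ⟨hl, hr, hrl, hE⟩, p, σ, hp, rfl⟩ := h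
  simp only at hl hr hrl hE hp ⊢
  -- The rules of `conv` are ground, so the matching substitution plays no role.
  rw [hl.subst_eq] at hp
  rw [hr.subst_eq]
  refine ⟨fun M _ _ hM ν => (realize_termReplace hp ?_).symm, ?_, fun hs =>
    termGround_termReplace hs hr⟩
  · obtain ⟨L, hL, hν⟩ := hE M (by
      rintro D ⟨L, hL, -, rfl⟩ ν
      exact ⟨L, Multiset.mem_singleton_self L, hM L hL ν⟩) ν
    rw [Multiset.mem_singleton.1 hL, Literal.holds_mk] at hν
    exact (hν.2 rfl).symm
  · have := hlt.context r l hrl s p (by simp [hp])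
    rwa [termReplace_self hp] at this

theorem IsNormalForm.conv (hlt : DesiredOrdering lt) {Γ : List (Literal Sg V)} {s t : Sg.Term V}
    (h : IsNormalForm (conv lt Γ) s t) :
    EqIn Γ s t ∧ (t = s ∨ lt t s) ∧ (TermGround s → TermGround t) := by
  obtain ⟨h, -⟩ := h
  induction h with
  | refl => exact ⟨fun _ _ _ _ _ => rfl, Or.inl rfl, id⟩
  | tail _ h ih =>
    obtain ⟨h1, h2, h3⟩ := Rewrites.conv hlt h
    obtain ⟨i1, i2, i3⟩ := ih
    refine ⟨fun M _ _ hM ν => (i1 M hM ν).trans (h1 M hM ν), Or.inr ?_, h3 ∘ i3⟩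
    rcases i2 with rfl | i2
    · exact h2
    · exact hlt.trans _ _ _ h2 i2

/-- Each rewrite step decreases the term, so well-founded induction on the term applies. -/
theorem exists_isNormalForm (hlt : DesiredOrdering lt) (Γ : List (Literal Sg V))
    (t : Sg.Term V) : ∃ s, IsNormalForm (conv lt Γ) t s := by
  induction t using hlt.wf.induction with
  | _ t ih =>
    by_cases h : ∃ t', Rewrites (conv lt Γ) t t'
    · obtain ⟨t', h⟩ := h
      obtain ⟨s, hs, hi⟩ := ih t' (Rewrites.conv hlt h).2.1
      exact ⟨s, .head h hs, hi⟩
    · exact ⟨t, .refl, h⟩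

theorem Clause.finite_vars (C : Clause Sg V) : (Clause.vars C).Finite := by
  classical
  have h : Clause.vars C = ⋃ L ∈ C.toFinset, ⋃ t ∈ L.eqn.toMultiset.toFinset, (SCLEQ.vars t : Set V) := by
    ext x
    simp [Clause.vars]
  rw [h]
  exact Set.Finite.biUnion (Finset.finite_toSet _) fun L _ =>
    Set.Finite.biUnion (Finset.finite_toSet _) fun t _ => Finset.finite_toSet _

theorem Clause.Ground.map_ground {C : Clause Sg V} {σ : Subst Sg V}
    (h : Clause.Ground (Clause.subst C σ)) {x : V} (hx : x ∈ Clause.vars C) :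
    TermGround (σ.map x) := by
  obtain ⟨L, hL, t, ht, hx⟩ := hx
  exact termGround_subst.1 (h _ (Multiset.mem_map_of_mem _ hL) _ (Sym2.mem_map.2 ⟨t, ht, rfl⟩)) x hx

theorem Clause.ground_subst_iff {C : Clause Sg V} {σ : Subst Sg V} :
    Clause.Ground (Clause.subst C σ) ↔ ∀ x ∈ Clause.vars C, TermGround (σ.map x) := by
  refine ⟨fun h x hx => h.map_ground hx, fun h => ?_⟩
  intro L' hL' t' ht'
  obtain ⟨L, hL, rfl⟩ := Multiset.mem_map.1 hL'
  obtain ⟨t, ht, rfl⟩ := Sym2.mem_map.1 ht'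
  exact termGround_subst.2 fun x hx => h x ⟨L, hL, t, ht, hx⟩

/-- Every grounding substitution of a clause can be normalized: the new instances of the literals
have the same truth value in `Γ`, are not larger, and irreducible literals do not change. -/
theorem exists_normalized (hlt : DesiredOrdering lt) (Γ : List (Literal Sg V))
    {E : Clause Sg V} {δ : Subst Sg V} (hE : Clause.Ground (Clause.subst E δ)) :
    ∃ δ' : Subst Sg V, SubstIrreducible (conv lt Γ) δ' ∧ Clause.Ground (Clause.subst E δ') ∧
      ∀ L ∈ E, (LitFalse Γ (L.subst δ) → LitFalse Γ (L.subst δ')) ∧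
        (∀ β, LitBelow lt β (L.subst δ) → LitBelow lt β (L.subst δ')) ∧
        (LitIrreducible (conv lt Γ) (L.subst δ) → L.subst δ' = L.subst δ) := by
  classical
  have hnf : ∀ x, ∃ t, IsNormalForm (conv lt Γ) (δ.map x) t ∧
      (TermIrreducible (conv lt Γ) (δ.map x) → t = δ.map x) := by
    intro x
    by_cases h : TermIrreducible (conv lt Γ) (δ.map x)
    -- An irreducible image is kept as it is; this is what leaves irreducible literals unchanged.
    · exact ⟨δ.map x, ⟨.refl, h⟩, fun _ => rfl⟩
    · obtain ⟨t, ht⟩ := exists_isNormalForm hlt Γ (δ.map x)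
      exact ⟨t, ht, fun h' => absurd h' h⟩
  choose nf h1 h2 using hnf
  -- Outside the variables of `E` the new substitution is the identity. This makes its domain finite
  -- and confines the irreducibility requirement to images that have been normalized.
  let δ' : Subst Sg V := ⟨fun x => if x ∈ Clause.vars E then nf x else .var x, by
    refine (Clause.finite_vars E).subset fun x hx => ?_
    by_contra h
    exact hx (if_neg h)⟩
  have hδ' : ∀ x ∈ Clause.vars E, δ'.map x = nf x := fun x hx => if_pos hx
  refine ⟨δ', ?_, ?_, ?_⟩
  · intro x hx
    have hxE : x ∈ Clause.vars E := by
      by_contra h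
      exact hx (if_neg h)
    rw [hδ' x hxE]
    exact (h1 x).2
  · refine Clause.ground_subst_iff.2 fun x hx => ?_
    rw [hδ' x hx]
    exact ((h1 x).conv hlt).2.2 (hE.map_ground hx)
  · intro L hL
    obtain ⟨b, s, t, rfl⟩ := L.exists_mk
    simp only [Literal.subst_mk]
    have hs : ∀ x ∈ vars s, δ'.map x = nf x := fun x hx => hδ' x ⟨_, hL, s, by simp, hx⟩
    have ht : ∀ x ∈ vars t, δ'.map x = nf x := fun x hx => hδ' x ⟨_, hL, t, by simp, hx⟩
    have eqs : ∀ u : Sg.Term V, (∀ x ∈ vars u, δ'.map x = nf x) →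
        EqIn Γ (u.subst δ.map) (u.subst δ'.map) := fun u hu => EqIn.subst u fun x hx => by
      rw [hu x hx]; exact ((h1 x).conv hlt).1
    have les : ∀ u : Sg.Term V, (∀ x ∈ vars u, δ'.map x = nf x) → ∀ β, lt (u.subst δ.map) β →
        lt (u.subst δ'.map) β := fun u hu β hβ => by
      rcases hlt.subst_le u (f := δ'.map) (g := δ.map) fun x hx => by
        rw [hu x hx]; exact ((h1 x).conv hlt).2.1 with h | h
      · rwa [h]
      · exact hlt.trans _ _ _ h hβ
    refine ⟨(litFalse_congr (eqs s hs) (eqs t ht)).1, fun β hβ => ?_, fun hi => ?_⟩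
    · rw [litBelow_mk] at hβ ⊢
      exact ⟨les s hs β hβ.1, les t ht β hβ.2⟩
    · have irr : ∀ u : Sg.Term V, (∀ x ∈ vars u, δ'.map x = nf x) →
          TermIrreducible (conv lt Γ) (u.subst δ.map) → u.subst δ'.map = u.subst δ.map :=
        fun u hu h => subst_congr fun x hx => by rw [hu x hx]; exact h2 x (h.of_subst hx)
      rw [irr s hs (hi _ (by simp)), irr t ht (hi _ (by simp))]

end Semantics

/-! ### Ground instances and falsity of side literals along rewrite inferences. -/

section Chains

open FirstOrder.Language (Term)

variable {Sg : FirstOrder.Language.{u, v}} {V : Type w} {lt : Sg.Term V → Sg.Term V → Prop}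

/-! ### Soundness of reduction chains -/

/-- The ground instance of the clause `L ∨ C` consists of literals below `β`, and `Cσ` is false
in `Γ`. -/
def SoundClosure (lt : Sg.Term V → Sg.Term V → Prop) (β : Sg.Term V) (Γ : List (Literal Sg V))
    (L : Literal Sg V) (C : Clause Sg V) (σ : Subst Sg V) : Prop :=
  ((L.subst σ).Ground ∧ LitBelow lt β (L.subst σ)) ∧
    ∀ K ∈ Clause.subst C σ, K.Ground ∧ LitBelow lt β K ∧ LitFalse Γ K

theorem SoundClosure.ground {β : Sg.Term V} {Γ : List (Literal Sg V)} {L : Literal Sg V}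
    {C : Clause Sg V} {σ : Subst Sg V} (h : SoundClosure lt β Γ L C σ) :
    Clause.Ground (Clause.subst (L ::ₘ C) σ) := by
  intro K hK
  rw [Clause.subst_cons, Multiset.mem_cons] at hK
  rcases hK with rfl | hK
  · exact h.1.1
  · exact (h.2 K hK).1

theorem SoundClosure.of_subst_eq {β : Sg.Term V} {Γ : List (Literal Sg V)} {L L' : Literal Sg V}
    {C C' : Clause Sg V} {σ σ' : Subst Sg V} (h : SoundClosure lt β Γ L C σ)
    (hL : L'.subst σ' = L.subst σ) (hC : Clause.subst C' σ' = Clause.subst C σ) :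
    SoundClosure lt β Γ L' C' σ' := by
  unfold SoundClosure
  rw [hL, hC]; exact h

theorem SoundClosure.mono {β : Sg.Term V} {Γ Δ : List (Literal Sg V)} {L : Literal Sg V}
    {C : Clause Sg V} {σ : Subst Sg V} (hΓ : Γ ⊆ Δ) (h : SoundClosure lt β Γ L C σ) :
    SoundClosure lt β Δ L C σ :=
  ⟨h.1, fun K hK => ⟨(h.2 K hK).1, (h.2 K hK).2.1, (h.2 K hK).2.2.mono hΓ⟩⟩

theorem EqLit.subst_comp (e : EqLit Sg V) (σ τ : Subst Sg V) :
    e.subst (σ.comp τ) = (e.subst σ).subst τ := by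
  simp only [EqLit.subst, Subst.comp_map]

theorem EqLit.toLit_subst (e : EqLit Sg V) (σ : Subst Sg V) :
    (e.subst σ).toLit = e.toLit.subst σ := rfl

theorem EqLit.at?_cases {e : EqLit Sg V} {p : List ℕ} {u : Sg.Term V} (h : e.at? p = some u) :
    (∃ q, p = 0 :: q ∧ termAt e.lhs q = some u) ∨ (∃ q, p = 1 :: q ∧ termAt e.rhs q = some u) := by
  rcases p with _ | ⟨_ | _ | n, q⟩
  · simp [EqLit.at?] at h
  · exact Or.inl ⟨q, rfl, h⟩
  · exact Or.inr ⟨q, rfl, h⟩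
  · simp [EqLit.at?] at h

theorem EqLit.at?_subst {e : EqLit Sg V} {p : List ℕ} {u : Sg.Term V} (h : e.at? p = some u)
    (σ : Subst Sg V) : (e.subst σ).at? p = some (u.subst σ.map) := by
  rcases EqLit.at?_cases h with ⟨q, rfl, h⟩ | ⟨q, rfl, h⟩ <;> exact termAt_subst h _

theorem EqLit.replace_subst {e : EqLit Sg V} {p : List ℕ} {u : Sg.Term V} (h : e.at? p = some u)
    (r : Sg.Term V) (σ : Subst Sg V) :
    (e.replace p r).subst σ = (e.subst σ).replace p (r.subst σ.map) := by
  rcases EqLit.at?_cases h with ⟨q, rfl, h⟩ | ⟨q, rfl, h⟩ <;>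
    simp [EqLit.replace, EqLit.subst, termReplace_subst h]

/-- Replacing a subterm of a literal by a smaller ground term. -/
theorem EqLit.replace_below (hlt : DesiredOrdering lt) {β : Sg.Term V} {e : EqLit Sg V}
    {p : List ℕ} {u r : Sg.Term V} (h : e.at? p = some u) (hr : TermGround r) (hru : lt r u)
    (he : e.toLit.Ground) (hβ : LitBelow lt β e.toLit) :
    (e.replace p r).toLit.Ground ∧ LitBelow lt β (e.replace p r).toLit := by
  obtain ⟨b, s, t⟩ := e
  simp only [EqLit.toLit, Literal.ground_mk, litBelow_mk] at he hβ
  have key : ∀ {s q}, termAt s q = some u → lt s β → lt (termReplace s q r) β := by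
    intro s q hq hs
    have := hlt.context r u hru s q (by simp [hq])
    rw [termReplace_self hq] at this
    exact hlt.trans _ _ _ this hs
  rcases EqLit.at?_cases h with ⟨q, rfl, h⟩ | ⟨q, rfl, h⟩
  · simp only [EqLit.toLit, EqLit.replace, Literal.ground_mk, litBelow_mk]
    exact ⟨⟨termGround_termReplace he.1 hr, he.2⟩, key h hβ.1, hβ.2⟩
  · simp only [EqLit.toLit, EqLit.replace, Literal.ground_mk, litBelow_mk]
    exact ⟨⟨he.1, termGround_termReplace he.2 hr⟩, hβ.1, key h hβ.2⟩

theorem RewriteStep.mem_clause_vars_of_lit {I : RewriteStep Sg V} {x : V}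
    (h : x ∈ vars I.lit.lhs ∨ x ∈ vars I.lit.rhs) : x ∈ Clause.vars I.clause := by
  rcases h with h | h
  · exact ⟨I.lit.toLit, Multiset.mem_cons_self _ _, _, Sym2.mem_mk_left _ _, h⟩
  · exact ⟨I.lit.toLit, Multiset.mem_cons_self _ _, _, Sym2.mem_mk_right _ _, h⟩

theorem RewriteStep.mem_clause_vars_of_rest {I : RewriteStep Sg V} {x : V}
    (h : x ∈ Clause.vars I.rest) : x ∈ Clause.vars I.clause := by
  obtain ⟨L, hL, h⟩ := h
  exact ⟨L, Multiset.mem_cons_of_mem hL, h⟩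

/-- The part of the soundness of rewrite inferences that is common to both kinds of inferences. -/
theorem soundClosure_rewrite (hlt : DesiredOrdering lt) {β : Sg.Term V} {Γ : List (Literal Sg V)}
    {I₁ I₂ : RewriteStep Sg V} (h₁ : SoundClosure lt β Γ I₁.lit.toLit I₁.rest I₁.sub)
    (h₂ : SoundClosure lt β Γ I₂.lit.toLit I₂.rest I₂.sub) {p : List ℕ} {l r t : Sg.Term V}
    (hlit : I₁.lit = ⟨true, l, r⟩ ∨ I₁.lit = ⟨true, r, l⟩)
    (hrl : lt (r.subst I₁.sub.map) (l.subst I₁.sub.map))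
    (hp : (I₂.lit.subst I₂.sub).at? p = some (l.subst I₁.sub.map))
    {K : EqLit Sg V} {C : Clause Sg V} {μ τ : Subst Sg V}
    (hτ : ∀ x ∈ Clause.vars I₁.clause, τ.map x = I₁.sub.map x)
    (hK : K.subst τ = I₂.lit.subst I₂.sub)
    (hC : Clause.subst C τ = Clause.subst I₂.rest I₂.sub)
    (ht : K.at? p = some t) (hμ : IsMGU μ {(t, l)}) :
    SoundClosure lt β Γ ((K.replace p r).subst μ).toLit
      (Clause.subst I₁.rest μ + Clause.subst C μ) τ := by
  have hlr : (∀ x ∈ vars l, x ∈ Clause.vars I₁.clause) ∧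
      ∀ x ∈ vars r, x ∈ Clause.vars I₁.clause := by
    rcases hlit with h | h
    · exact ⟨fun x hx => RewriteStep.mem_clause_vars_of_lit (by simp [h, hx]),
        fun x hx => RewriteStep.mem_clause_vars_of_lit (by simp [h, hx])⟩
    · exact ⟨fun x hx => RewriteStep.mem_clause_vars_of_lit (by simp [h, hx]),
        fun x hx => RewriteStep.mem_clause_vars_of_lit (by simp [h, hx])⟩
  have hl : l.subst τ.map = l.subst I₁.sub.map := subst_congr fun x hx => hτ x (hlr.1 x hx)
  have hr : r.subst τ.map = r.subst I₁.sub.map := subst_congr fun x hx => hτ x (hlr.2 x hx)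
  have hrg : TermGround (r.subst I₁.sub.map) := by
    have := h₁.1.1
    rcases hlit with h | h <;> rw [h] at this
    · exact (Literal.ground_mk.1 this).2
    · exact (Literal.ground_mk.1 this).1
  -- The subterm of `K` at `p` and the left side `l` have the same instance under `τ`. So `τ`
  -- unifies them, and `μ` disappears from all ground instances.
  have hu : μ.comp τ = τ := hμ.comp_eq fun e he => by
    rw [Set.mem_singleton_iff.1 he]
    have := EqLit.at?_subst ht τ
    rw [hK, hp] at this
    rw [hl]; exact (Option.some.inj this).symm
  have hlitτ : ((K.replace p r).subst μ).toLit.subst τ =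
      ((I₂.lit.subst I₂.sub).replace p (r.subst I₁.sub.map)).toLit := by
    rw [← EqLit.toLit_subst, ← EqLit.subst_comp, hu, EqLit.replace_subst ht, hK, hr]
  have hrest : Clause.subst (Clause.subst I₁.rest μ + Clause.subst C μ) τ =
      Clause.subst I₁.rest I₁.sub + Clause.subst I₂.rest I₂.sub := by
    rw [Clause.subst_add, ← Clause.subst_comp, ← Clause.subst_comp, hu, hC]
    congr 1
    exact Clause.subst_congr fun x hx => hτ x (RewriteStep.mem_clause_vars_of_rest hx)
  refine ⟨?_, fun L hL => ?_⟩
  · rw [hlitτ]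
    exact EqLit.replace_below hlt hp hrg hrl h₂.1.1 h₂.1.2
  · rw [hrest, Multiset.mem_add] at hL
    exact hL.elim (h₁.2 L) (h₂.2 L)

/-- On ground instances the inference only replaces a subterm by a smaller one and joins the side
literals of the premises. The truth of the rewriting equation is not involved. What has to be
checked is that the combined substitution acts on each premise like the substitution of that
premise. -/
theorem RewriteInference.sound (hlt : DesiredOrdering lt) {β : Sg.Term V}
    {Γ : List (Literal Sg V)} {I₁ I₂ : RewriteStep Sg V}
    (h₁ : SoundClosure lt β Γ I₁.lit.toLit I₁.rest I₁.sub)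
    (h₂ : SoundClosure lt β Γ I₂.lit.toLit I₂.rest I₂.sub) {p : List ℕ} {e : EqLit Sg V}
    {C : Clause Sg V} {σ : Subst Sg V} (h : RewriteInference lt I₁ I₂ p e C σ) :
    SoundClosure lt β Γ e.toLit C σ := by
  have g₁ : ∀ x ∈ Clause.vars I₁.clause, TermGround (I₁.sub.map x) :=
    Clause.ground_subst_iff.1 h₁.ground
  have g₂ : ∀ x ∈ Clause.vars I₂.clause, TermGround (I₂.sub.map x) :=
    Clause.ground_subst_iff.1 h₂.ground
  cases h with
  | @direct l r t μ hdisj hlit hrl hp ht hμ =>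
    -- The domain of the first substitution is disjoint from the variables of the second clause, so
    -- composing with it on the left has no effect there.
    have hσ₂ : ∀ x ∈ Clause.vars I₂.clause, (I₁.sub.comp I₂.sub).map x = I₂.sub.map x := by
      intro x hx
      have : x ∉ I₁.sub.dom := fun hx' =>
        Set.disjoint_left.1 hdisj (Or.inr hx') (Or.inl hx)
      change (I₁.sub.map x).subst I₂.sub.map = _
      rw [Subst.map_eq_var this]; rfl
    refine soundClosure_rewrite hlt h₁ h₂ hlit hrl hp (fun x hx => (g₁ x hx).subst_eq _) ?_ ?_ ht hμ
    · rw [EqLit.subst, EqLit.subst]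
      congr 1
      · exact subst_congr fun x hx => hσ₂ x (RewriteStep.mem_clause_vars_of_lit (Or.inl hx))
      · exact subst_congr fun x hx => hσ₂ x (RewriteStep.mem_clause_vars_of_lit (Or.inr hx))
    · exact Clause.subst_congr fun x hx => hσ₂ x (RewriteStep.mem_clause_vars_of_rest hx)
  | @belowVar l r t μ δ ρ hdisj hlit hrl hp _ hexp ht hμ =>
    -- The factorization is given only for the two sides of the rewrite literal; it is split into
    -- one equation per variable.
    have hfac : ∀ x, x ∈ vars I₂.lit.lhs ∨ x ∈ vars I₂.lit.rhs →
        ((δ.map x).subst I₂.sub.map).subst ρ.map = I₂.sub.map x := by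
      have hf := hexp.factors
      rw [← EqLit.subst_comp, ← EqLit.subst_comp] at hf
      simp only [EqLit.subst, EqLit.mk.injEq, true_and] at hf
      rintro x (hx | hx) <;> rw [← Subst.comp_map]
      · exact subst_eq_on_vars hf.1 x hx
      · exact subst_eq_on_vars hf.2 x hx
    -- `δ` acts as the identity on old variables outside the domain, and `σ₁` fixes all variables
    -- in the image
    have hσ₁ : ∀ x ∈ Clause.vars I₂.clause, (δ.map x).subst I₁.sub.map = δ.map x := by
      intro x hx
      conv_rhs => rw [← subst_var (δ.map x)]
      refine subst_congr fun y hy => Subst.map_eq_var fun hyd => ?_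
      by_cases hxd : x ∈ δ.dom
      · exact hexp.fresh x hxd y hy (Or.inl (Or.inr hyd))
      · rw [Subst.map_eq_var hxd] at hy
        rw [mem_vars_var.1 hy] at hyd
        exact Set.disjoint_left.1 hdisj (Or.inr hyd) (Or.inl hx)
    have hmain : ∀ x ∈ Clause.vars I₂.clause,
        (δ.map x).subst ((I₁.sub.comp I₂.sub).comp ρ).map = I₂.sub.map x := by
      intro x hx
      rw [Subst.comp_map, Subst.comp_map, hσ₁ x hx]
      -- A variable that occurs only among the side literals is untouched by `δ`, and its ground
      -- image is not affected by `ρ`.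
      by_cases hxl : x ∈ vars I₂.lit.lhs ∨ x ∈ vars I₂.lit.rhs
      · exact hfac x hxl
      · have : x ∉ δ.dom := fun h => hxl (hexp.dom x h)
        rw [Subst.map_eq_var this]
        exact (g₂ x hx).subst_eq _
    refine soundClosure_rewrite hlt h₁ h₂ hlit hrl hp (fun x hx => ?_) ?_ ?_ ht hμ
    · change ((I₁.sub.map x).subst I₂.sub.map).subst ρ.map = _
      rw [(g₁ x hx).subst_eq, (g₁ x hx).subst_eq]
    · rw [← EqLit.subst_comp, EqLit.subst, EqLit.subst]
      congr 1
      · exact subst_congr fun x hx => hmain x (RewriteStep.mem_clause_vars_of_lit (Or.inl hx))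
      · exact subst_congr fun x hx => hmain x (RewriteStep.mem_clause_vars_of_lit (Or.inr hx))
    · rw [← Clause.subst_comp]
      exact Clause.subst_congr fun x hx => hmain x (RewriteStep.mem_clause_vars_of_rest hx)

/-- Conjugation undoes the renaming before the original substitution is applied, and renaming the
resulting ground terms changes nothing. -/
theorem Literal.Ground.rename_conj {L : Literal Sg V} {σ : Subst Sg V} (h : (L.subst σ).Ground)
    (π : Equiv.Perm V) : (L.rename π).subst (σ.conj π) = L.subst σ := by
  obtain ⟨b, s, t, rfl⟩ := L.exists_mk
  obtain ⟨hs, ht⟩ := Literal.ground_mk.1 h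
  have key : ∀ u : Sg.Term V, TermGround (u.subst σ.map) →
      (u.relabel π).subst (σ.conj π).map = u.subst σ.map := by
    intro u hu
    rw [relabel_eq_subst, SCLEQ.subst_subst]
    refine SCLEQ.subst_congr fun x hx => ?_
    change (σ.map (π.symm (π x))).relabel π = σ.map x
    rw [π.symm_apply_apply]
    exact (termGround_subst.1 hu x hx).relabel_eq _
  change (⟨b, s((s.relabel π).subst (σ.conj π).map, (t.relabel π).subst (σ.conj π).map)⟩ :
    Literal Sg V) = ⟨b, s(s.subst σ.map, t.subst σ.map)⟩
  rw [key s hs, key t ht]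

theorem SoundClosure.rename {β : Sg.Term V} {Γ : List (Literal Sg V)} {L : Literal Sg V}
    {C : Clause Sg V} {σ : Subst Sg V} (h : SoundClosure lt β Γ L C σ) (π : Equiv.Perm V) :
    SoundClosure lt β Γ (L.rename π) (Clause.rename C π) (σ.conj π) := by
  refine h.of_subst_eq (h.1.1.rename_conj π) ?_
  simp only [Clause.rename, Clause.subst, Multiset.map_map]
  refine Multiset.map_congr rfl fun K hK => ?_
  exact Literal.Ground.rename_conj (h.2 _ (Multiset.mem_map_of_mem _ hK)).1 π

/-- Strong induction on the position in the chain: an entry is a renamed annotation or is inferred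
from entries to its left. -/
theorem IsReductionChain.sound (hlt : DesiredOrdering lt) {β : Sg.Term V}
    {Γ : List (Literal Sg V)} {Δ : List (AnnLit Sg V)}
    (hΔ : ∀ A ∈ Δ, SoundClosure lt β Γ A.lit A.rest A.sub) {P : List (RewriteStep Sg V)}
    (hP : IsReductionChain lt Δ P) {I : RewriteStep Sg V} (hI : I ∈ P) :
    SoundClosure lt β Γ I.lit.toLit I.rest I.sub := by
  have key : ∀ (i : ℕ) (I : RewriteStep Sg V), P[i]? = some I → SoundClosure lt β Γ I.lit.toLit I.rest I.sub := by
    intro i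
    induction i using Nat.strong_induction_on with
    | _ i ih =>
      intro I hI
      have hmem : ∀ R ∈ P.take i, SoundClosure lt β Γ R.lit.toLit R.rest R.sub := by
        intro R hR
        obtain ⟨j, hj⟩ := List.mem_iff_getElem?.1 hR
        rw [List.getElem?_take] at hj
        split at hj
        · exact ih j ‹_› R hj
        · cases hj
      rcases hP i I hI with ⟨A, hA, π, e, he, rfl⟩ | ⟨R, hR, S, hS, e, C, σ, p, rfl, h⟩
      · simp only [RewriteStep.lit, RewriteStep.rest, RewriteStep.sub, he]
        exact (hΔ A hA).rename π
      · exact h.sound hlt (hmem R hR) (hmem S hS)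
  obtain ⟨i, hi⟩ := List.mem_iff_getElem?.1 hI
  exact key i I hi

/-- The last closure of a reduction chain application is sound, and its literal is the normal form
of the reduced literal. -/
theorem IsReductionChainApplication.sound (hlt : DesiredOrdering lt) {β : Sg.Term V}
    {Γ : List (AnnLit Sg V)} {A : AnnLit Sg V} {P : List (RewriteStep Sg V)}
    {I : RewriteStep Sg V} (hP : IsReductionChainApplication lt Γ A P) (hI : P.getLast? = some I)
    (hg : A.ground.Ground) (hu : ¬ LitDefined (lits Γ) A.ground) :
    (¬ LitDefined (lits Γ) (I.lit.toLit.subst I.sub)) ∧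
      LitIrreducible (conv lt (lits Γ)) (I.lit.toLit.subst I.sub) ∧
      (I.lit.toLit.subst I.sub).Ground ∧
      (LitBelow lt β A.ground → LitBelow lt β (I.lit.toLit.subst I.sub)) := by
  obtain ⟨⟨-, I', hI', s, t, hA, hs, ht⟩, -⟩ := hP
  obtain rfl : I' = I := Option.some.inj (hI'.symm.trans hI)
  have e : I'.lit.toLit.subst I'.sub =
    ⟨I'.lit.pos, s((I'.lit.subst I'.sub).lhs, (I'.lit.subst I'.sub).rhs)⟩ := rfl
  obtain ⟨s1, s2, s3⟩ := hs.conv hlt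
  obtain ⟨t1, t2, t3⟩ := ht.conv hlt
  rw [hA] at hg hu ⊢
  obtain ⟨gs, gt⟩ := Literal.ground_mk.1 hg
  rw [e]
  have le : ∀ {a b : Sg.Term V}, a = b ∨ lt a b → lt b β → lt a β := by
    rintro a b (rfl | h) hb
    · exact hb
    · exact hlt.trans _ _ _ h hb
  refine ⟨fun h => hu ((litDefined_congr s1 t1).2 h), fun u hu' => ?_,
    Literal.ground_mk.2 ⟨s3 gs, t3 gt⟩, fun h => ?_⟩
  · rcases Sym2.mem_iff.1 hu' with rfl | rfl
    · exact hs.2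
    · exact ht.2
  · rw [litBelow_mk] at h ⊢
    exact ⟨le s2 h.1, le t2 h.2⟩

/-- A reduction chain that uses an annotation without renaming takes it with the identity
permutation. -/
theorem Subst.conj_one (σ : Subst Sg V) : σ.conj 1 = σ := Subst.ext_map (funext fun x => by
  change (σ.map x).relabel _root_.id = _
  rw [Term.relabel_id])

/-- An irreducible literal is reduced by the chain that consists of its own closure. -/
theorem isReductionChainApplication_singleton {Γ : List (AnnLit Sg V)} (k : ℕ) {b : Bool}
    {s t : Sg.Term V} {C : Clause Sg V} {σ : Subst Sg V}
    (h : LitIrreducible (conv lt (lits Γ)) (Literal.subst ⟨b, s(s, t)⟩ σ)) :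
    IsReductionChainApplication lt Γ ⟨k, ⟨b, s(s, t)⟩, C, σ⟩
      [.base ⟨b, s, t⟩ (Clause.rename C 1) (σ.conj 1)] := by
  refine ⟨⟨?_, _, rfl, s.subst σ.map, t.subst σ.map, rfl, ?_, ?_⟩, ?_⟩
  · intro i I hI
    have hi : i = 0 := by
      by_contra hi
      rw [List.getElem?_eq_none (by simp; omega)] at hI
      cases hI
    subst hi
    obtain rfl := Option.some.inj hI
    refine Or.inl ⟨_, List.mem_append_right _ (List.mem_singleton_self _), 1, _, ?_, rfl⟩
    change (⟨b, s(s, t)⟩ : Literal Sg V) = ⟨b, s(s.relabel id, t.relabel id)⟩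
    rw [Term.relabel_id, Term.relabel_id]
  · simp only [RewriteStep.lit, RewriteStep.sub, EqLit.subst, Subst.conj_one]
    exact ⟨.refl, h _ (Sym2.mem_mk_left _ _)⟩
  · simp only [RewriteStep.lit, RewriteStep.sub, EqLit.subst, Subst.conj_one]
    exact ⟨.refl, h _ (Sym2.mem_mk_right _ _)⟩
  -- Minimality is immediate: erasing the only entry leaves a chain without a last closure.
  · intro i hi
    obtain rfl : i = 0 := by simpa using hi
    rintro ⟨-, I, hI, -⟩
    simp at hI

theorem Clause.rename_one (C : Clause Sg V) : Clause.rename C 1 = C := by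
  conv_rhs => rw [← Multiset.map_id C]
  refine Multiset.map_congr rfl fun L _ => ?_
  obtain ⟨b, s, t, rfl⟩ := L.exists_mk
  change (⟨b, s(s.relabel id, t.relabel id)⟩ : Literal Sg V) = _
  rw [Term.relabel_id, Term.relabel_id]; rfl

end Chains

/-! ### Cores and defining indices, and the trail induced ordering. -/

section Trails

variable {Sg : FirstOrder.Language.{u, v}} {V : Type w} {lt : Sg.Term V → Sg.Term V → Prop}

/-! ### Trails and defining literals -/

theorem lits_append (Γ Δ : List (AnnLit Sg V)) : lits (Γ ++ Δ) = lits Γ ++ lits Δ :=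
  List.map_append

theorem lits_take_subset {Γ : List (AnnLit Sg V)} {m m' : ℕ} (h : m ≤ m') :
    lits (Γ.take m) ⊆ lits (Γ.take m') := by
  refine List.map_subset _ ?_
  have : Γ.take m = (Γ.take m').take m := by rw [List.take_take, min_eq_left h]
  rw [this]
  exact List.take_subset _ _

theorem lits_take_subset_lits (Γ : List (AnnLit Sg V)) (m : ℕ) : lits (Γ.take m) ⊆ lits Γ :=
  List.map_subset _ (List.take_subset _ _)

theorem getElem?_mem_take {Γ : List (AnnLit Sg V)} {i m : ℕ} {A : AnnLit Sg V}
    (h : Γ[i]? = some A) (him : i < m) : A ∈ Γ.take m :=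
  List.mem_iff_getElem?.2 ⟨i, by rw [List.getElem?_take, if_pos him, h]⟩

/-- This connects cores, which are sets of indices, with prefixes of the trail. -/
theorem definedBy_range_iff {Γ : List (AnnLit Sg V)} {m : ℕ} {L : Literal Sg V} :
    DefinedBy Γ (Finset.range m) L ↔ LitDefined (lits (Γ.take m)) L := by
  have : sublits Γ (Finset.range m) = units (lits (Γ.take m)) := by
    ext D
    constructor
    · rintro ⟨i, hi, A, hA, rfl⟩
      exact ⟨A.ground, List.mem_map_of_mem (getElem?_mem_take hA (Finset.mem_range.1 hi)), rfl⟩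
    · rintro ⟨L, hL, rfl⟩
      obtain ⟨A, hA, rfl⟩ := List.mem_map.1 hL
      obtain ⟨i, hi⟩ := List.mem_iff_getElem?.1 hA
      rw [List.getElem?_take] at hi
      split at hi
      · exact ⟨i, Finset.mem_range.2 ‹_›, A, hi, rfl⟩
      · cases hi
  unfold DefinedBy LitDefined LitTrue LitFalse
  rw [this]

theorem DefinedBy.mono {Γ : List (AnnLit Sg V)} {I J : Finset ℕ} {L : Literal Sg V}
    (h : DefinedBy Γ I L) (hIJ : I ⊆ J) : DefinedBy Γ J L := by
  have : sublits Γ I ⊆ sublits Γ J := by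
    rintro D ⟨i, hi, h⟩
    exact ⟨i, hIJ hi, h⟩
  exact h.imp (fun h M _ _ hM => h M fun D hD => hM D (this hD))
    fun h M _ _ hM => h M fun D hD => hM D (this hD)

theorem DefinedBy.exists_core {Γ : List (AnnLit Sg V)} {I : Finset ℕ} {L : Literal Sg V}
    (h : DefinedBy Γ I L) (hI : I ⊆ Finset.range Γ.length) : ∃ J ⊆ I, IsCore Γ L J := by
  induction I using Finset.strongInduction with
  | _ I ih =>
    by_cases h' : ∃ J, J ⊂ I ∧ DefinedBy Γ J L
    · obtain ⟨J, hJ, hd⟩ := h'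
      obtain ⟨K, hK, hc⟩ := ih J hJ hd (hJ.1.trans hI)
      exact ⟨K, hK.trans hJ.1, hc⟩
    · exact ⟨I, subset_rfl, hI, h, fun J hJ hd => h' ⟨J, hJ, hd⟩⟩

theorem LitDefined.exists_core {Γ : List (AnnLit Sg V)} {m : ℕ} {L : Literal Sg V}
    (h : LitDefined (lits (Γ.take m)) L) : ∃ J ⊆ Finset.range m, IsCore Γ L J := by
  -- A core consists of indices of the trail, whereas `m` may exceed its length.
  have h' : DefinedBy Γ (Finset.range (min m Γ.length)) L := by
    rw [definedBy_range_iff, ← List.take_take, List.take_length]; exact h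
  obtain ⟨J, hJ, hc⟩ := h'.exists_core (Finset.range_subset_range.2 (min_le_right _ _))
  exact ⟨J, hJ.trans (Finset.range_subset_range.2 (min_le_left _ _)), hc⟩

theorem exists_isGreatest {J : Finset ℕ} (h : J.Nonempty) : ∃ j, IsGreatest (J : Set ℕ) j :=
  ⟨J.max' h, J.isGreatest_max' h⟩

/-- A defined literal whose core is not empty has a defining literal. -/
theorem LitDefined.exists_isDefining {Γ : List (AnnLit Sg V)} {L : Literal Sg V}
    (h : LitDefined (lits Γ) L) (h0 : ¬ DefinedBy Γ ∅ L) : ∃ i, IsDefining Γ L i := by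
  classical
  have hex : ∃ j I, IsCore Γ L I ∧ IsGreatest (I : Set ℕ) j := by
    obtain ⟨J, -, hc⟩ := LitDefined.exists_core (Γ := Γ) (m := Γ.length) (by rwa [List.take_length])
    have hne : J.Nonempty := by
      rw [Finset.nonempty_iff_ne_empty]
      rintro rfl
      exact h0 hc.2.1
    obtain ⟨j, hj⟩ := exists_isGreatest hne
    exact ⟨j, J, hc, hj⟩
  -- The defining index is the least number that is the largest element of some core.
  exact ⟨Nat.find hex, Nat.find_spec hex, fun J hJ j hj => Nat.find_min' hex ⟨J, hJ, hj⟩⟩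

theorem IsDefining.lt_length {Γ : List (AnnLit Sg V)} {L : Literal Sg V} {i : ℕ}
    (h : IsDefining Γ L i) : i < Γ.length := by
  obtain ⟨⟨I, hI, hi⟩, -⟩ := h
  exact Finset.mem_range.1 (hI.1 hi.1)

/-- If `L` is defined in the prefix, the prefix contains a core, and the defining index is at most
the largest index of that core. Conversely, the core that attains the defining index lies in every
longer prefix. -/
theorem IsDefining.defined_iff {Γ : List (AnnLit Sg V)} {L : Literal Sg V} {i : ℕ}
    (h : IsDefining Γ L i) (m : ℕ) : LitDefined (lits (Γ.take m)) L ↔ i < m := by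
  obtain ⟨⟨I, hI, hi⟩, hmin⟩ := h
  constructor
  · intro hd
    obtain ⟨J, hJ, hc⟩ := hd.exists_core
    rcases J.eq_empty_or_nonempty with rfl | hne
    -- An empty core would be a proper subset of the nonempty minimal set `I`.
    · refine absurd hc.2.1 (hI.2.2 ∅ ?_)
      exact Finset.ssubset_iff_subset_ne.2 ⟨Finset.empty_subset _, fun h => by
        have := hi.1
        rw [← h] at this
        exact absurd this (Finset.notMem_empty _)⟩
    · obtain ⟨j, hj⟩ := exists_isGreatest hne
      exact (hmin J hc j hj).trans_lt (Finset.mem_range.1 (hJ hj.1))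
  · intro him
    refine definedBy_range_iff.1 (hI.2.1.mono fun j hj => Finset.mem_range.2 ?_)
    exact (hi.2 hj).trans_lt him

/-- `L` or its complement is the `i`-th literal of the trail, or this is the defining literal
of `L`. -/
def DefinesAt (Γ : List (AnnLit Sg V)) (L : Literal Sg V) (i : ℕ) : Prop :=
  (IsTrailLit Γ i L ∨ IsTrailLit Γ i L.comp) ∨ IsDefining Γ L i

theorem DefinesAt.lt_length {Γ : List (AnnLit Sg V)} {L : Literal Sg V} {i : ℕ}
    (h : DefinesAt Γ L i) : i < Γ.length := by
  rcases h with (⟨A, hA, -⟩ | ⟨A, hA, -⟩) | h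
  · exact (List.getElem?_eq_some_iff.1 hA).1
  · exact (List.getElem?_eq_some_iff.1 hA).1
  · exact h.lt_length

theorem IsTrail.take_notDefined {Γ : List (AnnLit Sg V)} (hΓ : IsTrail lt Γ) {i m : ℕ}
    {A : AnnLit Sg V} (h : Γ[i]? = some A) (hm : m ≤ i) :
    ¬ LitDefined (lits (Γ.take m)) A.ground :=
  fun hd => hΓ.undefined i A h (hd.mono (lits_take_subset hm))

/-- For a trail literal or its complement this is the condition that trail literals are undefined
before their own position; otherwise it is the property of defining indices. -/
theorem DefinesAt.defined_iff {Γ : List (AnnLit Sg V)} (hΓ : IsTrail lt Γ) {L : Literal Sg V}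
    {i : ℕ} (h : DefinesAt Γ L i) (m : ℕ) : LitDefined (lits (Γ.take m)) L ↔ i < m := by
  have key : ∀ K, IsTrailLit Γ i K → (LitDefined (lits (Γ.take m)) K ↔ i < m) := by
    rintro K ⟨A, hA, rfl⟩
    constructor
    · intro hd
      by_contra hm
      exact hΓ.take_notDefined hA (not_lt.1 hm) hd
    · exact fun him => Or.inl (.of_mem (List.mem_map_of_mem (getElem?_mem_take hA him)))
  rcases h with (h | h) | h
  · exact key L h
  · rw [← litDefined_comp]; exact key _ h
  · exact h.defined_iff m

/-- An index that defines `L` is determined by the prefixes in which `L` is defined. -/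
theorem DefinesAt.unique {Γ : List (AnnLit Sg V)} (hΓ : IsTrail lt Γ) {L : Literal Sg V}
    {i j : ℕ} (hi : DefinesAt Γ L i) (hj : DefinesAt Γ L j) : i = j := by
  have h1 := (hi.defined_iff hΓ (j + 1)).1 ((hj.defined_iff hΓ (j + 1)).2 (Nat.lt_succ_self j))
  have h2 := (hj.defined_iff hΓ (i + 1)).1 ((hi.defined_iff hΓ (i + 1)).2 (Nat.lt_succ_self i))
  omega

/-- The level of a defined literal is the level of the trail literal that defines it. -/
theorem LitDefined.litLevel_spec {Γ : List (AnnLit Sg V)} {L : Literal Sg V}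
    (h : LitDefined (lits Γ) L) :
    (∃ i A, Γ[i]? = some A ∧ DefinesAt Γ L i ∧ litLevel Γ L = A.level) ∨
      (DefinedBy Γ ∅ L ∧ litLevel Γ L = 0) := by
  classical
  cases hf : Γ.find? (fun A => decide (A.ground = L)) with
  | some A =>
    obtain ⟨i, hi⟩ := List.mem_iff_getElem?.1 (List.mem_of_find?_eq_some hf)
    have hg : A.ground = L := by simpa using List.find?_some hf
    refine Or.inl ⟨i, A, hi, Or.inl (Or.inl ⟨A, hi, hg⟩), ?_⟩
    unfold litLevel
    split
    · rename_i B hB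
      have : some B = some A := by rw [← hB, ← hf]
      rw [Option.some.inj this]
    · rename_i hB
      have : (none : Option (AnnLit Sg V)) = some A := by rw [← hB, ← hf]
      cases this
  | none =>
    have e : litLevel Γ L =
        if h : ∃ i A, Γ[i]? = some A ∧ IsDefining Γ L i then h.choose_spec.choose.level else 0 := by
      unfold litLevel
      split
      · rename_i B hB
        have : (none : Option (AnnLit Sg V)) = some B := by rw [← hB, ← hf]
        cases this
      · rfl
    by_cases hd : ∃ i A, Γ[i]? = some A ∧ IsDefining Γ L i
    · rw [dif_pos hd] at e
      exact Or.inl ⟨hd.choose, hd.choose_spec.choose, hd.choose_spec.choose_spec.1,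
        Or.inr hd.choose_spec.choose_spec.2, e⟩
    · rw [dif_neg hd] at e
      refine Or.inr ⟨?_, e⟩
      by_contra h0
      obtain ⟨i, hi⟩ := h.exists_isDefining h0
      exact hd ⟨i, _, List.getElem?_eq_getElem hi.lt_length, hi⟩

/-- A defined literal is defined in every prefix that contains all literals of its level. -/
theorem LitDefined.take_of_level {Γ : List (AnnLit Sg V)} (hΓ : IsTrail lt Γ) {L : Literal Sg V}
    (h : LitDefined (lits Γ) L) {m : ℕ}
    (hm : ∀ i A, Γ[i]? = some A → A.level = litLevel Γ L → i < m) :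
    LitDefined (lits (Γ.take m)) L := by
  rcases h.litLevel_spec with ⟨i, A, hA, hi, hl⟩ | ⟨h0, -⟩
  · exact (hi.defined_iff hΓ m).2 (hm i A hA hl.symm)
  · exact definedBy_range_iff.1 (h0.mono (Finset.empty_subset _))

/-- Defining indices are unique, so the level can only come from position `i`. An empty core is
impossible because the literal is undefined before `i`. -/
theorem IsTrail.litLevel_comp_ground {Γ : List (AnnLit Sg V)} (hΓ : IsTrail lt Γ) {i : ℕ}
    {A : AnnLit Sg V} (h : Γ[i]? = some A) : litLevel Γ A.ground.comp = A.level := by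
  have hd : LitDefined (lits Γ) A.ground.comp :=
    litDefined_comp.2 (Or.inl (.of_mem (List.mem_map_of_mem (List.mem_of_getElem? h))))
  have hA : DefinesAt Γ A.ground.comp i := Or.inl (Or.inr ⟨A, h, (Literal.comp_comp _).symm⟩)
  rcases hd.litLevel_spec with ⟨j, B, hB, hj, hl⟩ | ⟨h0, -⟩
  · obtain rfl := hj.unique hΓ hA
    rw [hl]
    rw [h] at hB
    rw [Option.some.inj hB]
  · exact absurd (litDefined_comp.1 (definedBy_range_iff.1 (h0.mono (Finset.empty_subset _))))
      (hΓ.undefined i A h)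

/-! ### The trail induced ordering -/

theorem IsTrailLit.mem {Γ : List (AnnLit Sg V)} {i : ℕ} {L : Literal Sg V}
    (h : IsTrailLit Γ i L) : L ∈ lits Γ := by
  obtain ⟨A, hA, rfl⟩ := h
  exact List.mem_map_of_mem (List.mem_of_getElem? hA)

/-- A literal that is smaller than a literal defined at `j` is of level zero or defined at some
`i ≤ j`, where `i = j` is restricted. -/
theorem TrailLT.cases_of_definesAt {β : Sg.Term V} {Γ : List (AnnLit Sg V)}
    {L K : Literal Sg V} (h : TrailLT lt β Γ L K) (hK : BetaDefined lt β (lits Γ) K) :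
    ZeroLevel lt β Γ L ∨
      ∃ i j, PosLevel lt β Γ L ∧ PosLevel lt β Γ K ∧ DefinesAt Γ L i ∧ DefinesAt Γ K j ∧
        (i < j ∨ (i = j ∧ ((IsTrailLit Γ i L ∧ IsTrailLit Γ j K.comp) ∨
          (K ∉ lits Γ ∧ K.comp ∉ lits Γ)))) := by
  cases h with
  | @other_other i j hL hK' hi hj hij =>
    refine Or.inr ⟨i, j, hL, hK', Or.inr hi.2.2.2.2, Or.inr hj.2.2.2.2, ?_⟩
    exact hij.imp id fun h => ⟨h.1, Or.inr ⟨hj.2.2.1, hj.2.2.2.1⟩⟩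
  | @lit_lit i j hL hK' hi hj hij =>
    exact Or.inr ⟨i, j, hL, hK', Or.inl (Or.inl hi), Or.inl (Or.inl hj), Or.inl hij⟩
  | @comp_lit i j hL hK' hi hj hij =>
    exact Or.inr ⟨i, j, hL, hK', Or.inl (Or.inr hi), Or.inl (Or.inl hj), Or.inl hij⟩
  | @lit_comp i j hL hK' hi hj hij =>
    exact Or.inr ⟨i, j, hL, hK', Or.inl (Or.inl hi), Or.inl (Or.inr hj),
      hij.lt_or_eq.imp id fun h => ⟨h, Or.inl ⟨hi, hj⟩⟩⟩
  | @comp_comp i j hL hK' hi hj hij =>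
    exact Or.inr ⟨i, j, hL, hK', Or.inl (Or.inr hi), Or.inl (Or.inr hj), Or.inl hij⟩
  | @trail_other i j hL hK' hi hj hij =>
    exact Or.inr ⟨i, j, hL, hK', Or.inl hi, Or.inr hj.2.2.2.2,
      hij.lt_or_eq.imp id fun h => ⟨h, Or.inr ⟨hj.2.2.1, hj.2.2.2.1⟩⟩⟩
  | @other_trail i j hL hK' hi hj hij =>
    exact Or.inr ⟨i, j, hL, hK', Or.inr hi.2.2.2.2, Or.inl hj, Or.inl hij⟩
  | zero_zero hL => exact Or.inl hL
  | zero_pos hL => exact Or.inl hL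
  | undef_undef _ _ _ h => exact absurd hK h
  | def_undef _ _ _ h => exact absurd hK h

/-- All trail literals of level zero are among the first `m` literals. -/
def ZeroBefore (Γ : List (AnnLit Sg V)) (m : ℕ) : Prop :=
  ∀ i A, Γ[i]? = some A → A.level = 0 → i < m

theorem ZeroLevel.take {β : Sg.Term V} {Γ : List (AnnLit Sg V)} (hΓ : IsTrail lt Γ) {m : ℕ}
    (hm : ZeroBefore Γ m) {L : Literal Sg V} (h : ZeroLevel lt β Γ L) :
    BetaDefined lt β (lits (Γ.take m)) L :=
  ⟨h.2.1.1, h.2.1.2.take_of_level hΓ fun i A hA hl => hm i A hA (hl.trans h.2.2)⟩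

/-- Going down in the ordering never increases the defining index. Literals of level zero are the
exception to comparison by position, which is why the prefix has to contain all trail literals of
level zero. -/
theorem TrailLT.defined_take {β : Sg.Term V} {Γ : List (AnnLit Sg V)} (hΓ : IsTrail lt Γ) {m : ℕ}
    (hm : ZeroBefore Γ m) {L K : Literal Sg V} (h : TrailLT lt β Γ L K)
    (hK : BetaDefined lt β (lits (Γ.take m)) K) : BetaDefined lt β (lits (Γ.take m)) L := by
  rcases h.cases_of_definesAt ⟨hK.1, hK.2.mono (lits_take_subset_lits _ _)⟩ with
    h | ⟨i, j, hL, -, hi, hj, hij⟩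
  · exact h.take hΓ hm
  · have := (hj.defined_iff hΓ m).1 hK.2
    exact ⟨hL.2.1.1, (hi.defined_iff hΓ m).2 (by rcases hij with h | h <;> omega)⟩

/-- Among the literals defined at position `m`, the trail literal comes first, so the smaller ones
are defined strictly before it. The two other possibilities at equal position would put its
complement on the trail or remove it from the trail. -/
theorem TrailLT.defined_take_of_ground {β : Sg.Term V} {Γ : List (AnnLit Sg V)}
    (hΓ : IsTrail lt Γ) {m : ℕ} (hm : ZeroBefore Γ m) {A : AnnLit Sg V} (hA : Γ[m]? = some A)
    (hβ : LitBelow lt β A.ground) {L : Literal Sg V} (h : TrailLT lt β Γ L A.ground) :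
    BetaDefined lt β (lits (Γ.take m)) L := by
  have hmem : A.ground ∈ lits Γ := List.mem_map_of_mem (List.mem_of_getElem? hA)
  rcases h.cases_of_definesAt ⟨hβ, Or.inl (.of_mem hmem)⟩ with h | ⟨i, j, hL, -, hi, hj, hij⟩
  · exact h.take hΓ hm
  · obtain rfl := hj.unique hΓ (Or.inl (Or.inl ⟨A, hA, rfl⟩))
    refine ⟨hL.2.1.1, (hi.defined_iff hΓ j).2 ?_⟩
    rcases hij with h | ⟨-, ⟨-, h⟩ | ⟨h, -⟩⟩
    · exact h
    · exact absurd h.mem (hΓ.consistent.comp_notMem hmem)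
    · exact absurd hmem h

/-- The complement is the second literal at its position, so the trail literal is the only smaller
one that is not defined earlier. -/
theorem TrailLT.defined_take_of_comp {β : Sg.Term V} {Γ : List (AnnLit Sg V)}
    (hΓ : IsTrail lt Γ) {m : ℕ} (hm : ZeroBefore Γ m) {A : AnnLit Sg V} (hA : Γ[m]? = some A)
    (hβ : LitBelow lt β A.ground) {L : Literal Sg V} (h : TrailLT lt β Γ L A.ground.comp) :
    BetaDefined lt β (lits (Γ.take m)) L ∨ L = A.ground := by
  have hmem : A.ground ∈ lits Γ := List.mem_map_of_mem (List.mem_of_getElem? hA)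
  rcases h.cases_of_definesAt ⟨litBelow_comp.2 hβ, litDefined_comp.2 (Or.inl (.of_mem hmem))⟩ with
    h | ⟨i, j, hL, -, hi, hj, hij⟩
  · exact Or.inl (h.take hΓ hm)
  · obtain rfl := hj.unique hΓ (Or.inl (Or.inr ⟨A, hA, (Literal.comp_comp _).symm⟩))
    rcases hij with h | ⟨rfl, ⟨⟨B, hB, rfl⟩, -⟩ | ⟨-, h⟩⟩
    · exact Or.inl ⟨hL.2.1.1, (hi.defined_iff hΓ j).2 h⟩
    · rw [hA] at hB
      exact Or.inr (by rw [Option.some.inj hB])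
    · rw [Literal.comp_comp] at h
      exact absurd hmem h

/-- The multiset extension of a well-founded relation is well-founded. -/
theorem wellFounded_mulExt {α : Type*} {r : α → α → Prop} (h : WellFounded r) :
    WellFounded (MulExt r) := by
  have htg : WellFounded (Relation.TransGen r) := h.transGen
  -- Since `r` need not be transitive, the preorder is generated by its transitive closure; the
  -- multiset extension of `r` is contained in the one of this closure.
  let _ : Preorder α :=
    { le := fun a b => a = b ∨ Relation.TransGen r a b
      lt := Relation.TransGen r
      le_refl := fun a => Or.inl rfl
      le_trans := by
        rintro a b c (rfl | h1) (rfl | h2)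
        · exact Or.inl rfl
        · exact Or.inr h2
        · exact Or.inr h1
        · exact Or.inr (h1.trans h2)
      lt_iff_le_not_ge := by
        intro a b
        constructor
        · intro hab
          refine ⟨Or.inr hab, ?_⟩
          rintro (rfl | hba)
          · exact htg.irrefl.irrefl _ hab
          · exact htg.irrefl.irrefl _ (hab.trans hba)
        · rintro ⟨rfl | hab, hn⟩
          · exact absurd (Or.inl rfl) hn
          · exact hab }
  have : WellFoundedLT α := ⟨htg⟩
  refine Subrelation.wf ?_ (Multiset.wellFounded_isDershowitzMannaLT (α := α))
  rintro M N ⟨X, Y, Z, hZ, rfl, rfl, hY⟩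
  refine ⟨X, Y, Z, by simpa using hZ, rfl, rfl, fun y hy => ?_⟩
  obtain ⟨z, hz, hr⟩ := hY y hy
  exact ⟨z, hz, Relation.TransGen.single hr⟩

open Classical in
/-- A rank that witnesses the well-foundedness of the trail induced ordering. -/
noncomputable def trailRank (lt : Sg.Term V → Sg.Term V → Prop) (β : Sg.Term V)
    (Γ : List (AnnLit Sg V)) (L : Literal Sg V) : ℕ × ℕ × Literal Sg V :=
  if PosLevel lt β Γ L then
    (sInf {i | DefinesAt Γ L i} + 1, if L ∈ lits Γ then 0 else if L.comp ∈ lits Γ then 1 else 2, L)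
  else if ZeroLevel lt β Γ L then (0, 0, L)
  else (Γ.length + 1, 0, L)

theorem trailRank_of_posLevel {β : Sg.Term V} {Γ : List (AnnLit Sg V)} (hΓ : IsTrail lt Γ)
    {L : Literal Sg V} {i : ℕ} (h : PosLevel lt β Γ L) (hi : DefinesAt Γ L i) :
    (trailRank lt β Γ L).1 = i + 1 := by
  have : {i | DefinesAt Γ L i} = {i} :=
    Set.eq_singleton_iff_unique_mem.2 ⟨hi, fun j hj => DefinesAt.unique hΓ hj hi⟩
  rw [trailRank, if_pos h, this, csInf_singleton]

theorem trailRank_of_zeroLevel {β : Sg.Term V} {Γ : List (AnnLit Sg V)} {L : Literal Sg V}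
    (h : ZeroLevel lt β Γ L) : trailRank lt β Γ L = (0, 0, L) := by
  rw [trailRank, if_neg fun h' => by have := h'.2.2; rw [h.2.2] at this; omega, if_pos h]

theorem trailRank_of_undefined {β : Sg.Term V} {Γ : List (AnnLit Sg V)} {L : Literal Sg V}
    (h : ¬ BetaDefined lt β (lits Γ) L) : trailRank lt β Γ L = (Γ.length + 1, 0, L) := by
  rw [trailRank, if_neg fun h' => h h'.2.1, if_neg fun h' => h h'.2.1]

theorem trailRank_snd_other {β : Sg.Term V} {Γ : List (AnnLit Sg V)} {L : Literal Sg V} {i : ℕ}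
    (h : PosLevel lt β Γ L) (hi : IsOther lt β Γ i L) : (trailRank lt β Γ L).2 = (2, L) := by
  rw [trailRank, if_pos h, if_neg hi.2.2.1, if_neg hi.2.2.2.1]

theorem trailRank_snd_lit {β : Sg.Term V} {Γ : List (AnnLit Sg V)} {L : Literal Sg V}
    (h : PosLevel lt β Γ L) (hL : L ∈ lits Γ) : (trailRank lt β Γ L).2 = (0, L) := by
  rw [trailRank, if_pos h, if_pos hL]

theorem trailRank_snd_comp {β : Sg.Term V} {Γ : List (AnnLit Sg V)} (hΓ : IsTrail lt Γ)
    {L : Literal Sg V} (h : PosLevel lt β Γ L) (hL : L.comp ∈ lits Γ) :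
    (trailRank lt β Γ L).2 = (1, L) := by
  have : L ∉ lits Γ := fun h' => hΓ.consistent.comp_notMem h' hL
  rw [trailRank, if_pos h, if_neg this, if_pos hL]

theorem wellFounded_trailLT (hlt : DesiredOrdering lt) {β : Sg.Term V} {Γ : List (AnnLit Sg V)}
    (hΓ : IsTrail lt Γ) : WellFounded (TrailLT lt β Γ) := by
  -- The rank compares first the defining position, then trail literal before complement before all
  -- others, and finally the term ordering. Positions are shifted by one to leave `0` for level
  -- zero, while `Γ.length + 1` lies above all positions and serves the `β`-undefined literals.
  have hwf : WellFounded (InvImage (Prod.Lex (· < ·) (Prod.Lex (· < ·) (LitLT lt)))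
      (trailRank lt β Γ)) :=
    InvImage.wf _ (WellFounded.prod_lex wellFounded_lt
      (WellFounded.prod_lex wellFounded_lt (InvImage.wf _ (wellFounded_mulExt hlt.wf))))
  have left : ∀ {x y : ℕ × ℕ × Literal Sg V}, x.1 < y.1 →
      Prod.Lex (· < ·) (Prod.Lex (· < ·) (LitLT lt)) x y := fun h => Prod.lex_def.2 (Or.inl h)
  have right : ∀ {x y : ℕ × ℕ × Literal Sg V}, x.1 = y.1 →
      Prod.Lex (· < ·) (LitLT lt) x.2 y.2 →
      Prod.Lex (· < ·) (Prod.Lex (· < ·) (LitLT lt)) x y :=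
    fun h h' => Prod.lex_def.2 (Or.inr ⟨h, h'⟩)
  have pos : ∀ {L K i j}, PosLevel lt β Γ L → PosLevel lt β Γ K → DefinesAt Γ L i →
      DefinesAt Γ K j → (i < j ∨ (i = j ∧ Prod.Lex (· < ·) (LitLT lt) (trailRank lt β Γ L).2
        (trailRank lt β Γ K).2)) →
      InvImage (Prod.Lex (· < ·) (Prod.Lex (· < ·) (LitLT lt))) (trailRank lt β Γ) L K := by
    intro L K i j hL hK hi hj h
    have h1 := trailRank_of_posLevel hΓ hL hi
    have h2 := trailRank_of_posLevel hΓ hK hj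
    rcases h with h | ⟨rfl, h⟩
    · exact left (by omega)
    · exact right (by omega) h
  refine Subrelation.wf (fun {L K} h => ?_) hwf
  cases h with
  | other_other hL hK hi hj hij =>
    refine pos hL hK (Or.inr hi.2.2.2.2) (Or.inr hj.2.2.2.2) (hij.imp id fun h => ⟨h.1, ?_⟩)
    rw [trailRank_snd_other hL hi, trailRank_snd_other hK hj]
    exact .right _ h.2
  | lit_lit hL hK hi hj hij =>
    exact pos hL hK (Or.inl (Or.inl hi)) (Or.inl (Or.inl hj)) (Or.inl hij)
  | comp_lit hL hK hi hj hij =>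
    exact pos hL hK (Or.inl (Or.inr hi)) (Or.inl (Or.inl hj)) (Or.inl hij)
  | lit_comp hL hK hi hj hij =>
    refine pos hL hK (Or.inl (Or.inl hi)) (Or.inl (Or.inr hj)) (hij.lt_or_eq.imp id fun h => ⟨h, ?_⟩)
    rw [trailRank_snd_lit hL hi.mem, trailRank_snd_comp hΓ hK hj.mem]
    exact .left _ _ Nat.zero_lt_one
  | comp_comp hL hK hi hj hij =>
    exact pos hL hK (Or.inl (Or.inr hi)) (Or.inl (Or.inr hj)) (Or.inl hij)
  | trail_other hL hK hi hj hij =>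
    refine pos hL hK (Or.inl hi) (Or.inr hj.2.2.2.2) (hij.lt_or_eq.imp id fun h => ⟨h, ?_⟩)
    rw [trailRank_snd_other hK hj]
    rcases hi with hi | hi
    · rw [trailRank_snd_lit hL hi.mem]
      exact .left _ _ Nat.zero_lt_two
    · rw [trailRank_snd_comp hΓ hL hi.mem]
      exact .left _ _ Nat.one_lt_two
  | other_trail hL hK hi hj hij =>
    exact pos hL hK (Or.inr hi.2.2.2.2) (Or.inl hj) (Or.inl hij)
  | zero_zero hL hK h =>
    rw [InvImage, trailRank_of_zeroLevel hL, trailRank_of_zeroLevel hK]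
    exact .right _ (.right _ h)
  | zero_pos hL hK =>
    -- A literal with an empty core has level zero, so one of positive level does have a defining
    -- position.
    obtain ⟨j, hj⟩ : ∃ j, DefinesAt Γ K j := by
      rcases hK.2.1.2.litLevel_spec with ⟨j, -, -, hj, -⟩ | ⟨-, h⟩
      · exact ⟨j, hj⟩
      · have := hK.2.2
        omega
    refine left ?_
    rw [trailRank_of_zeroLevel hL, trailRank_of_posLevel hΓ hK hj]
    exact Nat.succ_pos _
  | undef_undef _ _ hL hK h =>
    rw [InvImage, trailRank_of_undefined hL, trailRank_of_undefined hK]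
    exact .right _ (.right _ h)
  | def_undef hLg _ hL hK =>
    refine left ?_
    rw [trailRank_of_undefined hK]
    rcases Nat.eq_zero_or_pos (litLevel Γ L) with h0 | h0
    · rw [trailRank_of_zeroLevel ⟨hLg, hL, h0⟩]
      exact Nat.succ_pos _
    · rcases hL.2.litLevel_spec with ⟨j, -, -, hj, -⟩ | ⟨-, h⟩
      · rw [trailRank_of_posLevel hΓ ⟨hLg, hL, h0⟩ hj]
        have := hj.lt_length
        simp only
        omega
      · omega

end Trails

/-! ### The model argument for redundant clauses, and operations that preserve trails. -/

section Redundancy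

variable {Sg : FirstOrder.Language.{u, v}} {V : Type w} {lt : Sg.Term V → Sg.Term V → Prop}

/-! ### Clauses that are smaller than a false clause -/

theorem clauseBetaFalse_iff {β : Sg.Term V} {Γ : List (Literal Sg V)} {C : Clause Sg V} :
    ClauseBetaFalse lt β Γ C ↔ ∀ L ∈ C, LitBelow lt β L ∧ LitFalse Γ L := by
  rw [ClauseBetaFalse, clauseBelow_iff]
  exact ⟨fun h L hL => ⟨h.1 L hL, h.2 L hL⟩, fun h => ⟨fun L hL => (h L hL).1, fun L hL => (h L hL).2⟩⟩

theorem ClauseBetaFalse.mono {β : Sg.Term V} {Γ Δ : List (Literal Sg V)} {C : Clause Sg V}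
    (hΓ : Γ ⊆ Δ) (h : ClauseBetaFalse lt β Γ C) : ClauseBetaFalse lt β Δ C :=
  ⟨h.1, fun L hL => (h.2 L hL).mono hΓ⟩

theorem ClauseBetaFalse.of_subset {β : Sg.Term V} {Γ : List (Literal Sg V)} {C D : Clause Sg V}
    (hD : D ⊆ C) (h : ClauseBetaFalse lt β Γ C) : ClauseBetaFalse lt β Γ D :=
  clauseBetaFalse_iff.2 fun L hL => clauseBetaFalse_iff.1 h L (hD hL)

/-- No ground instance of a clause in `N` is `β`-false in `Γ`. -/
def NoConflict (lt : Sg.Term V → Sg.Term V → Prop) (β : Sg.Term V) (Γ : List (Literal Sg V))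
    (N : Set (Clause Sg V)) : Prop :=
  ∀ D ∈ gnd N, ¬ ClauseBetaFalse lt β Γ D

/-- Clauses are universally closed, so the failing clause may fail under another valuation than `C`.
This is harmless, because truth and falsity in a sequence of literals refer to all valuations. -/
theorem Entails.exists_fails {N : Set (Clause Sg V)} {C : Clause Sg V} (h : Entails N C)
    (M : Type (max u w)) [Nonempty M] [Sg.Structure M] {ν : V → M} (hC : ∀ L ∈ C, ¬ L.Holds ν) :
    ∃ D ∈ N, ∃ ν : V → M, ∀ L ∈ D, ¬ L.Holds ν := by
  by_contra hn
  push Not at hn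
  obtain ⟨L, hL, hν⟩ := h M hn ν
  exact hC L hL hν

theorem Entails.mono {N N' : Set (Clause Sg V)} {C : Clause Sg V} (hN : N ⊆ N')
    (h : Entails N C) : Entails N' C := fun M _ _ hM => h M fun D hD => hM D (hN hD)

/-- Let all literals that are smaller than a literal in `R`, and all those smaller than `B` that
fail in a given model of `Γ`, be `β`-defined in `Γ`. Then a clause that is smaller than `B ∨ R`
and fails in the model is false in `Γ`, except that it may contain `B` once. -/
theorem betaFalse_or_cons {β : Sg.Term V} {Γ : List (Literal Sg V)}
    {r : Literal Sg V → Literal Sg V → Prop} {B : Literal Sg V} {R D : Clause Sg V}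
    {M : Type (max u w)} [Nonempty M] [Sg.Structure M] (hM : Models M Γ) {ν : V → M}
    (hR : ClauseBetaFalse lt β Γ R) (hr : ∀ L, ∀ K ∈ R, r L K → BetaDefined lt β Γ L)
    (hB : ∀ L, r L B → ¬ L.Holds ν → BetaDefined lt β Γ L) (hD : MulExt r D (B ::ₘ R))
    (hν : ∀ L ∈ D, ¬ L.Holds ν) :
    ClauseBetaFalse lt β Γ D ∨ ∃ D', D = B ::ₘ D' ∧ ClauseBetaFalse lt β Γ D' := by
  obtain ⟨X, Y, Z, -, rfl, hN, hYZ⟩ := hD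
  have hY : ∀ L ∈ Y, LitBelow lt β L ∧ LitFalse Γ L := by
    intro L hL
    have hf := hν L (Multiset.mem_add.2 (Or.inr hL))
    obtain ⟨z, hz, hLz⟩ := hYZ L hL
    have hd : BetaDefined lt β Γ L := by
      have : z ∈ B ::ₘ R := hN ▸ Multiset.mem_add.2 (Or.inr hz)
      rcases Multiset.mem_cons.1 this with rfl | h
      · exact hB L hLz hf
      · exact hr L z h hLz
    exact ⟨hd.1, hd.2.false_of_not_holds hM hf⟩
  rw [clauseBetaFalse_iff] at hR
  -- The part `X` that both multisets share is the only place where `B` can survive. After one copy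
  -- is removed, the rest of `X` lies in `R`.
  by_cases hBX : B ∈ X
  · obtain ⟨X', rfl⟩ := Multiset.exists_cons_of_mem hBX
    rw [Multiset.cons_add, Multiset.cons_inj_right] at hN
    refine Or.inr ⟨X' + Y, Multiset.cons_add _ _ _, clauseBetaFalse_iff.2 fun L hL => ?_⟩
    rcases Multiset.mem_add.1 hL with h | h
    · exact hR L (hN ▸ Multiset.mem_add.2 (Or.inl h))
    · exact hY L h
  · refine Or.inl (clauseBetaFalse_iff.2 fun L hL => ?_)
    rcases Multiset.mem_add.1 hL with h | h
    · have : L ∈ B ::ₘ R := hN ▸ Multiset.mem_add.2 (Or.inl h)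
      rcases Multiset.mem_cons.1 this with rfl | h'
      · exact absurd h hBX
      · exact hR L h'
    · exact hY L h

/-- A clause that is false in a prefix of the trail without conflicts is not redundant. -/
theorem not_groundRedundant_of_noConflict {β : Sg.Term V} {Γ : List (AnnLit Sg V)}
    (hΓ : IsTrail lt Γ) {m : ℕ} (hm : ZeroBefore Γ m) {C : Clause Sg V}
    (hC : ClauseBetaFalse lt β (lits (Γ.take m)) C) {N : Set (Clause Sg V)}
    (hN : NoConflict lt β (lits (Γ.take m)) N) :
    ¬ GroundRedundant (TrailLT lt β Γ) (gnd N) C := by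
  intro h
  obtain ⟨M, hne, _, hM⟩ := (hΓ.consistent.mono (lits_take_subset_lits Γ m)).exists_model
  obtain ⟨x⟩ := id hne
  -- All literals of `C` are false in the prefix, so any model of the prefix refutes `C` and some
  -- clause not larger than `C`. All literals of that clause turn out to be defined, hence false, in
  -- the prefix.
  obtain ⟨D, ⟨hD, hDC⟩, ν, hν⟩ := Entails.exists_fails h M (ν := fun _ => x)
    fun L hL => litFalse_iff.1 (hC.2 L hL) M hM _
  refine hN D hD ?_
  rcases hDC with rfl | ⟨X, Y, Z, -, rfl, rfl, hY⟩
  · exact hC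
  · have hC' := clauseBetaFalse_iff.1 hC
    refine clauseBetaFalse_iff.2 fun L hL => ?_
    rcases Multiset.mem_add.1 hL with h | h
    · exact hC' L (Multiset.mem_add.2 (Or.inl h))
    · obtain ⟨z, hz, hLz⟩ := hY L h
      obtain ⟨h1, h2⟩ := hC' z (Multiset.mem_add.2 (Or.inr hz))
      obtain ⟨d1, d2⟩ := hLz.defined_take hΓ hm ⟨h1, Or.inr h2⟩
      exact ⟨d1, d2.false_of_not_holds hM (hν L hL)⟩

/-- If a clause with the complement of the `m`-th trail literal, whose other literals are false
before, is redundant, then some ground instance is of the same form. -/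
theorem GroundRedundant.exists_comp {β : Sg.Term V} {Γ : List (AnnLit Sg V)}
    (hΓ : IsTrail lt Γ) {m : ℕ} (hm : ZeroBefore Γ m) {A : AnnLit Sg V} (hA : Γ[m]? = some A)
    (hβ : LitBelow lt β A.ground) {R : Clause Sg V}
    (hR : ClauseBetaFalse lt β (lits (Γ.take m)) R) {N : Set (Clause Sg V)}
    (hN : NoConflict lt β (lits (Γ.take m)) N)
    (h : GroundRedundant (TrailLT lt β Γ) (gnd N) (A.ground.comp ::ₘ R)) :
    ∃ D, A.ground.comp ::ₘ D ∈ gnd N ∧ ClauseBetaFalse lt β (lits (Γ.take m)) D := by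
  -- The model has to satisfy the whole trail and not only the prefix, so that the trail literal
  -- holds and its complement fails.
  obtain ⟨M, hne, _, hM⟩ := hΓ.consistent.exists_model
  have hmem : A.ground ∈ lits Γ := List.mem_map_of_mem (List.mem_of_getElem? hA)
  have hM' : Models M (lits (Γ.take m)) := hM.mono (lits_take_subset_lits Γ m)
  obtain ⟨x⟩ := id hne
  obtain ⟨D, ⟨hD, hDC⟩, ν, hν⟩ := Entails.exists_fails h M (ν := fun _ => x) fun L hL => by
    rcases Multiset.mem_cons.1 hL with rfl | hL
    · rw [Literal.holds_comp, not_not]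
      exact hM _ hmem _
    · exact litFalse_iff.1 (hR.2 L hL) M hM' _
  rcases hDC with rfl | hDC
  · exact ⟨R, hD, hR⟩
  · have hR' := clauseBetaFalse_iff.1 hR
    rcases betaFalse_or_cons hM' hR
        (fun L K hK hLK => hLK.defined_take hΓ hm ⟨(hR' K hK).1, Or.inr (hR' K hK).2⟩)
        -- Among the literals smaller than the complement, only the trail literal can be undefined
        -- in the prefix; it holds in the model and so does not occur in a failing clause.
        (fun L hL hf => (hL.defined_take_of_comp hΓ hm hA hβ).resolve_right fun h => by
          rw [h] at hf
          exact hf (hM _ hmem _)) hDC hν with h | ⟨D', rfl, h⟩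
    · exact absurd h (hN D hD)
    · exact ⟨D', hD, h⟩

/-- A set of smaller clauses that entails the annotation of a trail literal contains a clause that
propagates this literal. -/
theorem Entails.exists_propagating {β : Sg.Term V} {Γ : List (AnnLit Sg V)}
    (hΓ : IsTrail lt Γ) {m : ℕ} (hm : ZeroBefore Γ m) {A : AnnLit Sg V} (hA : Γ[m]? = some A)
    (hβ : LitBelow lt β A.ground) {R : Clause Sg V}
    (hR : ClauseBetaFalse lt β (lits (Γ.take m)) R) {N : Set (Clause Sg V)}
    (hlt : ∀ D ∈ N, MulExt (TrailLT lt β Γ) D (A.ground ::ₘ R))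
    (hN : ∀ D ∈ N, ¬ ClauseBetaFalse lt β (lits (Γ.take m)) D)
    (h : Entails N (A.ground ::ₘ R)) :
    ∃ D, A.ground ::ₘ D ∈ N ∧ ClauseBetaFalse lt β (lits (Γ.take m)) D := by
  have hu : ¬ LitTrue (lits (Γ.take m)) A.ground := fun h' => hΓ.undefined m A hA (Or.inl h')
  rw [litTrue_iff] at hu
  push Not at hu
  -- As the trail literal is undefined in the prefix, some model of the prefix falsifies it.
  obtain ⟨M, _, _, hM, ν₀, hν₀⟩ := hu
  obtain ⟨D, hD, ν, hν⟩ := Entails.exists_fails h M (ν := ν₀) fun L hL => by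
    rcases Multiset.mem_cons.1 hL with rfl | hL
    · exact hν₀
    · exact litFalse_iff.1 (hR.2 L hL) M hM _
  have hR' := clauseBetaFalse_iff.1 hR
  rcases betaFalse_or_cons hM hR
      (fun L K hK hLK => hLK.defined_take hΓ hm ⟨(hR' K hK).1, Or.inr (hR' K hK).2⟩)
      (fun L hL _ => hL.defined_take_of_ground hΓ hm hA hβ) (hlt D hD) hν with h | ⟨D', rfl, h⟩
  · exact absurd h (hN D hD)
  · exact ⟨D', hD, h⟩

theorem Clause.exists_of_subst_eq_cons {E : Clause Sg V} {δ : Subst Sg V} {B : Literal Sg V}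
    {D : Clause Sg V} (h : Clause.subst E δ = B ::ₘ D) :
    ∃ L C, E = L ::ₘ C ∧ L.subst δ = B ∧ Clause.subst C δ = D := by
  have hB : B ∈ Clause.subst E δ := h ▸ Multiset.mem_cons_self B D
  obtain ⟨L, hL, rfl⟩ := Multiset.mem_map.1 hB
  obtain ⟨C, rfl⟩ := Multiset.exists_cons_of_mem hL
  rw [Clause.subst_cons, Multiset.cons_inj_right] at h
  exact ⟨L, C, rfl, rfl, h⟩

/-! ### Operations on trails -/

theorem IsTrail.level_mono {Γ : List (AnnLit Sg V)} (hΓ : IsTrail lt Γ) {i j : ℕ}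
    {A B : AnnLit Sg V} (hA : Γ[i]? = some A) (hB : Γ[j]? = some B) (hij : i ≤ j) :
    A.level ≤ B.level := by
  obtain ⟨hi, rfl⟩ := List.getElem?_eq_some_iff.1 hA
  obtain ⟨hj, rfl⟩ := List.getElem?_eq_some_iff.1 hB
  rcases hij.lt_or_eq with h | rfl
  · exact List.pairwise_iff_getElem.1 hΓ.levels i j hi hj h
  · exact le_rfl

theorem lits_take (Γ : List (AnnLit Sg V)) (m : ℕ) : lits (Γ.take m) = (lits Γ).take m :=
  List.map_take

theorem map_set_eq {α β : Type*} {l : List α} {j : ℕ} {a a' : α} (h : l[j]? = some a) {f : α → β}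
    (hf : f a' = f a) : (l.set j a').map f = l.map f := by
  have hj := (List.getElem?_eq_some_iff.1 h).1
  rw [List.map_set, hf]
  refine List.ext_getElem? fun i => ?_
  rw [List.getElem?_set]
  split
  · rename_i h'
    subst h'
    rw [if_pos (by simpa using hj), List.getElem?_map, h]; rfl
  · rfl

/-- Apart from groundness of the annotations, being a trail depends only on the levels and the
ground literals, and these are kept. -/
theorem IsTrail.set {Γ : List (AnnLit Sg V)} (hΓ : IsTrail lt Γ) {j : ℕ} {A A' : AnnLit Sg V}
    (hA : Γ[j]? = some A) (hl : A'.level = A.level) (hg : A'.ground = A.ground)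
    (hc : A'.groundClause.Ground) : IsTrail lt (Γ.set j A') := by
  have hlits : lits (Γ.set j A') = lits Γ := map_set_eq hA hg
  have hget : ∀ (i : ℕ) (B : AnnLit Sg V), (Γ.set j A')[i]? = some B → ∃ B', Γ[i]? = some B' ∧ B.ground = B'.ground := by
    intro i B hB
    have h1 : (lits (Γ.set j A'))[i]? = some B.ground := by
      rw [lits, List.getElem?_map, hB]; rfl
    rw [hlits, lits, List.getElem?_map, Option.map_eq_some_iff] at h1
    obtain ⟨B', h1, h2⟩ := h1
    exact ⟨B', h1, h2.symm⟩
  refine ⟨?_, ?_, ?_, ?_, ?_⟩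
  · intro B hB
    rcases List.mem_or_eq_of_mem_set hB with hB | rfl
    · exact hΓ.closures B hB
    · exact hc
  · rw [hlits]; exact hΓ.consistent
  · have h : ((Γ.set j A').map AnnLit.level).Pairwise (· ≤ ·) := by
      rw [map_set_eq hA hl, List.pairwise_map]; exact hΓ.levels
    exact List.pairwise_map.1 h
  · intro i B hB
    obtain ⟨B', hB', e⟩ := hget i B hB
    rw [lits_take, hlits, ← lits_take, e]
    exact hΓ.undefined i B' hB'
  · intro i B hB
    obtain ⟨B', hB', e⟩ := hget i B hB
    rw [lits_take, hlits, ← lits_take, e]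
    exact hΓ.irreducible i B' hB'

/-- Exchanging an annotation for another ground one of the same literal keeps the trail, so falsity
of the remainder is the only real condition. -/
theorem canJustify_of_subst_eq_cons {β : Sg.Term V} {Γ : List (AnnLit Sg V)} (hΓ : IsTrail lt Γ)
    {j : ℕ} {A : AnnLit Sg V} (hA : Γ[j]? = some A) {E : Clause Sg V} {δ : Subst Sg V}
    {D : Clause Sg V} (hE : Clause.subst E δ = A.ground ::ₘ D)
    (hg : Clause.Ground (Clause.subst E δ)) (hD : ClauseBetaFalse lt β (lits (Γ.take j)) D) :
    CanJustify lt β Γ j A E δ := by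
  obtain ⟨L, C, rfl, hL, rfl⟩ := Clause.exists_of_subst_eq_cons hE
  exact ⟨L, C, rfl, hL, hD, hΓ.set hA rfl hL hg⟩

theorem lastLevel_nil : lastLevel ([] : List (AnnLit Sg V)) = 0 := rfl

theorem lastLevel_append (Γ : List (AnnLit Sg V)) (A : AnnLit Sg V) :
    lastLevel (Γ ++ [A]) = A.level := by simp [lastLevel]

theorem IsTrail.level_le_lastLevel {Γ : List (AnnLit Sg V)} (hΓ : IsTrail lt Γ) {A : AnnLit Sg V}
    (hA : A ∈ Γ) : A.level ≤ lastLevel Γ := by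
  rcases List.eq_nil_or_concat Γ with rfl | ⟨Δ, B, rfl⟩
  · cases hA
  · rw [List.concat_eq_append] at *
    rw [lastLevel_append]
    obtain ⟨i, hi⟩ := List.mem_iff_getElem?.1 hA
    have hil := (List.getElem?_eq_some_iff.1 hi).1
    refine hΓ.level_mono hi (j := Δ.length) (by simp) ?_
    simp at hil
    omega

theorem isTrail_nil : IsTrail lt ([] : List (AnnLit Sg V)) where
  closures A hA := by cases hA
  consistent := by
    -- The empty sequence holds in any structure, for instance one with a single element.
    let _ : Sg.Structure PUnit.{max u w + 1} := ⟨fun _ _ => PUnit.unit, fun _ _ => True⟩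
    exact Consistent.of_model PUnit.{max u w + 1} fun L hL => by cases hL
  levels := List.Pairwise.nil
  undefined i A h := by simp at h
  irreducible i A h := by simp at h

theorem getElem?_append_cases {α : Type*} {l l' : List α} {i : ℕ} {a : α} (h : l[i]? = some a) :
    (l ++ l')[i]? = some a ∧ (l ++ l').take i = l.take i := by
  have hi := (List.getElem?_eq_some_iff.1 h).1
  exact ⟨by rw [List.getElem?_append_left hi, h], List.take_append_of_le_length hi.le⟩

theorem IsTrail.prefix {Γ Δ : List (AnnLit Sg V)} (h : IsTrail lt (Γ ++ Δ)) : IsTrail lt Γ where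
  closures A hA := h.closures A (List.mem_append_left _ hA)
  consistent := h.consistent.mono (by rw [lits_append]; exact List.subset_append_left _ _)
  levels := (List.pairwise_append.1 h.levels).1
  undefined i A hA := by
    obtain ⟨h1, h2⟩ := getElem?_append_cases (l' := Δ) hA
    rw [← h2]; exact h.undefined i A h1
  irreducible i A hA := by
    obtain ⟨h1, h2⟩ := getElem?_append_cases (l' := Δ) hA
    rw [← h2]; exact h.irreducible i A h1

theorem getElem?_concat_cases {α : Type*} {l : List α} {i : ℕ} {a b : α}
    (h : (l ++ [b])[i]? = some a) :
    (l[i]? = some a ∧ (l ++ [b]).take i = l.take i ∧ (l ++ [b]).take (i + 1) = l.take (i + 1)) ∨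
      (a = b ∧ i = l.length ∧ (l ++ [b]).take i = l ∧ (l ++ [b]).take (i + 1) = l ++ [b]) := by
  rcases lt_trichotomy i l.length with hi | rfl | hi
  · rw [List.getElem?_append_left hi] at h
    exact Or.inl ⟨h, List.take_append_of_le_length hi.le, List.take_append_of_le_length hi⟩
  · refine Or.inr ⟨by simpa using h.symm, rfl, by simp, ?_⟩
    rw [List.take_of_length_le (by simp)]
  · rw [List.getElem?_eq_none (by simp; omega)] at h
    cases h

theorem IsTrail.append {Γ : List (AnnLit Sg V)} (h : IsTrail lt Γ) {A : AnnLit Sg V}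
    (hc : A.groundClause.Ground) (hg : A.ground.Ground) (hl : lastLevel Γ ≤ A.level)
    (hu : ¬ LitDefined (lits Γ) A.ground) (hi : LitIrreducible (conv lt (lits Γ)) A.ground) :
    IsTrail lt (Γ ++ [A]) where
  closures B hB := by
    rcases List.mem_append.1 hB with hB | hB
    · exact h.closures B hB
    · rwa [List.mem_singleton.1 hB]
  consistent := by
    rw [lits_append]
    exact Consistent.append hg hu
  levels := List.pairwise_append.2 ⟨h.levels, List.pairwise_singleton _ _, fun B hB C hC => by
    rw [List.mem_singleton.1 hC]
    exact (h.level_le_lastLevel hB).trans hl⟩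
  undefined i B hB := by
    rcases getElem?_concat_cases hB with ⟨h1, h2, -⟩ | ⟨rfl, -, h2, -⟩
    · rw [h2]; exact h.undefined i B h1
    · rwa [h2]
  irreducible i B hB := by
    rcases getElem?_concat_cases hB with ⟨h1, h2, -⟩ | ⟨rfl, -, h2, -⟩
    · rw [h2]; exact h.irreducible i B h1
    · rwa [h2]

end Redundancy

/-! ### Invariants of regular runs, conflict resolution phases, and construction of propagations. -/

section Runs

variable {Sg : FirstOrder.Language.{u, v}} {V : Type w} {lt : Sg.Term V → Sg.Term V → Prop}

/-! ### Invariants of runs -/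

/-- `Γ` is a trail. The annotations of its propagated literals are below `β` and, except for the
propagated literal, false in the trail to the left; those of decision literals are false in the
trail up to the decision literal, except for this literal. -/
structure AnnotatedTrail (lt : Sg.Term V → Sg.Term V → Prop) (β : Sg.Term V)
    (Γ : List (AnnLit Sg V)) : Prop where
  isTrail : IsTrail lt Γ
  annotation : ∀ (i : ℕ) (A : AnnLit Sg V), Γ[i]? = some A →
    (A.level = lastLevel (Γ.take i) ∧ SoundClosure lt β (lits (Γ.take i)) A.lit A.rest A.sub) ∨
      (IsDecision (Γ.take i) A ∧ SoundClosure lt β (lits (Γ.take (i + 1))) A.lit A.rest A.sub)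

theorem annotatedTrail_nil {β : Sg.Term V} : AnnotatedTrail lt β [] :=
  ⟨isTrail_nil, fun i A h => by simp at h⟩

theorem AnnotatedTrail.sound {β : Sg.Term V} {Γ : List (AnnLit Sg V)}
    (h : AnnotatedTrail lt β Γ) {A : AnnLit Sg V} (hA : A ∈ Γ) :
    SoundClosure lt β (lits Γ) A.lit A.rest A.sub := by
  obtain ⟨i, hi⟩ := List.mem_iff_getElem?.1 hA
  rcases h.annotation i A hi with ⟨-, h⟩ | ⟨-, h⟩ <;> exact h.mono (lits_take_subset_lits _ _)

theorem AnnotatedTrail.prefix {β : Sg.Term V} {Γ Δ : List (AnnLit Sg V)}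
    (h : AnnotatedTrail lt β (Γ ++ Δ)) : AnnotatedTrail lt β Γ where
  isTrail := h.isTrail.prefix
  annotation i A hA := by
    obtain ⟨h1, h2⟩ := getElem?_append_cases (l' := Δ) hA
    have := h.annotation i A h1
    rwa [h2, List.take_append_of_le_length (List.getElem?_eq_some_iff.1 hA).1] at this

theorem AnnotatedTrail.append {β : Sg.Term V} {Γ : List (AnnLit Sg V)}
    (h : AnnotatedTrail lt β Γ) {A : AnnLit Sg V} (hu : ¬ LitDefined (lits Γ) A.ground)
    (hi : LitIrreducible (conv lt (lits Γ)) A.ground)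
    (hA : (A.level = lastLevel Γ ∧ SoundClosure lt β (lits Γ) A.lit A.rest A.sub) ∨
      (IsDecision Γ A ∧ SoundClosure lt β (lits (Γ ++ [A])) A.lit A.rest A.sub)) :
    AnnotatedTrail lt β (Γ ++ [A]) where
  isTrail := by
    have hs : SoundClosure lt β (lits (Γ ++ [A])) A.lit A.rest A.sub := by
      rcases hA with ⟨-, h⟩ | ⟨-, h⟩
      · refine h.mono ?_
        rw [lits_append]; exact List.subset_append_left _ _
      · exact h
    refine h.isTrail.append hs.ground hs.1.1 ?_ hu hi
    rcases hA with ⟨h, -⟩ | ⟨h, -⟩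
    · exact h.ge
    · rw [IsDecision] at h; omega
  annotation i B hB := by
    rcases getElem?_concat_cases hB with ⟨h1, h2, h3⟩ | ⟨rfl, -, h2, h3⟩
    · rw [h2, h3]; exact h.annotation i B h1
    · rw [h2, h3]; exact hA

/-- Reduction to normal form keeps the literal undefined and makes it irreducible. Falsity of the
new side literals comes from the soundness of the chain relative to the present trail. -/
theorem AnnotatedTrail.append_propagated (hlt : DesiredOrdering lt) {β : Sg.Term V}
    {Γ : List (AnnLit Sg V)} (h : AnnotatedTrail lt β Γ) {A : AnnLit Sg V}
    (hA : SoundClosure lt β (lits Γ) A.lit A.rest A.sub)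
    (hu : BetaUndefined lt β (lits Γ) A.ground) {P : List (RewriteStep Sg V)}
    {I : RewriteStep Sg V} (hP : IsReductionChainApplication lt Γ A P) (hI : P.getLast? = some I) :
    AnnotatedTrail lt β (Γ ++ [⟨lastLevel Γ, I.lit.toLit, I.rest, I.sub⟩]) := by
  obtain ⟨h1, h2, -, -⟩ := hP.sound hlt (β := β) hI hA.1.1 (hu.not_defined hlt hA.1.2)
  refine h.append h1 h2 (Or.inl ⟨rfl, ?_⟩)
  refine hP.1.1.sound hlt (fun B hB => ?_) (List.mem_of_getLast? hI)
  rcases List.mem_append.1 hB with hB | hB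
  · exact h.sound hB
  · rwa [List.mem_singleton.1 hB]

/-- Of the chain only the final literal is used. The annotation `K ∨ comp K` is false apart from `K`
only once `K` itself belongs to the trail, which is why decision literals have the weaker invariant.
-/
theorem AnnotatedTrail.append_decision (hlt : DesiredOrdering lt) {β : Sg.Term V}
    {Γ : List (AnnLit Sg V)} (h : AnnotatedTrail lt β Γ) {A : AnnLit Sg V}
    (hg : A.ground.Ground) (hβ : LitBelow lt β A.ground)
    (hu : BetaUndefined lt β (lits Γ) A.ground) {P : List (RewriteStep Sg V)}
    {I : RewriteStep Sg V} (hP : IsReductionChainApplication lt Γ A P) (hI : P.getLast? = some I) :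
    AnnotatedTrail lt β
      (Γ ++ [⟨lastLevel Γ + 1, I.lit.toLit, {I.lit.toLit.comp}, I.sub⟩]) := by
  obtain ⟨h1, h2, h3, h4⟩ := hP.sound hlt (β := β) hI hg (hu.not_defined hlt hβ)
  refine h.append h1 h2 (Or.inr ⟨rfl, ⟨h3, h4 hβ⟩, fun K hK => ?_⟩)
  rw [Clause.subst_singleton, Multiset.mem_singleton] at hK
  subst hK
  rw [Literal.comp_subst]
  refine ⟨Literal.comp_ground.2 h3, litBelow_comp.2 (h4 hβ), .of_comp_mem ?_⟩
  rw [Literal.comp_comp, lits_append]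
  exact List.mem_append_right _ (List.mem_singleton_self _)

/-- The invariants of regular runs. -/
structure State.Invariant (lt : Sg.Term V → Sg.Term V → Prop) (S : State Sg V) : Prop where
  trail : AnnotatedTrail lt S.β S.trail
  level : S.k = lastLevel S.trail
  noConflict : ∀ m < S.trail.length, NoConflict lt S.β (lits (S.trail.take m)) (S.N ∪ S.U)
  closure : ∀ C σ, S.status = .closure C σ →
    Clause.Ground (Clause.subst C σ) ∧ ClauseBetaFalse lt S.β (lits S.trail) (Clause.subst C σ)

theorem NoConflict.of_prefix {β : Sg.Term V} {Γ Δ : List (AnnLit Sg V)} {N : Set (Clause Sg V)}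
    (h : ∀ m < (Γ ++ Δ).length, NoConflict lt β (lits ((Γ ++ Δ).take m)) N) :
    ∀ m < Γ.length, NoConflict lt β (lits (Γ.take m)) N := by
  intro m hm
  have := h m (by simp; omega)
  rwa [List.take_append_of_le_length hm.le] at this

/-- Appending a literal turns the old trail into a proper prefix, which accounts for the extra
hypothesis. -/
theorem NoConflict.of_append {β : Sg.Term V} {Γ : List (AnnLit Sg V)} {N : Set (Clause Sg V)}
    {A : AnnLit Sg V} (h : ∀ m < Γ.length, NoConflict lt β (lits (Γ.take m)) N)
    (hΓ : NoConflict lt β (lits Γ) N) :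
    ∀ m < (Γ ++ [A]).length, NoConflict lt β (lits ((Γ ++ [A]).take m)) N := by
  intro m hm
  have hm' : m ≤ Γ.length := by simp at hm; omega
  rw [List.take_append_of_le_length hm']
  rcases hm'.lt_or_eq with h' | rfl
  · exact h m h'
  · rwa [List.take_length]

/-- If Conflict is not applicable, then no ground instance at all is `β`-false. -/
theorem noConflict_of_not_applicable (hlt : DesiredOrdering lt) {S : State Sg V}
    (hS : S.status = .top) (h : ¬ Applicable lt .conflict S) :
    NoConflict lt S.β (lits S.trail) (S.N ∪ S.U) := by
  obtain ⟨Γ, N, U, β, k, D⟩ := S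
  simp only at hS
  subst hS
  rintro D ⟨E, hE, δ, rfl, hg⟩ hD
  -- Conflict requires an irreducible substitution; normalization supplies one that still gives a
  -- `β`-false instance.
  obtain ⟨δ', hi, hg', hδ'⟩ := exists_normalized hlt (lits Γ) hg
  have hD' : ClauseBetaFalse lt β (lits Γ) (Clause.subst E δ') := by
    rw [clauseBetaFalse_iff] at hD ⊢
    intro L' hL'
    obtain ⟨L, hL, rfl⟩ := Multiset.mem_map.1 hL'
    obtain ⟨h1, h2⟩ := hD _ (Multiset.mem_map_of_mem _ hL)
    obtain ⟨d1, d2, -⟩ := hδ' L hL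
    exact ⟨d2 β h1, d1 h2⟩
  by_cases hl : clauseLevel Γ (Clause.subst E δ') = 0
  · exact h ⟨_, .conflict_bot hE hg' hD' hi hl⟩
  · exact h ⟨_, .conflict hE hg' hD' hi hl⟩

theorem Clause.subst_subst_of_comp_eq {μ σ : Subst Sg V} (h : μ.comp σ = σ) (C : Clause Sg V) :
    Clause.subst (Clause.subst C μ) σ = Clause.subst C σ := by
  rw [← Clause.subst_comp, h]

theorem Clause.subst_subset {C D : Clause Sg V} (h : D ≤ C) (σ : Subst Sg V) :
    Clause.subst D σ ⊆ Clause.subst C σ :=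
  Multiset.subset_of_le (Multiset.map_le_map h)

/-- Every rule application preserves the invariants, provided that Conflict has precedence. -/
theorem Step.invariant (hlt : DesiredOrdering lt) {R : Rule} {S S' : State Sg V}
    (h : Step lt R S S') (hS : S.Invariant lt)
    (hc : R ≠ .conflict → S.status = .top → NoConflict lt S.β (lits S.trail) (S.N ∪ S.U)) :
    S'.Invariant lt := by
  obtain ⟨hT, hk, hN, hC⟩ := hS
  have sub : ∀ {Γ : List (AnnLit Sg V)} {β : Sg.Term V} {C D : Clause Sg V},
      D ⊆ C → (Clause.Ground C ∧ ClauseBetaFalse lt β (lits Γ) C) →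
      Clause.Ground D ∧ ClauseBetaFalse lt β (lits Γ) D :=
    fun hD h => ⟨fun L hL => h.1 L (hD hL), h.2.of_subset hD⟩
  cases h with
  | @propagate Γ N U β k C₀ b s t E σ μ P I hmem hg hf hE hμ hu hb hi hP hI =>
    simp only at hk
    subst hk
    have hμσ : μ.comp σ = σ := hμ.comp_eq (by
      rintro q ⟨e, he, rfl | rfl⟩
      · exact (hE e he).1
      · exact (hE e he).2)
    rw [Clause.subst_subst_of_comp_eq hμσ, clauseBelow_iff] at hb
    have hmemL : (⟨b, s(s, t)⟩ : Literal Sg V).subst σ ∈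
        Clause.subst (C₀ + {⟨b, s(s, t)⟩}) σ := by
      rw [Clause.subst_add, Clause.subst_singleton]; simp
    have hsound : SoundClosure lt β (lits Γ) ⟨b, s(s, t)⟩ C₀ σ := by
      refine ⟨⟨hg _ hmemL, hb _ hmemL⟩, fun K hK => ?_⟩
      have hK' := Clause.subst_subset (Multiset.le_add_right C₀ {⟨b, s(s, t)⟩}) σ hK
      exact ⟨hg _ hK', hb _ hK', hf _ hK⟩
    have hLμ : (Literal.subst ⟨b, s(s, t)⟩ μ).subst σ = Literal.subst ⟨b, s(s, t)⟩ σ := by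
      rw [← Literal.subst_comp, hμσ]
    refine ⟨hT.append_propagated hlt ?_ ?_ hP hI, by simp only [lastLevel_append],
      NoConflict.of_append hN (hc (by simp) rfl), fun C σ h => by cases h⟩
    · exact hsound.of_subst_eq hLμ (Clause.subst_subst_of_comp_eq hμσ C₀)
    · rw [AnnLit.ground, hLμ]; exact hu
  | @decide Γ N U β k C₀ L σ P I hmem hg hf hu hb hi hP hI =>
    simp only at hk
    subst hk
    have hmemL : L.subst σ ∈ Clause.subst (C₀ + {L}) σ := by
      rw [Clause.subst_add, Clause.subst_singleton]; simp
    refine ⟨hT.append_decision hlt (A := ⟨lastLevel Γ + 1, L, C₀, σ⟩) (hg _ hmemL)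
      (clauseBelow_iff.1 hb _ hmemL) hu hP hI, by simp only [lastLevel_append],
      NoConflict.of_append hN (hc (by simp) rfl), fun C σ h => by cases h⟩
  | conflict_bot => exact ⟨hT, hk, hN, fun C σ h => by cases h⟩
  | conflict hmem hg hf hi hl =>
    refine ⟨hT, hk, hN, fun C σ h => ?_⟩
    cases h
    exact ⟨hg, hf⟩
  | @skip Γ K A N U β k C σ hf =>
    have e : Γ ++ [K, A] = (Γ ++ [K]) ++ [A] := by simp
    simp only [e] at hT hN hC
    refine ⟨hT.prefix, (lastLevel_append _ _).symm, NoConflict.of_prefix hN, fun C' σ' h => ?_⟩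
    cases h
    exact ⟨(hC _ _ rfl).1, hf⟩
  | exploreRefutation _ _ _ _ hg _ hf =>
    refine ⟨hT, hk, hN, fun C σ h => ?_⟩
    cases h
    exact ⟨hg, hf⟩
  | @factorize Γ N U β k C b s t s' t' σ μ hs ht hμ =>
    refine ⟨hT, hk, hN, fun C' σ' h => ?_⟩
    cases h
    have hμσ : μ.comp σ = σ := hμ.comp_eq (by
      rintro q (rfl | rfl)
      · exact hs
      · exact ht)
    rw [Clause.subst_subst_of_comp_eq hμσ]
    exact sub (Clause.subst_subset (Multiset.le_add_right _ _) σ) (hC _ _ rfl)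
  | @equalityResolution Γ N U β k C s t σ μ hs hμ =>
    refine ⟨hT, hk, hN, fun C' σ' h => ?_⟩
    cases h
    have hμσ : μ.comp σ = σ := hμ.comp_eq (by
      rintro q rfl
      exact hs)
    rw [Clause.subst_subst_of_comp_eq hμσ]
    exact sub (Clause.subst_subset (Multiset.le_add_right _ _) σ) (hC _ _ rfl)
  | @backtrack_decision Γ Γ' K N U β k C L σ hl hex hno hd =>
    refine ⟨hT.prefix, ?_, ?_, fun C σ h => by cases h⟩
    · simp only [IsDecision] at hd ⊢
      omega
    · rintro m hm D ⟨E, hE, τ, rfl, hg⟩ hD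
      rw [← Set.union_assoc] at hE
      -- Old clauses have no false instance in proper prefixes of the old trail; for the learned
      -- clause this is the side condition of Backtrack.
      rcases hE with hE | rfl
      · exact NoConflict.of_prefix hN m hm _ ⟨E, hE, τ, rfl, hg⟩ hD
      · exact hno ⟨τ, hg, hD.mono (lits_take_subset_lits _ _)⟩
  | @backtrack_propagated Γ Γ' K N U β k C L σ hl hex hno hd =>
    refine ⟨hT.prefix, ?_, ?_, fun C σ h => by cases h⟩
    -- A literal that is not a decision has the level of its predecessor, so the level of `K` is
    -- also that of the remaining trail.
    · rcases hT.annotation Γ.length K (by simp) with ⟨h, -⟩ | ⟨h, -⟩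
      · simpa using h
      · exact absurd (by simpa using h) hd
    · rintro m hm D ⟨E, hE, τ, rfl, hg⟩ hD
      rw [← Set.union_assoc] at hE
      rcases hE with hE | rfl
      · exact NoConflict.of_prefix hN m hm _ ⟨E, hE, τ, rfl, hg⟩ hD
      · exact hno ⟨τ, hg, hD.mono (lits_take_subset_lits _ _)⟩
  | grow =>
    exact ⟨annotatedTrail_nil, rfl, fun m hm => by simp at hm, fun C σ h => by cases h⟩

theorem IsRegularRun.invariant (hlt : DesiredOrdering lt) {N : Set (Clause Sg V)} {n : ℕ}
    {S : ℕ → State Sg V} {r : ℕ → Rule} (hrun : IsRegularRun lt N n S r) :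
    ∀ i ≤ n, (S i).Invariant lt := by
  intro i
  induction i with
  | zero =>
    intro _
    obtain ⟨β, -, h⟩ := hrun.init
    rw [h]
    exact ⟨annotatedTrail_nil, rfl, fun m hm => by simp at hm, fun C σ h => by cases h⟩
  | succ i ih =>
    intro hi
    refine (hrun.step i hi).invariant hlt (ih (by omega)) fun hr ht => ?_
    exact noConflict_of_not_applicable hlt ht fun h => hr (hrun.conflict_first i hi h)

/-! ### Conflict resolution -/

theorem State.not_inConflict_of_top {S : State Sg V} (h : S.status = .top) : ¬ S.InConflict := by
  rintro ⟨C, σ, h'⟩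
  rw [h] at h'
  cases h'

/-- The rules of conflict resolution only shorten the trail. -/
theorem Step.conflict_resolution {R : Rule} {S S' : State Sg V} (h : Step lt R S S')
    (hS : S.InConflict) (hS' : S'.InConflict) :
    R ≠ .conflict ∧ S'.N = S.N ∧ S'.U = S.U ∧ S'.β = S.β ∧
      ∃ Δ, S.trail = S'.trail ++ Δ ∧ (R = .skip ↔ Δ ≠ []) := by
  obtain ⟨C, σ, hS⟩ := hS
  obtain ⟨C', σ', hS'⟩ := hS'
  cases h with
  | propagate => cases hS
  | decide => cases hS
  | conflict_bot => cases hS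
  | conflict => cases hS
  | @skip Γ K A => exact ⟨by simp, rfl, rfl, rfl, [A], by simp, by simp⟩
  | exploreRefutation => exact ⟨by simp, rfl, rfl, rfl, [], by simp, by simp⟩
  | factorize => exact ⟨by simp, rfl, rfl, rfl, [], by simp, by simp⟩
  | equalityResolution => exact ⟨by simp, rfl, rfl, rfl, [], by simp, by simp⟩
  | backtrack_decision => cases hS'
  | backtrack_propagated => cases hS'
  | grow => cases hS

theorem Step.enter_conflict {R : Rule} {S S' : State Sg V} (h : Step lt R S S')
    (hS : ¬ S.InConflict) (hS' : S'.InConflict) :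
    R = .conflict ∧ S'.N = S.N ∧ S'.U = S.U ∧ S'.β = S.β ∧ S'.trail = S.trail := by
  obtain ⟨C', σ', hS'⟩ := hS'
  cases h with
  | propagate => cases hS'
  | decide => cases hS'
  | conflict_bot => cases hS'
  | conflict => exact ⟨rfl, rfl, rfl, rfl, rfl⟩
  | skip => exact absurd ⟨_, _, rfl⟩ hS
  | exploreRefutation => exact absurd ⟨_, _, rfl⟩ hS
  | factorize => exact absurd ⟨_, _, rfl⟩ hS
  | equalityResolution => exact absurd ⟨_, _, rfl⟩ hS
  | backtrack_decision => cases hS'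
  | backtrack_propagated => cases hS'
  | grow => cases hS'

theorem Step.status_of_conflict {S S' : State Sg V} (h : Step lt .conflict S S') :
    S.status = .top := by
  cases h <;> rfl

/-- Within a conflict resolution phase, the trail is only shortened by Skip. -/
theorem IsRun.conflict_resolution {N : Set (Clause Sg V)} {n : ℕ} {S : ℕ → State Sg V}
    {r : ℕ → Rule} (hrun : IsRun lt N n S r) {i b : ℕ} (hib : i ≤ b) (hb : b ≤ n)
    (h : ∀ j, i ≤ j → j ≤ b → (S j).InConflict) :
    (S b).N = (S i).N ∧ (S b).U = (S i).U ∧ (S b).β = (S i).β ∧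
      ∃ Δ, (S i).trail = (S b).trail ++ Δ ∧
        ((∃ j, i ≤ j ∧ j < b ∧ r j = .skip) ↔ Δ ≠ []) := by
  induction b, hib using Nat.le_induction with
  | base =>
    refine ⟨rfl, rfl, rfl, [], by simp, ?_⟩
    constructor
    · rintro ⟨j, h1, h2, -⟩
      omega
    · intro h
      exact absurd rfl h
  | succ b hib ih =>
    obtain ⟨i1, i2, i3, Δ, i4, i5⟩ := ih (by omega) fun j h1 h2 => h j h1 (by omega)
    obtain ⟨-, s1, s2, s3, Δ', s4, s5⟩ := (hrun.step b (by omega)).conflict_resolution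
      (h b hib (by omega)) (h (b + 1) (by omega) le_rfl)
    refine ⟨s1.trans i1, s2.trans i2, s3.trans i3, Δ' ++ Δ, by rw [i4, s4, List.append_assoc], ?_⟩
    constructor
    · rintro ⟨j, h1, h2, h3⟩ h0
      obtain ⟨h4, h5⟩ := List.append_eq_nil_iff.1 h0
      rcases Nat.lt_succ_iff_lt_or_eq.1 h2 with h6 | rfl
      · exact i5.1 ⟨j, h1, h6, h3⟩ h5
      · exact s5.1 h3 h4
    · intro h0
      by_cases h4 : Δ = []
      · have h5 : Δ' ≠ [] := fun h5 => h0 (by rw [h4, h5]; rfl)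
        exact ⟨b, hib, Nat.lt_succ_self b, s5.2 h5⟩
      · obtain ⟨j, h1, h2, h3⟩ := i5.2 h4
        exact ⟨j, h1, h2.trans (Nat.lt_succ_self b), h3⟩

/-- Every conflict resolution phase starts with an application of Conflict. -/
theorem IsRun.exists_lastConflict {N : Set (Clause Sg V)} {n : ℕ} {S : ℕ → State Sg V}
    {r : ℕ → Rule} (hrun : IsRun lt N n S r) {b : ℕ} (hb : b ≤ n) (h : (S b).InConflict) :
    ∃ c, LastConflict r c b ∧ ∀ j, c < j → j ≤ b → (S j).InConflict := by
  induction b with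
  | zero =>
    obtain ⟨β, -, h0⟩ := hrun.init
    exact absurd h (State.not_inConflict_of_top (by rw [h0]))
  | succ b ih =>
    have hstep := hrun.step b hb
    by_cases hc : (S b).InConflict
    · obtain ⟨c, ⟨h1, h2, h3⟩, h4⟩ := ih (by omega) hc
      refine ⟨c, ⟨by omega, h2, fun j hj hjb => ?_⟩, fun j hj hjb => ?_⟩
      · rcases Nat.lt_succ_iff_lt_or_eq.1 hjb with h5 | rfl
        · exact h3 j hj h5
        · exact (hstep.conflict_resolution hc h).1
      · rcases Nat.le_succ_iff.1 hjb with h5 | rfl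
        · exact h4 j hj h5
        · exact h
    · obtain ⟨h1, -⟩ := hstep.enter_conflict hc h
      refine ⟨b, ⟨Nat.lt_succ_self b, h1, fun j h2 h3 => by omega⟩, fun j h2 h3 => ?_⟩
      obtain rfl : j = b + 1 := by omega
      exact h

theorem Step.decide_spec {S S' : State Sg V} (h : Step lt .decide S S') :
    S.status = .top ∧ S'.N = S.N ∧ S'.U = S.U ∧ S'.β = S.β ∧
      ∃ A, S'.trail = S.trail ++ [A] ∧ A.level = S.k + 1 := by
  cases h
  exact ⟨rfl, rfl, rfl, rfl, _, rfl, rfl⟩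

theorem Step.backtrack_spec {S S' : State Sg V} (h : Step lt .backtrack S S') {C : Clause Sg V}
    {σ : Subst Sg V} (hC : S.status = .closure C σ) :
    ∃ D L, C = D + {L} ∧ clauseLevel S.trail (Clause.subst D σ) < S.k := by
  cases h <;> cases hC <;> exact ⟨_, _, rfl, ‹_›⟩

theorem Literal.subst_id (L : Literal Sg V) : L.subst Subst.id = L := by
  obtain ⟨b, s, t, rfl⟩ := L.exists_mk
  change (⟨b, s(s.subst _, t.subst _)⟩ : Literal Sg V) = _
  rw [show (Subst.id : Subst Sg V).map = FirstOrder.Language.Term.var from rfl, subst_var, subst_var]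

theorem Clause.subst_id (C : Clause Sg V) : Clause.subst C Subst.id = C := by
  conv_rhs => rw [← Multiset.map_id C]
  exact Multiset.map_congr rfl fun L _ => L.subst_id

/-- An undefined irreducible literal can be propagated with every clause that has an instance in
which all other literals are false. -/
theorem exists_propagate (hlt : DesiredOrdering lt) {S : State Sg V} (hS : S.status = .top)
    {B : Literal Sg V} {D : Clause Sg V} (hg : B ::ₘ D ∈ gnd (S.N ∪ S.U))
    (hB : LitBelow lt S.β B) (hu : ¬ LitDefined (lits S.trail) B)
    (hi : LitIrreducible (conv lt (lits S.trail)) B)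
    (hD : ClauseBetaFalse lt S.β (lits S.trail) D) :
    ∃ S' A, Step lt .propagate S S' ∧ S'.trail = S.trail ++ [A] ∧ A.clause ∈ S.N ∪ S.U ∧
      A.ground = B := by
  obtain ⟨Γ, N, U, β, k, st⟩ := S
  simp only at hS hg hB hu hi hD ⊢
  subst hS
  obtain ⟨E, hE, δ, hδ, hground⟩ := hg
  obtain ⟨L, C, rfl, rfl, rfl⟩ := Clause.exists_of_subst_eq_cons hδ.symm
  rw [hδ] at hground
  obtain ⟨δ', hi', hg', hδ'⟩ := exists_normalized hlt (lits Γ) hground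
  -- Normalization does not touch the irreducible literal, so exactly `B` is propagated and its
  -- reduction chain is a single closure.
  have hL' : L.subst δ' = L.subst δ := (hδ' L (Multiset.mem_cons_self _ _)).2.2 hi
  have hC' : ClauseBetaFalse lt β (lits Γ) (Clause.subst C δ') := by
    rw [clauseBetaFalse_iff] at hD ⊢
    intro K' hK'
    obtain ⟨K, hK, rfl⟩ := Multiset.mem_map.1 hK'
    obtain ⟨h1, h2⟩ := hD _ (Multiset.mem_map_of_mem _ hK)
    obtain ⟨d1, d2, -⟩ := hδ' K (Multiset.mem_cons_of_mem hK)
    exact ⟨d2 β h1, d1 h2⟩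
  obtain ⟨b, s, t, rfl⟩ := L.exists_mk
  have e : C + {⟨b, s(s, t)⟩} = ⟨b, s(s, t)⟩ ::ₘ C := by
    rw [add_comm, Multiset.singleton_add]
  have hP : IsReductionChainApplication lt Γ
      ⟨k, Literal.subst ⟨b, s(s, t)⟩ Subst.id, Clause.subst C Subst.id, δ'⟩
      [.base ⟨b, s, t⟩ (Clause.rename C 1) (δ'.conj 1)] := by
    rw [Literal.subst_id, Clause.subst_id]
    exact isReductionChainApplication_singleton k (by rw [hL']; exact hi)
  -- No duplicates of the literal are merged, so the unifier is the identity and the annotation is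
  -- the clause of `N ∪ U` itself.
  refine ⟨_, _, Step.propagate (C₀ := C) (b := b) (s := s) (t := t) (E := []) (σ := δ')
    (μ := Subst.id) ?_ ?_ hC'.2 (by simp) ?_ ?_ ?_ hi' hP rfl, rfl, ?_, ?_⟩
  · simpa [e] using hE
  · rw [e]; exact hg'
  · simpa using isMGU_id_empty
  · rw [hL']; exact Or.inr hu
  · rw [e, Clause.subst_id, clauseBelow_iff]
    intro K hK
    rw [Clause.subst_cons, Multiset.mem_cons] at hK
    rcases hK with rfl | hK
    · rw [hL']; exact hB
    · exact (clauseBetaFalse_iff.1 hC' K hK).1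
  · simpa [AnnLit.clause, RewriteStep.lit, RewriteStep.rest, EqLit.toLit, Clause.rename_one]
      using hE
  · simp only [AnnLit.ground, RewriteStep.lit, RewriteStep.sub, EqLit.toLit, Subst.conj_one]
    exact hL'

end Runs

/-! ### Learned clauses and justifications of propagated literals. -/

section Main

variable {Sg : FirstOrder.Language.{u, v}} {V : Type w} {lt : Sg.Term V → Sg.Term V → Prop}

/-! ### Learned clauses -/

/-- Levels do not decrease along a trail, so no literal of level zero can follow one of positive
level. -/
theorem zeroBefore_of_lastLevel_pos {Γ Δ : List (AnnLit Sg V)} (h : IsTrail lt (Γ ++ Δ))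
    (hl : 0 < lastLevel Γ) : ZeroBefore (Γ ++ Δ) Γ.length := by
  intro i A hA h0
  by_contra hi
  rcases List.eq_nil_or_concat Γ with rfl | ⟨Γ', B, rfl⟩
  · simp [lastLevel_nil] at hl
  · rw [List.concat_eq_append] at *
    rw [lastLevel_append] at hl
    have hB : (Γ' ++ [B] ++ Δ)[Γ'.length]? = some B := by simp
    have := h.level_mono hB hA (by simp at hi; omega)
    omega

theorem le_clauseLevel {Γ : List (AnnLit Sg V)} {C : Clause Sg V} {L : Literal Sg V} (hL : L ∈ C) :
    litLevel Γ L ≤ clauseLevel Γ C := Multiset.le_sup (Multiset.mem_map_of_mem _ hL)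

/-- The instance of a learned clause is not redundant if Skip was applied. -/
theorem State.Invariant.not_groundRedundant {S : State Sg V} (hS : S.Invariant lt)
    {Γ Δ : List (AnnLit Sg V)} (hΓ : S.trail = Γ ++ Δ) (hΔ : Δ ≠ []) (hl : 0 < lastLevel Γ)
    {Γ' : List (AnnLit Sg V)} (hΓ' : IsTrail lt (Γ ++ Γ')) {C : Clause Sg V}
    (hC : ClauseBetaFalse lt S.β (lits Γ) C) :
    ¬ GroundRedundant (TrailLT lt S.β (Γ ++ Γ')) (gnd (S.N ∪ S.U)) C := by
  have e : (Γ ++ Γ').take Γ.length = Γ := by simp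
  refine not_groundRedundant_of_noConflict hΓ' (zeroBefore_of_lastLevel_pos hΓ' hl)
    (by rwa [e]) ?_
  rw [e]
  -- Since `Δ` is not empty, `Γ` is a proper prefix of the trail and therefore contains no conflict.
  have := hS.noConflict Γ.length (by
    rw [hΓ, List.length_append]
    have := List.length_pos_iff.2 hΔ
    omega)
  rwa [hΓ, List.take_left'] at this
  rfl

/-- The instance of a learned clause is not redundant if the last trail literal is a decision
literal that could not be preceded by a propagation of its complement. -/
theorem State.Invariant.not_groundRedundant_of_decide (hlt : DesiredOrdering lt) {T S : State Sg V}
    (hS : S.Invariant lt) (hT : T.status = .top) (hN : S.N = T.N) (hU : S.U = T.U) (hβ : S.β = T.β)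
    {A : AnnLit Sg V} (hA : S.trail = T.trail ++ [A]) (hl : lastLevel T.trail < A.level)
    (hreg : ¬ ∃ S' B, Step lt .propagate T S' ∧ S'.trail = T.trail ++ [B] ∧
      B.clause ∈ T.N ∪ T.U ∧ A.ground = B.ground.comp)
    {C : Clause Sg V} {L : Literal Sg V} (hC : ClauseBetaFalse lt S.β (lits S.trail) (C + {L}))
    (hlevel : clauseLevel S.trail C < A.level) (hmem : A.ground.comp ∈ C + {L}) :
    ¬ GroundRedundant (TrailLT lt S.β S.trail) (gnd (S.N ∪ S.U)) (C + {L}) := by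
  intro hred
  have hΓ := hS.trail.isTrail
  have hget : S.trail[T.trail.length]? = some A := by rw [hA]; simp
  have htake : S.trail.take T.trail.length = T.trail := by rw [hA]; simp
  have hbelow : LitBelow lt S.β A.ground :=
    (hS.trail.sound (List.mem_of_getElem? hget)).1.2
  -- The complement of the decision literal has the highest level, while `C` has a lower one. So the
  -- complement must be the distinguished literal `L`.
  have hcomp : A.ground.comp ∉ C := by
    intro h
    have := le_clauseLevel (Γ := S.trail) h
    rw [hΓ.litLevel_comp_ground hget] at this
    omega
  have hL : L = A.ground.comp := by
    rcases Multiset.mem_add.1 hmem with h | h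
    · exact absurd h hcomp
    · exact (Multiset.mem_singleton.1 h).symm
  subst hL
  have hbefore : ∀ i B, S.trail[i]? = some B → B.level < A.level → i < T.trail.length := by
    intro i B hB hBA
    by_contra hi
    have := hΓ.level_mono hget hB (not_lt.1 hi)
    omega
  have hm : ZeroBefore S.trail T.trail.length := fun i B hB h0 => hbefore i B hB (by omega)
  -- The literals of `C` have lower levels, hence are already defined before the decision. They are
  -- false there because they are false in the consistent longer trail.
  have hR : ClauseBetaFalse lt S.β (lits T.trail) C := by
    rw [clauseBetaFalse_iff] at hC ⊢
    intro K hK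
    obtain ⟨h1, h2⟩ := hC K (Multiset.mem_add.2 (Or.inl hK))
    have hK' := le_clauseLevel (Γ := S.trail) hK
    have hd : LitDefined (lits (S.trail.take T.trail.length)) K :=
      LitDefined.take_of_level hΓ (Or.inr h2) fun i B hB h => hbefore i B hB (by omega)
    rw [htake] at hd
    refine ⟨h1, hd.resolve_left fun ht => hΓ.consistent.not_true_of_false h2 (ht.mono ?_)⟩
    rw [hA, lits_append]
    exact List.subset_append_left _ _
  have hno := hS.noConflict T.trail.length (List.getElem?_eq_some_iff.1 hget).1
  rw [add_comm, Multiset.singleton_add] at hred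
  obtain ⟨D, hD, hDf⟩ := hred.exists_comp hΓ hm hget hbelow (by rwa [htake]) hno
  rw [htake] at hDf
  have hu := hΓ.undefined _ _ hget
  have hi := hΓ.irreducible _ _ hget
  rw [htake] at hu hi
  rw [hN, hU] at hD
  rw [hβ] at hDf hbelow
  -- The decision literal and its complement have the same sides, so the complement is undefined and
  -- irreducible as well. It can therefore be propagated where the decision was made.
  obtain ⟨S', B, h1, h2, h3, h4⟩ := exists_propagate hlt hT hD (litBelow_comp.2 hbelow)
    (fun h => hu (litDefined_comp.1 h)) hi hDf
  exact hreg ⟨S', B, h1, h2, h3, by rw [h4, Literal.comp_comp]⟩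

/-- If Skip was applied between Conflict and Backtrack, the clause is false in a proper prefix of
the trail at Conflict. Otherwise Conflict followed Decide, the trail never changed during the phase,
and the decision argument applies. -/
theorem IsRegularRun.not_groundRedundant (hlt : DesiredOrdering lt) {N : Set (Clause Sg V)} {n : ℕ}
    {S : ℕ → State Sg V} {r : ℕ → Rule} (hrun : IsRegularRun lt N n S r) {b : ℕ} (hb : b < n)
    (hr : r b = .backtrack) {C : Clause Sg V} {σ : Subst Sg V} (hC : (S b).status = .closure C σ)
    {i : ℕ} (hib : i ≤ b) (hi : ∀ j, i ≤ j → j ≤ b → (S j).InConflict) :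
    ¬ GroundRedundant (TrailLT lt (S i).β (S i).trail) (gnd ((S b).N ∪ (S b).U))
      (Clause.subst C σ) := by
  have hstep := hrun.step b hb
  rw [hr] at hstep
  obtain ⟨D, L, rfl, hlevel⟩ := hstep.backtrack_spec hC
  have hinv := hrun.invariant hlt b hb.le
  obtain ⟨-, hf⟩ := hinv.closure _ _ hC
  -- The level of the remaining literals is strictly below `k`, which forces `k` to be positive.
  have hpos : 0 < lastLevel (S b).trail := by rw [← hinv.level]; omega
  obtain ⟨c, hc, hconf⟩ := hrun.toIsRun.exists_lastConflict hb.le ⟨_, _, hC⟩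
  have hcb := hc.1
  have hcstep := hrun.step c (by omega)
  rw [hc.2.1] at hcstep
  have hctop := hcstep.status_of_conflict
  -- The status is `⊤` when Conflict is applied, so the part of the phase considered cannot reach
  -- back to that state.
  have hci : c + 1 ≤ i := by
    by_contra h
    exact State.not_inConflict_of_top hctop (hi c (by omega) hcb.le)
  obtain ⟨-, n1, u1, b1, t1⟩ := hcstep.enter_conflict (State.not_inConflict_of_top hctop)
    (hconf (c + 1) (by omega) hcb)
  obtain ⟨n2, u2, b2, Δ, t2, hΔ⟩ := hrun.toIsRun.conflict_resolution (i := c + 1) (b := b) hcb hb.le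
    fun j h1 h2 => hconf j h1 h2
  obtain ⟨n3, u3, b3, Γ', t3, hΓ'⟩ := hrun.toIsRun.conflict_resolution hib hb.le hi
  have hinvc := hrun.invariant hlt (c + 1) (by omega)
  have hinvi := hrun.invariant hlt i (by omega)
  by_cases hskip : ∃ j, c + 1 ≤ j ∧ j < b ∧ r j = .skip
  -- The trail at Backtrack is a proper prefix of the one at Conflict and also a prefix of the one
  -- that induces the ordering; the two extensions may differ.
  · rw [n2, u2, ← b3, b2, t3]
    rw [b2] at hf
    exact hinvc.not_groundRedundant t2 (hΔ.1 hskip) hpos (t3 ▸ hinvi.trail.isTrail) hf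
  · obtain ⟨d, rfl, hd⟩ : AfterDecide r c :=
      (hrun.skip_once b hb hr c hc).resolve_right fun ⟨j, h1, h2, h3⟩ => hskip ⟨j, h1, h2, h3⟩
    have hΔ0 : Δ = [] := by
      by_contra h
      exact hskip (hΔ.2 h)
    have hΓ0 : Γ' = [] := by
      by_contra h
      obtain ⟨j, h1, h2, h3⟩ := hΓ'.2 h
      exact hskip ⟨j, hci.trans h1, h2, h3⟩
    rw [hΔ0, List.append_nil] at t2
    rw [hΓ0, List.append_nil] at t3
    have hdstep := hrun.step d (by omega)
    rw [hd] at hdstep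
    obtain ⟨dtop, n4, u4, b4, A, t4, hA⟩ := hdstep.decide_spec
    have hAb : (S b).trail = (S d).trail ++ [A] := by rw [← t2, t1, t4]
    have hinvd := hrun.invariant hlt d (by omega)
    obtain ⟨A', hA', hmem⟩ := hrun.backtrack_after_decide b hb hr (d + 1) hc ⟨d, rfl, hd⟩ _ _ hC
    obtain rfl : A = A' := by rw [hAb] at hA'; simpa using hA'
    have hkA : (S b).k = A.level := by rw [hinv.level, hAb, lastLevel_append]
    rw [← b3, t3]
    rw [Clause.subst_add, Clause.subst_singleton] at hf hmem ⊢
    refine hinv.not_groundRedundant_of_decide hlt dtop (by rw [n2, n1, n4]) (by rw [u2, u1, u4])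
      (by rw [b2, b1, b4]) hAb ?_ (hrun.no_bad_decision d (by omega) hd A t4) hf ?_ hmem
    · rw [hA, hinvd.level]; exact Nat.lt_succ_self _
    · rwa [← hkA]

/-! ### Justifications of propagated literals -/

/-- Let `R` be false to the left of the trail literal `A`. If instances of clauses that are smaller
than `A ∨ R` entail this clause, then one of them can justify `A`. -/
theorem State.Invariant.exists_canJustify {S : State Sg V} (hS : S.Invariant lt) {j : ℕ}
    {A : AnnLit Sg V} (hA : S.trail[j]? = some A) (hl : 0 < A.level) {R : Clause Sg V}
    (hR : ClauseBetaFalse lt S.β (lits (S.trail.take j)) R) {G : Set (Clause Sg V × Subst Sg V)}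
    (hG : ∀ E ∈ G, E.1 ∈ S.N ∪ S.U ∧ Clause.Ground (Clause.subst E.1 E.2) ∧
      MulExt (TrailLT lt S.β S.trail) (Clause.subst E.1 E.2) (A.ground ::ₘ R))
    (h : Entails {D | ∃ E ∈ G, D = Clause.subst E.1 E.2} (A.ground ::ₘ R)) :
    ∃ E ∈ G, CanJustify lt S.β S.trail j A E.1 E.2 := by
  have hΓ := hS.trail.isTrail
  have hj := (List.getElem?_eq_some_iff.1 hA).1
  have hm : ZeroBefore S.trail j := by
    intro i B hB h0
    by_contra hi
    have := hΓ.level_mono hA hB (not_lt.1 hi)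
    omega
  obtain ⟨D, ⟨E, hE, hD⟩, hf⟩ := h.exists_propagating hΓ hm hA
    (hS.trail.sound (List.mem_of_getElem? hA)).1.2 hR
    (by rintro D ⟨E, hE, rfl⟩; exact (hG E hE).2.2)
    (by
      rintro D ⟨E, hE, rfl⟩
      exact hS.noConflict j hj _ ⟨E.1, (hG E hE).1, E.2, rfl, (hG E hE).2.1⟩)
  exact ⟨E, hE, canJustify_of_subst_eq_cons hΓ hA hD.symm (hG E hE).2.1 hf⟩

theorem CanJustify.exists_eq {β : Sg.Term V} {Γ : List (AnnLit Sg V)} {j : ℕ} {A : AnnLit Sg V}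
    {E : Clause Sg V} {δ : Subst Sg V} (h : CanJustify lt β Γ j A E δ) :
    ∃ R, Clause.subst E δ = A.ground ::ₘ R ∧ ClauseBetaFalse lt β (lits (Γ.take j)) R := by
  obtain ⟨K, D, rfl, hK, hD, -⟩ := h
  exact ⟨_, by rw [Clause.subst_cons, hK], hD⟩

theorem State.Invariant.exists_canJustify_of_entailed {S : State Sg V} (hS : S.Invariant lt) {j : ℕ}
    {A : AnnLit Sg V} (hA : S.trail[j]? = some A) (hl : 0 < A.level) {R : Clause Sg V}
    (hR : ClauseBetaFalse lt S.β (lits (S.trail.take j)) R)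
    (h : EntailedBySmaller (TrailLT lt S.β S.trail) (gnd (S.N ∪ S.U)) (A.ground ::ₘ R)) :
    ∃ E ∈ S.N ∪ S.U, ∃ δ, CanJustify lt S.β S.trail j A E δ ∧
      MulExt (TrailLT lt S.β S.trail) (Clause.subst E δ) (A.ground ::ₘ R) := by
  obtain ⟨E, hE, hj⟩ := hS.exists_canJustify hA hl hR
    (G := {E | E.1 ∈ S.N ∪ S.U ∧ Clause.Ground (Clause.subst E.1 E.2) ∧
      MulExt (TrailLT lt S.β S.trail) (Clause.subst E.1 E.2) (A.ground ::ₘ R)})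
    (fun E hE => hE) (h.mono (by
      rintro D ⟨⟨E, hE, δ, rfl, hg⟩, hD⟩
      exact ⟨(E, δ), ⟨hE, hg, hD⟩, rfl⟩))
  exact ⟨E.1, hE.1, E.2, hj, hE.2.2⟩

/-- A minimal clause that can justify the literal is not entailed by smaller clauses. -/
theorem State.Invariant.exists_canJustify_not_entailed (hlt : DesiredOrdering lt) {S : State Sg V}
    (hS : S.Invariant lt) {j : ℕ} {A : AnnLit Sg V} (hA : S.trail[j]? = some A) (hl : 0 < A.level)
    {R : Clause Sg V} (hR : ClauseBetaFalse lt S.β (lits (S.trail.take j)) R)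
    (h : EntailedBySmaller (TrailLT lt S.β S.trail) (gnd (S.N ∪ S.U)) (A.ground ::ₘ R)) :
    ∃ E ∈ S.N ∪ S.U, ∃ δ, CanJustify lt S.β S.trail j A E δ ∧
      ¬ EntailedBySmaller (TrailLT lt S.β S.trail) (gnd (S.N ∪ S.U)) (Clause.subst E δ) := by
  obtain ⟨E₀, hE₀, δ₀, hj₀, -⟩ := hS.exists_canJustify_of_entailed hA hl hR h
  -- A justifying instance is chosen minimal. If it were entailed by smaller clauses, the same
  -- argument with its own remainder in place of `R` would give a smaller justifying instance.
  obtain ⟨D, ⟨E, hE, δ, hj, rfl⟩, hmin⟩ :=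
    (wellFounded_mulExt (wellFounded_trailLT hlt hS.trail.isTrail (β := S.β))).has_min
      {D | ∃ E ∈ S.N ∪ S.U, ∃ δ, CanJustify lt S.β S.trail j A E δ ∧ D = Clause.subst E δ}
      ⟨_, E₀, hE₀, δ₀, hj₀, rfl⟩
  refine ⟨E, hE, δ, hj, fun hent => ?_⟩
  obtain ⟨R', hR', hf⟩ := hj.exists_eq
  rw [hR'] at hent hmin
  obtain ⟨E', hE', δ', hj', hlt'⟩ := hS.exists_canJustify_of_entailed hA hl hf hent
  exact hmin _ ⟨E', hE', δ', hj', rfl⟩ hlt'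

/-- The annotation of a propagated literal is false to the left of it, except for the literal. -/
theorem State.Invariant.groundClause_eq {S : State Sg V} (hS : S.Invariant lt) {j : ℕ}
    {A : AnnLit Sg V} (hA : S.trail[j]? = some A) (hd : ¬ IsDecision (S.trail.take j) A) :
    ∃ R, A.groundClause = A.ground ::ₘ R ∧
      ClauseBetaFalse lt S.β (lits (S.trail.take j)) R := by
  refine ⟨Clause.subst A.rest A.sub, Clause.subst_cons _ _ _, ?_⟩
  rcases hS.trail.annotation j A hA with ⟨-, h⟩ | ⟨h, -⟩
  · exact clauseBetaFalse_iff.2 fun K hK => (h.2 K hK).2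
  · exact absurd h hd

end Main

end SCLEQ

theorem mainTheorem3 {Sg : FirstOrder.Language.{u, v}} {V : Type w} [Infinite V]
    (lt : Sg.Term V → Sg.Term V → Prop) (hlt : SCLEQ.DesiredOrdering lt)
    (N : Set (SCLEQ.Clause Sg V)) (n : ℕ) (S : ℕ → SCLEQ.State Sg V) (r : ℕ → SCLEQ.Rule)
    (hrun : SCLEQ.IsRegularRun lt N n S r) :
    -- the clause `C` learned by Backtrack is not redundant, and neither is its instance `Cσ`,
    -- for the ordering induced by the trail of any state `S i` of this conflict resolution
    (∀ b < n, r b = .backtrack → ∀ C σ, (S b).status = .closure C σ →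
      ∀ i ≤ b, (∀ j, i ≤ j → j ≤ b → (S j).InConflict) →
        ¬ SCLEQ.Redundant (SCLEQ.TrailLT lt (S i).β (S i).trail) ((S b).N ∪ (S b).U) C ∧
        ¬ SCLEQ.GroundRedundant (SCLEQ.TrailLT lt (S i).β (S i).trail)
            (SCLEQ.gnd ((S b).N ∪ (S b).U)) (C.subst σ)) ∧
    -- only non-redundant clauses have to be considered as justifications on the trail
    (∀ i ≤ n, ∀ (j : ℕ) (A : SCLEQ.AnnLit Sg V), (S i).trail[j]? = some A →
      ¬ SCLEQ.IsDecision ((S i).trail.take j) A → 0 < A.level →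
      (∀ G : Set (SCLEQ.Clause Sg V × SCLEQ.Subst Sg V),
        (∀ E ∈ G, E.1 ∈ (S i).N ∪ (S i).U ∧ (E.1.subst E.2).Ground ∧
          SCLEQ.MulExt (SCLEQ.TrailLT lt (S i).β (S i).trail) (E.1.subst E.2) A.groundClause) →
        SCLEQ.Entails {D | ∃ E ∈ G, D = E.1.subst E.2} A.groundClause →
        ∃ E ∈ G, SCLEQ.CanJustify lt (S i).β (S i).trail j A E.1 E.2) ∧
      (SCLEQ.EntailedBySmaller (SCLEQ.TrailLT lt (S i).β (S i).trail)
          (SCLEQ.gnd ((S i).N ∪ (S i).U)) A.groundClause →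
        ∃ E ∈ (S i).N ∪ (S i).U, ∃ δ : SCLEQ.Subst Sg V,
          SCLEQ.CanJustify lt (S i).β (S i).trail j A E δ ∧
          ¬ SCLEQ.EntailedBySmaller (SCLEQ.TrailLT lt (S i).β (S i).trail)
            (SCLEQ.gnd ((S i).N ∪ (S i).U)) (E.subst δ))) := by
  refine ⟨fun b hb hr C σ hC i hib hi => ?_, fun i hi j A hA hd hl => ?_⟩
  · have h := hrun.not_groundRedundant hlt hb hr hC hib hi
    have hg := ((hrun.invariant hlt b hb.le).closure C σ hC).1
    -- The invariant makes the instance under `σ` ground, so redundancy of the learned clause would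
    -- include redundancy of this instance.
    exact ⟨fun hred => h (hred _ ⟨C, rfl, σ, rfl, hg⟩), h⟩
  · have hS := hrun.invariant hlt i hi
    obtain ⟨R, hA', hR⟩ := hS.groundClause_eq hA hd
    rw [hA']
    exact ⟨fun G hG hent => hS.exists_canJustify hA hl hR hG hent,
      fun hent => hS.exists_canJustify_not_entailed hlt hA hl hR hent⟩
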